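/- **Setting.** Let $P$ and $R$ be finite sets of players and resources. Each resource $r$ has a value $v_r\ge 0$ and is desired by some of the players. An allocation assigns every resource to one player; its value is the minimum over players $p$ of the total value of the resources that $p$ receives and desires, and $\tau^*$ is the maximum value of an allocation. Fix $\delta\in(0,1)$, $\lambda=6+\delta$, $\mu\in(0,1)$ and $\tau$ with $0\le\tau\le\tau^*$. A resource $r$ is *fat* if $v_r\ge\tau/\lambda$, otherwise *thin*; $\mathit{value}(B)=\sum_{r\in B}v_r$. A *fat edge* is $(p,r)$ with $r$ fat and desired by $p$; $G$ is the bipartite graph of fat edges. A *thin edge* is $(p,B)$ with $B$ a set of thin resources desired by $p$ and $\mathit{value}(B)\ge\tau/\lambda$; it covers $p$ and the resources in $B$. A set $B$ is *minimal* if $\mathit{value}(B)\ge\tau/\lambda$ and every proper subset has value $<\tau/\lambda$. A *partial allocation* $(M,\mathcal E)$ is a maximum matching $M$ of $G$ and a set $\mathcal E$ of thin edges $(p,B)$ with $B$ minimal, such that no two edges of $M\cup\mathcal E$ cover the same player and no two edges of $\mathcal E$ share a resource. For a maximum matching $M$ of $G$, let $G_M$ be $G$ with $(p,r)$ directed from $r$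 to $p$ if $(p,r)\in M$ and from $p$ to $r$ otherwise. For sets of players $S,T$, $f_M(S,T)$ is the maximum number of node-disjoint directed paths in $G_M$ from $S$ to $T$; one-node (trivial) paths are allowed. **States.** A state $(M,\mathcal E,\mathcal I,(L_1,\dots,L_\ell))$ consists of $M$, $\mathcal E$, a set $\mathcal I$ of thin edges, and a stack of layers $L_i=(\mathcal X_i,\mathcal Y_i,d_i,z_i)$, where $\mathcal X_i,\mathcal Y_i$ are sets of pairs (player, set of resources) and $d_i,z_i$ are numbers. $I,X_i,Y_i$ are the sets of players covered by $\mathcal I,\mathcal X_i,\mathcal Y_i$, and a subscript $\le k$ denotes the union over indices $1,\dots,k$. A *canonical decomposition* is a partition $\mathcal I=\mathcal I_1\cup\dots\cup\mathcal I_\ell$ (parts may be empty; $I_i$ are the players of $\mathcal I_i$) with $f_M(Y_{\le i},I_{\le i})=f_M(Y_{\le i},I)=|I_{\le i}|=|\mathcal I_{\le i}|$ for all $i\in[1,\ell]$. Layer $L_i$ is *collapsible* if some canonical decomposition has $|I_i|\ge\mu|Y_i|$. **Algorithm.** It starts with any partial allocation $(M,\mathcal E)$ and any player $p_0$ covered by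 neither $M$ nor $\mathcal E$, in the state with $\mathcal I=\emptyset$, $\ell=1$, $L_1=(\emptyset,\{(p_0,\emptyset)\},0,0)$. As long as no layer is collapsible it performs Build; as long as some layer is collapsible it performs Collapse. All choices left open below are arbitrary. *Build.* Start with $\mathcal X_{\ell+1}=\emptyset$. At any moment, a player $p$ is *addable* if $f_M(Y_{\le\ell},X_{\le\ell+1}\cup I\cup\{p\})=f_M(Y_{\le\ell},X_{\le\ell+1}\cup I)+1$; a thin edge $(p,B)$ with $p$ addable is *addable* if $\mathit{value}(B)\in[\tau/\lambda,\tau+\tau/\lambda]$ and $B$ contains no resource covered by $\mathcal X_{\le\ell+1}\cup\mathcal Y_{\le\ell}\cup\mathcal I$. An edge $(p,B)$ is *unblocked* if some $B'\subseteq B$ with $\mathit{value}(B')\ge\tau/\lambda$ contains no resource covered by $\mathcal E$, and *blocked* otherwise. (1) While there is an unblocked addable edge $(p,B)$, add to $\mathcal I$ an edge $(p,B')$ with $B'\subseteq B$ minimal and containing no resource covered by $\mathcal E$. (2) Then, while there is an addable edge: for each player $p$ with an addable edge identify a blocked addable edge $(p,B)$ such that $B\not\subset B'$ for every blocked addable edge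 $(p,B')$, and add one of largest value among the identified edges to $\mathcal X_{\ell+1}$. (3) Let $\mathcal Y_{\ell+1}$ be the set of edges of $\mathcal E$ sharing a resource with an edge of $\mathcal X_{\ell+1}$, $d_{\ell+1}=f_M(Y_{\le\ell},X_{\le\ell+1}\cup I)$, $z_{\ell+1}=|X_{\ell+1}|$; push $L_{\ell+1}$ on the stack. *Collapse (one iteration).* Let $t$ be the smallest index of a collapsible layer. If $t=1$, the algorithm ends. Otherwise take a canonical decomposition $\mathcal I_1\cup\dots\cup\mathcal I_\ell$ and a set of node-disjoint paths in $G_M$ from $Y_{\le\ell}$ to $I$ that is a disjoint union $\Gamma_1\cup\dots\cup\Gamma_\ell$, where $\Gamma_i$ consists of $|I_i|$ paths from $Y_i$ to $I_i$. Remove the layers above $L_t$; set $\mathcal I:=\mathcal I_{\le t-1}$; replace $M$ by its symmetric difference with the set of edges of $\Gamma_t$; let $\mathcal V$ be the set of edges in $\mathcal Y_t$ whose player is the first node of a path in $\Gamma_t$; set $\mathcal E:=(\mathcal E\cup\mathcal I_t)\setminus\mathcal V$ and $\mathcal Y_t:=\mathcal Y_t\setminus\mathcal V$. Then, one after the other,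 for each $(p,B)\in\mathcal X_t$ that is now unblocked: remove it from $\mathcal X_t$ and, if $f_M(Y_{\le t-1},I\cup\{p\})=f_M(Y_{\le t-1},I)+1$, add to $\mathcal I$ some $(p,B')$ with $B'\subseteq B$ minimal and containing no resource covered by $\mathcal E$. Finally $\ell:=t$. A *state of the algorithm* is the initial state or any state reached after a Build or after an iteration of Collapse. **Lemma.** For every $\delta\in(0,1)$ there is a constant $\mu\in(0,1)$, depending only on $\delta$, such that for every instance, every $\tau$ with $0\le\tau\le\tau^*$ and $\lambda=6+\delta$, and every state $(M,\mathcal E,\mathcal I,(L_1,\dots,L_\ell))$ of the algorithm run with $\tau,\lambda,\mu$: if $|Y_{i+1}|<\sqrt{\mu}\,|Y_{\le i}|$ for some $i\in[1,\ell-1]$, then some layer below $L_{i+1}$ (that is, $L_j$ with $1\le j\le i$) is collapsible. -/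

import Mathlib

universe u w

namespace FairAlloc

noncomputable section

/-- An instance of the restricted max-min fair allocation problem with players `P` and resources
`R`: resource `r` is worth `v r` to the players that desire it and `0` to the others. -/
structure Problem (P : Type u) (R : Type w) where
  desires : P → R → Prop
  v : R → ℝ
  v_nonneg : ∀ r, 0 ≤ v r

/-- A problem together with the parameters of the algorithm: the guess `tau` of the optimal value,
the target ratio `lam`, and the collapsibility constant `mu`. -/
structure Setting (P : Type u) (R : Type w) extends Problem P R where
  tau : ℝ
  lam : ℝ
  mu : ℝ

/-- A pair `(p, B)` of a player and a set of resources. -/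
abbrev Edge (P : Type u) (R : Type w) := P × Finset R

/-- A layer `(𝒳, 𝒴, d, z)` of the stack. -/
structure Layer (P : Type u) (R : Type w) where
  X : Finset (Edge P R)
  Y : Finset (Edge P R)
  d : ℕ
  z : ℕ

/-- A state `(M, ℰ, ℐ, (L₁, …, L_ℓ))`. The stack consists of `layer 1, …, layer ℓ` (bottom to
top); the values of `layer` at other indices are not part of the stack and are never used. -/
structure State (P : Type u) (R : Type w) where
  M : Finset (P × R)
  E : Finset (Edge P R)
  I : Finset (Edge P R)
  ℓ : ℕ
  layer : ℕ → Layer P R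

section

variable {P : Type u} {R : Type w} [Fintype P] [Fintype R] [DecidableEq P] [DecidableEq R]

open Classical in
/-- The value of the allocation in which resource `r` is given to player `a r`. -/
def Problem.allocValue (A : Problem P R) (a : R → P) : ℝ :=
  ⨅ p : P, ∑ r : R, if a r = p ∧ A.desires p r then A.v r else 0

/-- The optimal value `τ*`: a maximum over finitely many allocations. -/
def Problem.optValue (A : Problem P R) : ℝ :=
  ⨆ a : R → P, A.allocValue a

/-! ### Fat edges, thin edges, partial allocations -/

def Setting.Fat (A : Setting P R) (r : R) : Prop := A.tau / A.lam ≤ A.v r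

def Setting.FatEdge (A : Setting P R) (p : P) (r : R) : Prop := A.desires p r ∧ A.Fat r

def Setting.value (A : Setting P R) (B : Finset R) : ℝ := ∑ r ∈ B, A.v r

def Setting.ThinEdge (A : Setting P R) (e : Edge P R) : Prop :=
  (∀ r ∈ e.2, A.desires e.1 r ∧ ¬ A.Fat r) ∧ A.tau / A.lam ≤ A.value e.2

/-- The players covered by a set of edges. -/
def players (S : Finset (Edge P R)) : Finset P := S.image Prod.fst

/-- The resources covered by a set of edges. -/
def resources (S : Finset (Edge P R)) : Finset R := S.biUnion Prod.snd

/-- `M` is a matching of the bipartite graph `G` of fat edges. -/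
def Setting.IsMatching (A : Setting P R) (M : Finset (P × R)) : Prop :=
  (∀ e ∈ M, A.FatEdge e.1 e.2) ∧
  (∀ e ∈ M, ∀ f ∈ M, e.1 = f.1 → e = f) ∧
  (∀ e ∈ M, ∀ f ∈ M, e.2 = f.2 → e = f)

def Setting.IsMaxMatching (A : Setting P R) (M : Finset (P × R)) : Prop :=
  A.IsMatching M ∧ ∀ M', A.IsMatching M' → M'.card ≤ M.card

/-- `B` has value at least `τ/λ`, and no proper subset of `B` has. -/
def Setting.MinimalSet (A : Setting P R) (B : Finset R) : Prop :=
  A.tau / A.lam ≤ A.value B ∧ ∀ B', B' ⊂ B → A.value B' < A.tau / A.lam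

structure Setting.IsPartialAllocation (A : Setting P R) (M : Finset (P × R))
    (E : Finset (Edge P R)) : Prop where
  maxMatching : A.IsMaxMatching M
  thin : ∀ e ∈ E, A.ThinEdge e
  player_disjoint : ∀ e ∈ E, ∀ f ∈ E, e.1 = f.1 → e = f
  player_unmatched : ∀ e ∈ E, ∀ m ∈ M, e.1 ≠ m.1
  resource_disjoint : ∀ e ∈ E, ∀ f ∈ E, e ≠ f → Disjoint e.2 f.2
  minimal : ∀ e ∈ E, A.MinimalSet e.2

/-! ### Node-disjoint paths in the directed graph `G_M` -/

/-- The arcs of `G_M`: from `r` to `p` if `(p, r) ∈ M`, and from `p` to `r` for the other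
fat edges `(p, r)`. -/
def Setting.Arc (A : Setting P R) (M : Finset (P × R)) : P ⊕ R → P ⊕ R → Prop
  | .inl p, .inr r => A.FatEdge p r ∧ (p, r) ∉ M
  | .inr r, .inl p => A.FatEdge p r ∧ (p, r) ∈ M
  | _, _ => False

/-- A path of `G_M` from a player in `S` to a player in `T`, as its list of nodes; a list with a
single node is a trivial path. -/
def Setting.IsPath (A : Setting P R) (M : Finset (P × R)) (S T : Finset P)
    (π : List (P ⊕ R)) : Prop :=
  π.IsChain (A.Arc M) ∧ π.Nodup ∧
  (∃ p ∈ S, π.head? = some (Sum.inl p)) ∧ (∃ q ∈ T, π.getLast? = some (Sum.inl q))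

/-- A feasible solution of `G_M(S, T)`: a set of node-disjoint paths from `S` to `T`. -/
def Setting.Feasible (A : Setting P R) (M : Finset (P × R)) (S T : Finset P)
    (Γ : Finset (List (P ⊕ R))) : Prop :=
  (∀ π ∈ Γ, A.IsPath M S T π) ∧ ∀ π ∈ Γ, ∀ π' ∈ Γ, π ≠ π' → π.Disjoint π'

/-- `f_M(S, T)`: the maximum number of node-disjoint paths from `S` to `T` in `G_M`. -/
def Setting.maxPaths (A : Setting P R) (M : Finset (P × R)) (S T : Finset P) : ℕ :=
  sSup {n : ℕ | ∃ Γ : Finset (List (P ⊕ R)), A.Feasible M S T Γ ∧ Γ.card = n}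

open Classical in
/-- The sources of a set of paths. -/
def sources (Γ : Finset (List (P ⊕ R))) : Finset P :=
  Finset.univ.filter fun p => ∃ π ∈ Γ, π.head? = some (Sum.inl p)

open Classical in
/-- The (undirected) edges used by a set of paths. -/
def pathEdges (Γ : Finset (List (P ⊕ R))) : Finset (P × R) :=
  Finset.univ.filter fun e => ∃ π ∈ Γ,
    [Sum.inl e.1, Sum.inr e.2] <:+: π ∨ [Sum.inr e.2, Sum.inl e.1] <:+: π

/-- `M ⊕ Γ⁺` (trivial paths have no edges). -/
def flip (M : Finset (P × R)) (Γ : Finset (List (P ⊕ R))) : Finset (P × R) :=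
  symmDiff M (pathEdges Γ)

/-! ### Components of a state -/

/-- `𝒳_{≤ k}`. -/
def State.Xle (s : State P R) (k : ℕ) : Finset (Edge P R) :=
  (Finset.Icc 1 k).biUnion fun i => (s.layer i).X

/-- `𝒴_{≤ k}`. -/
def State.Yle (s : State P R) (k : ℕ) : Finset (Edge P R) :=
  (Finset.Icc 1 k).biUnion fun i => (s.layer i).Y

/-! ### Build phase -/

/-- The data that change while layer `ℓ + 1` is under construction: `ℐ` and `𝒳_{ℓ+1}`. -/
structure Partial (P : Type u) (R : Type w) where
  I : Finset (Edge P R)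
  X : Finset (Edge P R)

/-- `X_{≤ ℓ+1} ∪ I`. -/
def targets (s : State P R) (c : Partial P R) : Finset P :=
  players (s.Xle s.ℓ ∪ c.X) ∪ players c.I

def Setting.AddablePlayer (A : Setting P R) (s : State P R) (c : Partial P R) (p : P) : Prop :=
  A.maxPaths s.M (players (s.Yle s.ℓ)) (targets s c ∪ {p}) =
    A.maxPaths s.M (players (s.Yle s.ℓ)) (targets s c) + 1

/-- `e` is an addable thin edge (in particular its player is addable). -/
def Setting.AddableEdge (A : Setting P R) (s : State P R) (c : Partial P R)
    (e : Edge P R) : Prop :=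
  A.ThinEdge e ∧ A.AddablePlayer s c e.1 ∧ A.value e.2 ≤ A.tau + A.tau / A.lam ∧
  Disjoint e.2 (resources ((s.Xle s.ℓ ∪ c.X) ∪ s.Yle s.ℓ ∪ c.I))

def Setting.Unblocked (A : Setting P R) (E : Finset (Edge P R)) (e : Edge P R) : Prop :=
  ∃ B ⊆ e.2, A.tau / A.lam ≤ A.value B ∧ Disjoint B (resources E)

/-- One execution of the second step of the build routine: for an unblocked addable edge `(p, B)`,
a minimal `(p, B')` with `B' ⊆ B` is added to `ℐ`. -/
def Setting.AddUnblocked (A : Setting P R) (s : State P R) (c c' : Partial P R) : Prop :=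
  ∃ (p : P) (B B' : Finset R), A.AddableEdge s c (p, B) ∧ B' ⊆ B ∧ A.MinimalSet B' ∧
    Disjoint B' (resources s.E) ∧ c' = ⟨insert (p, B') c.I, c.X⟩

/-- `(p, B)` is a maximal blocked addable edge of player `p`. -/
def Setting.MaximalBlocked (A : Setting P R) (s : State P R) (c : Partial P R)
    (p : P) (B : Finset R) : Prop :=
  (A.AddableEdge s c (p, B) ∧ ¬ A.Unblocked s.E (p, B)) ∧
  ∀ B', A.AddableEdge s c (p, B') → ¬ A.Unblocked s.E (p, B') → ¬ B ⊂ B'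

/-- One execution of the third step of the build routine: one maximal blocked addable edge
`(p, cand p)` is identified for each player `p` that is incident to an addable edge, and among
these edges one of largest value is added to `𝒳_{ℓ+1}`. -/
def Setting.AddBlocked (A : Setting P R) (s : State P R) (c c' : Partial P R) : Prop :=
  ∃ cand : P → Finset R,
    (∀ q, (∃ B, A.AddableEdge s c (q, B)) → A.MaximalBlocked s c q (cand q)) ∧
    ∃ p, (∃ B, A.AddableEdge s c (p, B)) ∧
      (∀ q, (∃ B, A.AddableEdge s c (q, B)) → A.value (cand q) ≤ A.value (cand p)) ∧
      c' = ⟨c.I, insert (p, cand p) c.X⟩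

open Classical in
/-- The layer that is pushed when the construction ends with `c`. -/
def Setting.newLayer (A : Setting P R) (s : State P R) (c : Partial P R) : Layer P R where
  X := c.X
  Y := s.E.filter fun e => ∃ e' ∈ c.X, ¬ Disjoint e.2 e'.2
  d := A.maxPaths s.M (players (s.Yle s.ℓ)) (targets s c)
  z := (players c.X).card

/-- `s'` is a possible result of the build routine on `s`. -/
def Setting.Build (A : Setting P R) (s s' : State P R) : Prop :=
  ∃ c₁ c₂ : Partial P R,
    Relation.ReflTransGen (A.AddUnblocked s) ⟨s.I, ∅⟩ c₁ ∧
    (∀ e, A.AddableEdge s c₁ e → ¬ A.Unblocked s.E e) ∧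
    Relation.ReflTransGen (A.AddBlocked s) c₁ c₂ ∧
    (∀ e, ¬ A.AddableEdge s c₂ e) ∧
    s' = ⟨s.M, s.E, c₂.I, s.ℓ + 1, Function.update s.layer (s.ℓ + 1) (A.newLayer s c₂)⟩

/-! ### Collapse phase -/

/-- `𝒟_{≤ k}` for a family `𝒟` of sets of edges. -/
def famLe (D : ℕ → Finset (Edge P R)) (k : ℕ) : Finset (Edge P R) := (Finset.Icc 1 k).biUnion D

/-- `D 1, …, D ℓ` is a canonical decomposition of `ℐ`. -/
def Setting.IsCanonicalDecomp (A : Setting P R) (s : State P R)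
    (D : ℕ → Finset (Edge P R)) : Prop :=
  famLe D s.ℓ = s.I ∧
  (∀ i ∈ Finset.Icc 1 s.ℓ, ∀ j ∈ Finset.Icc 1 s.ℓ, i ≠ j → Disjoint (D i) (D j)) ∧
  ∀ i ∈ Finset.Icc 1 s.ℓ,
    A.maxPaths s.M (players (s.Yle i)) (players (famLe D i)) =
      A.maxPaths s.M (players (s.Yle i)) (players s.I) ∧
    A.maxPaths s.M (players (s.Yle i)) (players s.I) = (players (famLe D i)).card ∧
    (players (famLe D i)).card = (famLe D i).card

/-- `Γ 1 ∪ … ∪ Γ ℓ` is a canonical solution of `G_M(Y_{≤ ℓ}, I)` for the decomposition `D`. -/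
def Setting.IsCanonicalSolution (A : Setting P R) (s : State P R)
    (D : ℕ → Finset (Edge P R)) (Γ : ℕ → Finset (List (P ⊕ R))) : Prop :=
  (∀ i ∈ Finset.Icc 1 s.ℓ,
    (Γ i).card = (players (D i)).card ∧
    ∀ π ∈ Γ i, A.IsPath s.M (players (s.layer i).Y) (players (D i)) π) ∧
  (∀ i ∈ Finset.Icc 1 s.ℓ, ∀ j ∈ Finset.Icc 1 s.ℓ, i ≠ j → Disjoint (Γ i) (Γ j)) ∧
  A.Feasible s.M (players (s.Yle s.ℓ)) (players s.I) ((Finset.Icc 1 s.ℓ).biUnion Γ)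

/-- Layer `L_i` of the stack of `s` is collapsible. -/
def Setting.Collapsible (A : Setting P R) (s : State P R) (i : ℕ) : Prop :=
  1 ≤ i ∧ i ≤ s.ℓ ∧ ∃ D, A.IsCanonicalDecomp s D ∧
    A.mu * ((players (s.layer i).Y).card : ℝ) ≤ ((players (D i)).card : ℝ)

/-- The loop over the edges that became unblocked: the listed edges `(p, B)` are treated in order;
if `f_M(Y, I ∪ {p}) = f_M(Y, I) + 1`, then a minimal `(p, B')` with `B' ⊆ B`, free of resources
used in `ℰ`, is added to `ℐ`, and otherwise nothing is added. -/
inductive Setting.Release (A : Setting P R) (M : Finset (P × R)) (E : Finset (Edge P R))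
    (Y : Finset P) : List (Edge P R) → Finset (Edge P R) → Finset (Edge P R) → Prop
  | nil (I : Finset (Edge P R)) : Setting.Release A M E Y [] I I
  | add (p : P) (B B' : Finset R) (es : List (Edge P R)) (I J : Finset (Edge P R)) :
      A.maxPaths M Y (players I ∪ {p}) = A.maxPaths M Y (players I) + 1 →
      B' ⊆ B → A.MinimalSet B' → Disjoint B' (resources E) →
      Setting.Release A M E Y es (insert (p, B') I) J →
      Setting.Release A M E Y ((p, B) :: es) I J
  | skip (p : P) (B : Finset R) (es : List (Edge P R)) (I J : Finset (Edge P R)) :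
      A.maxPaths M Y (players I ∪ {p}) ≠ A.maxPaths M Y (players I) + 1 →
      Setting.Release A M E Y es I J →
      Setting.Release A M E Y ((p, B) :: es) I J

open Classical in
/-- One iteration of the collapse routine that does not end the algorithm: the lowest collapsible
layer is `L_t` with `t ≥ 2`. (If `t = 1`, then `p₀` gets satisfied and the algorithm stops.) -/
def Setting.Collapse (A : Setting P R) (s s' : State P R) : Prop :=
  ∃ (t : ℕ) (D : ℕ → Finset (Edge P R)) (Γ : ℕ → Finset (List (P ⊕ R)))
    (V E' : Finset (Edge P R)) (M' : Finset (P × R)) (es : List (Edge P R))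
    (I' : Finset (Edge P R)),
    2 ≤ t ∧ A.Collapsible s t ∧ (∀ j, j < t → ¬ A.Collapsible s j) ∧
    A.IsCanonicalDecomp s D ∧ A.IsCanonicalSolution s D Γ ∧
    M' = flip s.M (Γ t) ∧
    V = (s.layer t).Y.filter (fun e => e.1 ∈ sources (Γ t)) ∧
    E' = (s.E ∪ D t) \ V ∧
    es.Nodup ∧ es.toFinset = (s.layer t).X.filter (fun e => A.Unblocked E' e) ∧
    A.Release M' E' (players (s.Yle (t - 1))) es (famLe D (t - 1)) I' ∧
    s' = ⟨M', E', I', t, Function.update s.layer t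
      ⟨(s.layer t).X.filter (fun e => ¬ A.Unblocked E' e), (s.layer t).Y \ V,
        (s.layer t).d, (s.layer t).z⟩⟩

/-! ### The states of the algorithm -/

/-- The states of the algorithm (initially, and after each call of the build routine and each
iteration of the collapse routine) when it is started on any partial allocation `(M, ℰ)` and any
player `p₀` who is not satisfied by it, whatever choices it makes. -/
inductive Setting.IsState (A : Setting P R) : State P R → Prop
  | init (M : Finset (P × R)) (E : Finset (Edge P R)) (p₀ : P) :
      A.IsPartialAllocation M E → (∀ m ∈ M, m.1 ≠ p₀) → (∀ e ∈ E, e.1 ≠ p₀) →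
      Setting.IsState A ⟨M, E, ∅, 1, fun _ => ⟨∅, {(p₀, ∅)}, 0, 0⟩⟩
  | build (s s' : State P R) : Setting.IsState A s → (∀ i, ¬ A.Collapsible s i) →
      A.Build s s' → Setting.IsState A s'
  | collapse (s s' : State P R) : Setting.IsState A s → A.Collapse s s' → Setting.IsState A s'

end

end

end FairAlloc

/-!
The players that a maximum matching `M` of the fat edges leaves unmatched form a basis of a
matroid that does not depend on `M` (`Setting.matroid`, with rank function `Setting.rank`). If `Y`
consists of unmatched players and `U` is the set of all unmatched players, then
`f_M(Y, S) = rank ((U \ Y) ∪ S) - |U \ Y|` (`Setting.IsMaxMatching.maxPaths_add`): flipping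
node-disjoint paths exchanges their sources for their sinks in the basis, and conversely the
symmetric difference of two maximum matchings consists of such paths. So a player is addable if
and only if it lies outside of a closure of this matroid, and everything the algorithm does can be
expressed by ranks and closures of sets of players.

The invariants `Setting.Inv` of a state remember, for each layer, how `𝒳_{j+1}` was constructed
(`Setting.Record`). A later collapse changes `M`, `ℐ` and removes edges from `𝒳_{j+1}`, but the
closure of `(U \ Y_{≤ j}) ∪ I` only grows (`Setting.IsCanonicalSolution.subset_span`), and it
contains the players of all removed edges. Hence a player outside of the closure
`Setting.reachX` was addable when a given edge was chosen, so that, by the greedy choice, its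
uncovered thin resources were worth at most as much as that edge (or the edge was worth `τ`); and
less than `τ/λ` if the player was still addable when the construction ended.

Now fix a layer `L_i` such that `Y_{i+1}` is small, but `Y_2, …, Y_i` are not, and suppose that none
of `L_1, …, L_i` is collapsible, so that `f_M(Y_{≤ j}, I) ≤ μ |Y_{≤ j}|` for `j ≤ i`. Take an
allocation in which every player gets value `τ`. The players without a fat resource in it contain a
basis `T` of the matroid (`Setting.exists_isMaxMatching_thin`). There are `|Y_{≤ i}|` positions: the
edges of `𝒳_2, …, 𝒳_{i+1}`, and additional ones for the end of the construction of `𝒳_{i+1}`.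
Submodularity, applied layer by layer, gives Hall's condition for matching the positions, up to an
error of `∑_{j ≤ i} f_M(Y_{≤ j}, I)`, with players of `T` that are outside of the closures belonging
to the positions (`LayeredFamily.sum_le`). Each of these players has thin resources worth `τ`, and
those not covered by the layers are worth at most the value of the edge at its position, or `τ/λ`.
Since the edges of `𝒳` are worth less than `τ/λ` outside of the resources of `𝒴`, and edges of `𝒴`
at most `2 τ/λ`, this yields `λ |Y_{≤ i}| ≤ 6 |Y_{≤ i}| + 4 |Y_{i+1}|` up to the error terms
(`Setting.Inv.tau_mul_card_le`). The growth of `Y_2, …, Y_i` keeps the errors, a geometric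
sum, of order `√μ |Y_{≤ i}|`, and `λ = 6 + δ` is a contradiction for `√μ = δ / 40`.
-/

namespace FairAlloc

open Finset

set_option linter.unusedSectionVars false

/-! ### Maximum matchings and the players they leave unmatched -/

section Matchings

variable {P : Type u} {R : Type w} [Fintype P] [DecidableEq P] [DecidableEq R]

/-- The players that are not covered by `M`. -/
def unmatched (M : Finset (P × R)) : Finset P := univ.filter fun p => ∀ m ∈ M, m.1 ≠ p

lemma mem_unmatched {M : Finset (P × R)} {p : P} : p ∈ unmatched M ↔ ∀ r, (p, r) ∉ M := by
  simp only [unmatched, mem_filter, mem_univ, true_and]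
  exact ⟨fun h r hr => h _ hr rfl, fun h m hm hp => h m.2 (by rw [← hp]; exact hm)⟩

lemma notMem_unmatched {M : Finset (P × R)} {p : P} : p ∉ unmatched M ↔ ∃ r, (p, r) ∈ M := by
  simp [mem_unmatched]

variable {A : Setting P R}

lemma Setting.IsMatching.resource_eq {M : Finset (P × R)} (h : A.IsMatching M) {p : P} {r r' : R}
    (h₁ : (p, r) ∈ M) (h₂ : (p, r') ∈ M) : r = r' :=
  congrArg Prod.snd (h.2.1 _ h₁ _ h₂ rfl)

lemma Setting.IsMatching.player_eq {M : Finset (P × R)} (h : A.IsMatching M) {p p' : P} {r : R}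
    (h₁ : (p, r) ∈ M) (h₂ : (p', r) ∈ M) : p = p' :=
  congrArg Prod.fst (h.2.2 _ h₁ _ h₂ rfl)

lemma Setting.IsMatching.card_add_card_unmatched {M : Finset (P × R)} (h : A.IsMatching M) :
    M.card + (unmatched M).card = Fintype.card P := by
  have h1 : unmatched M = univ \ M.image Prod.fst := by
    ext p
    simp only [mem_unmatched, mem_sdiff, mem_univ, true_and, mem_image, Prod.exists,
      exists_and_right, exists_eq_right, not_exists]
  have h2 : (M.image Prod.fst).card = M.card :=
    card_image_of_injOn fun e he f hf hef => h.2.1 e he f hf hef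
  have h3 := card_sdiff_add_card_eq_card (subset_univ (M.image Prod.fst))
  rw [h1, ← h2, add_comm, h3, card_univ]

lemma Setting.IsMaxMatching.card_unmatched_eq {M M' : Finset (P × R)} (h : A.IsMaxMatching M)
    (h' : A.IsMaxMatching M') : (unmatched M).card = (unmatched M').card := by
  have := h.1.card_add_card_unmatched
  have := h'.1.card_add_card_unmatched
  have := h.2 _ h'.1
  have := h'.2 _ h.1
  lia

lemma Setting.IsMaxMatching.of_card_unmatched_le {M M' : Finset (P × R)} (h : A.IsMaxMatching M)
    (h' : A.IsMatching M') (hc : (unmatched M').card ≤ (unmatched M).card) :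
    A.IsMaxMatching M' := by
  refine ⟨h', fun N hN => ?_⟩
  have := h.1.card_add_card_unmatched
  have := h'.card_add_card_unmatched
  have := h.2 _ hN
  lia

/-- A fat edge between a player `e` missed by a maximum matching and a resource `r` can be swapped
into the matching, at the expense of the player that was matched to `r`. -/
lemma Setting.IsMaxMatching.swap {M : Finset (P × R)} (h : A.IsMaxMatching M) {e : P} {r : R}
    (he : e ∈ unmatched M) (hf : A.FatEdge e r) :
    ∃ p, p ≠ e ∧ (p, r) ∈ M ∧ A.IsMaxMatching (insert (e, r) (M.erase (p, r))) ∧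
      unmatched (insert (e, r) (M.erase (p, r))) = insert p ((unmatched M).erase e) := by
  rw [mem_unmatched] at he
  have hex : ∃ p, (p, r) ∈ M := by
    by_contra! hno
    have hM : A.IsMatching (insert (e, r) M) := by
      refine ⟨?_, ?_, ?_⟩
      · simp only [mem_insert, forall_eq_or_imp]
        exact ⟨hf, h.1.1⟩
      · rintro ⟨p, s⟩ hp ⟨p', s'⟩ hp' hpp
        simp only [mem_insert, Prod.mk.injEq] at hp hp' hpp ⊢
        subst hpp
        refine ⟨rfl, ?_⟩
        rcases hp with ⟨rfl, rfl⟩ | hp <;> rcases hp' with ⟨h1, rfl⟩ | hp'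
        · rfl
        · exact absurd hp' (he _)
        · subst h1; exact absurd hp (he _)
        · exact h.1.resource_eq hp hp'
      · rintro ⟨p, s⟩ hp ⟨p', s'⟩ hp' hpp
        simp only [mem_insert, Prod.mk.injEq] at hp hp' hpp ⊢
        subst hpp
        refine ⟨?_, rfl⟩
        rcases hp with ⟨rfl, rfl⟩ | hp <;> rcases hp' with ⟨h1, h2⟩ | hp'
        · exact h1.symm
        · exact absurd hp' (hno _)
        · subst h2; exact absurd hp (hno _)
        · exact h.1.player_eq hp hp'
    have := h.2 _ hM
    rw [card_insert_of_notMem (he r)] at this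
    lia
  obtain ⟨p, hp⟩ := hex
  have hpe : p ≠ e := by rintro rfl; exact he _ hp
  have hM : A.IsMatching (insert (e, r) (M.erase (p, r))) := by
    refine ⟨?_, ?_, ?_⟩
    · intro m hm
      rcases mem_insert.1 hm with rfl | hm
      · exact hf
      · exact h.1.1 _ (mem_of_mem_erase hm)
    · rintro ⟨q, s⟩ hq ⟨q', s'⟩ hq' hqq
      simp only [mem_insert, mem_erase, Prod.mk.injEq] at hq hq' hqq ⊢
      subst hqq
      refine ⟨rfl, ?_⟩
      rcases hq with ⟨rfl, rfl⟩ | ⟨_, hq⟩ <;> rcases hq' with ⟨h1, rfl⟩ | ⟨_, hq'⟩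
      · rfl
      · exact absurd hq' (he _)
      · subst h1; exact absurd hq (he _)
      · exact h.1.resource_eq hq hq'
    · rintro ⟨q, s⟩ hq ⟨q', s'⟩ hq' hqq
      simp only [mem_insert, mem_erase, Prod.mk.injEq] at hq hq' hqq ⊢
      subst hqq
      refine ⟨?_, rfl⟩
      rcases hq with ⟨rfl, rfl⟩ | ⟨hn, hq⟩ <;> rcases hq' with ⟨h1, h2⟩ | ⟨hn', hq'⟩
      · exact h1.symm
      · exact (hn' (Prod.ext (h.1.player_eq hq' hp) rfl)).elim
      · subst h2; exact (hn (Prod.ext (h.1.player_eq hq hp) rfl)).elim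
      · exact h.1.player_eq hq hq'
  have hU : unmatched (insert (e, r) (M.erase (p, r))) = insert p ((unmatched M).erase e) := by
    ext q
    simp only [mem_unmatched, mem_insert, mem_erase, Prod.mk.injEq, not_or, not_and, ne_eq]
    constructor
    · intro hq
      by_cases hqp : q = p
      · exact Or.inl hqp
      · refine Or.inr ⟨fun hqe => (hq r).1 hqe rfl, fun s hs => ?_⟩
        exact (hq s).2 (fun h1 => absurd h1 hqp) hs
    · rintro (rfl | ⟨hqe, hq⟩) s
      · exact ⟨fun h1 => absurd h1 hpe, fun h1 h2 => h1 rfl (h.1.resource_eq h2 hp)⟩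
      · exact ⟨fun h1 => absurd h1 hqe, fun _ => hq s⟩
  refine ⟨p, hpe, hp, h.of_card_unmatched_le hM ?_, hU⟩
  rw [hU]
  refine (card_insert_le _ _).trans ?_
  rw [card_erase_add_one (mem_unmatched.2 he)]

lemma card_sdiff_swap_lt {M N : Finset (P × R)} {e p : P} {r : R} (he : (e, r) ∈ N)
    (he' : (e, r) ∉ M) (hp : (p, r) ∉ N) :
    (N \ insert (e, r) (M.erase (p, r))).card < (N \ M).card := by
  refine card_lt_card ⟨fun m hm => ?_, fun hsub => ?_⟩
  · simp only [mem_sdiff, mem_insert, mem_erase, not_or, not_and, ne_eq] at hm ⊢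
    exact ⟨hm.1, fun hmM => hm.2.2 (fun h => hp (h ▸ hm.1)) hmM⟩
  · have := hsub (mem_sdiff.2 ⟨he, he'⟩)
    simp at this

/-- The sets of players missed by maximum matchings have the basis exchange property. -/
lemma Setting.IsMaxMatching.exchange {N : Finset (P × R)} (hN : A.IsMaxMatching N) :
    ∀ (n : ℕ) (M : Finset (P × R)), A.IsMaxMatching M → (N \ M).card ≤ n →
      ∀ e ∈ unmatched M, e ∉ unmatched N →
      ∃ f ∈ unmatched N, f ∉ unmatched M ∧ ∃ M', A.IsMaxMatching M' ∧
        unmatched M' = insert f ((unmatched M).erase e) := by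
  intro n
  induction n with
  | zero =>
    intro M hM hn e he heN
    obtain ⟨r, hr⟩ := notMem_unmatched.1 heN
    have : (e, r) ∈ N \ M := mem_sdiff.2 ⟨hr, mem_unmatched.1 he r⟩
    rw [Nat.le_zero, card_eq_zero] at hn
    simp [hn] at this
  | succ n ih =>
    intro M hM hn e he heN
    obtain ⟨r, hr⟩ := notMem_unmatched.1 heN
    obtain ⟨p, hpe, hp, hM', hU⟩ := hM.swap he (hN.1.1 _ hr)
    have hpM : p ∉ unmatched M := notMem_unmatched.2 ⟨r, hp⟩
    by_cases hpN : p ∈ unmatched N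
    · exact ⟨p, hpN, hpM, _, hM', hU⟩
    · have hpr : (p, r) ∉ N := fun h => hpe (hN.1.player_eq h hr)
      have hlt := card_sdiff_swap_lt hr (mem_unmatched.1 he r) hpr
      obtain ⟨f, hfN, hfM, M'', hM'', hU''⟩ :=
        ih _ hM' (by lia) p (by rw [hU]; exact mem_insert_self _ _) hpN
      rw [hU] at hfM hU''
      have hfe : f ≠ e := by rintro rfl; exact heN hfN
      refine ⟨f, hfN, fun h => hfM (mem_insert_of_mem (mem_erase.2 ⟨hfe, h⟩)), M'', hM'', ?_⟩
      rw [hU'', erase_insert]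
      exact fun h => hpM (mem_of_mem_erase h)

/-- Any matching `N` of fat edges can be completed: some maximum matching misses only players
that `N` misses. -/
lemma Setting.IsMatching.exists_isMaxMatching {M N : Finset (P × R)} (hN : A.IsMatching N)
    (hM : A.IsMaxMatching M) : ∃ M', A.IsMaxMatching M' ∧ unmatched M' ⊆ unmatched N := by
  induction hn : (N \ M).card using Nat.strong_induction_on generalizing M with
  | _ n ih =>
    by_cases hsub : unmatched M ⊆ unmatched N
    · exact ⟨M, hM, hsub⟩
    · obtain ⟨e, he, heN⟩ := not_subset.1 hsub
      obtain ⟨r, hr⟩ := notMem_unmatched.1 heN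
      obtain ⟨p, hpe, hp, hM', hU⟩ := hM.swap he (hN.1 _ hr)
      have hpr : (p, r) ∉ N := fun h => hpe (hN.player_eq h hr)
      exact ih _ (hn ▸ card_sdiff_swap_lt hr (mem_unmatched.1 he r) hpr) hM' rfl

end Matchings

/-! ### Rank functions -/

section Rank

variable {P : Type u} [DecidableEq P]

/-- The rank axioms of a matroid, for a function on finite sets. -/
structure IsRank (r : Finset P → ℕ) : Prop where
  mono : ∀ {S T}, S ⊆ T → r S ≤ r T
  submod : ∀ S T, r (S ∩ T) + r (S ∪ T) ≤ r S + r T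
  le_card : ∀ S, r S ≤ S.card

namespace IsRank

variable {r : Finset P → ℕ} (h : IsRank r)
include h

lemma union_le (S T : Finset P) : r (S ∪ T) ≤ r S + T.card := by
  have := h.submod S T
  have := h.le_card T
  lia

lemma insert_le (p : P) (S : Finset P) : r (insert p S) ≤ r S + 1 := by
  have := h.union_le S {p}
  rwa [card_singleton, union_comm, ← insert_eq] at this

lemma indep_subset {S T : Finset P} (hT : T.card ≤ r T) (hST : S ⊆ T) : r S = S.card := by
  have h1 := h.union_le S (T \ S)
  rw [union_sdiff_of_subset hST] at h1
  have h2 := card_sdiff_add_card_eq_card hST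
  have := h.le_card S
  lia

end IsRank

variable [Fintype P]

/-- The closure of `S`: the elements whose addition to `S` does not increase the rank. -/
def span (r : Finset P → ℕ) (S : Finset P) : Finset P := univ.filter fun p => r (insert p S) = r S

namespace IsRank

variable {r : Finset P → ℕ}

lemma mem_span {S : Finset P} {p : P} : p ∈ span r S ↔ r (insert p S) = r S := by simp [span]

lemma subset_span (r : Finset P → ℕ) (S : Finset P) : S ⊆ span r S := fun p hp => by
  rw [mem_span, insert_eq_of_mem hp]

variable (h : IsRank r)
include h

lemma notMem_span {S : Finset P} {p : P} : p ∉ span r S ↔ r (insert p S) = r S + 1 := by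
  have h1 := h.insert_le p S
  have h2 := h.mono (subset_insert p S)
  rw [mem_span]
  lia

lemma span_mono {S T : Finset P} (hST : S ⊆ T) : span r S ⊆ span r T := by
  intro p hp
  by_cases hpT : p ∈ T
  · exact subset_span r T hpT
  rw [mem_span] at hp ⊢
  have h1 := h.submod T (insert p S)
  have h2 : r S ≤ r (T ∩ insert p S) := h.mono (subset_inter hST (subset_insert _ _))
  have h3 : T ∪ insert p S = insert p T := by
    rw [union_insert, union_eq_left.2 hST]
  have h4 := h.mono (subset_insert p T)
  rw [h3] at h1
  lia

lemma rank_union_of_subset_span {S T : Finset P} (hT : T ⊆ span r S) : r (S ∪ T) = r S := by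
  induction T using Finset.induction_on with
  | empty => simp
  | insert p T hp ih =>
    have h1 := ih ((subset_insert _ _).trans hT)
    have h2 := h.span_mono (subset_union_left (s₁ := S) (s₂ := T)) (hT (mem_insert_self p T))
    rw [mem_span] at h2
    rw [union_insert, h2, h1]

lemma rank_le_of_subset_span {S T : Finset P} (hT : T ⊆ span r S) : r T ≤ r S := by
  rw [← h.rank_union_of_subset_span hT]
  exact h.mono subset_union_right

lemma rank_span (S : Finset P) : r (span r S) = r S :=
  le_antisymm (h.rank_le_of_subset_span subset_rfl) (h.mono (subset_span r S))

lemma span_subset_span {S T : Finset P} (hT : T ⊆ span r S) : span r T ⊆ span r S := by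
  intro p hp
  have h1 := h.span_mono (subset_union_right (s₁ := S) (s₂ := T)) hp
  rw [mem_span] at h1 ⊢
  rw [h.rank_union_of_subset_span hT] at h1
  have h2 := h.mono (insert_subset_insert p (subset_union_left (s₁ := S) (s₂ := T)))
  have h3 := h.mono (subset_insert p S)
  lia

lemma subset_span_of_rank_le {S T : Finset P} (hST : S ⊆ T) (hr : r T ≤ r S) : T ⊆ span r S := by
  intro p hp
  rw [mem_span]
  have h1 := h.mono (insert_subset hp hST)
  have h2 := h.mono (subset_insert p S)
  lia

end IsRank

end Rank

/-! ### The matroid of unmatched players -/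

section Matroid

variable {P : Type u} {R : Type w} [Fintype P] [Fintype R] [DecidableEq P] [DecidableEq R]

lemma Setting.exists_isMaxMatching (A : Setting P R) : ∃ M, A.IsMaxMatching M := by
  classical
  obtain ⟨M, hM, hmax⟩ := exists_max_image (univ.filter fun M : Finset (P × R) => A.IsMatching M)
    card ⟨∅, by simp [Setting.IsMatching]⟩
  exact ⟨M, (mem_filter.1 hM).2, fun M' hM' => hmax M' (mem_filter.2 ⟨mem_univ _, hM'⟩)⟩

/-- The matroid on the players whose bases are the sets of players missed by maximum matchings
of the fat edges (the dual of the transversal matroid of `G`). -/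
def Setting.matroid (A : Setting P R) : Matroid P :=
  Matroid.ofIsBaseOfFinite (E := Set.univ) Set.finite_univ
    (fun B => ∃ M, A.IsMaxMatching M ∧ B = (unmatched M : Set P))
    (let ⟨M, hM⟩ := A.exists_isMaxMatching; ⟨_, M, hM, rfl⟩)
    (by
      rintro _ _ ⟨M, hM, rfl⟩ ⟨N, hN, rfl⟩ e ⟨he, heN⟩
      obtain ⟨f, hf, hfM, M', hM', hU⟩ := hN.exchange _ M hM le_rfl e he heN
      exact ⟨f, ⟨hf, hfM⟩, M', hM', by rw [hU]; simp⟩)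
    (fun _ _ => Set.subset_univ _)

lemma Setting.matroid_isBase {A : Setting P R} {B : Set P} :
    A.matroid.IsBase B ↔ ∃ M, A.IsMaxMatching M ∧ B = (unmatched M : Set P) := Iff.rfl

/-- The rank function of the matroid of unmatched players. -/
noncomputable def Setting.rank (A : Setting P R) (S : Finset P) : ℕ := (A.matroid.eRk S).toNat

lemma Setting.coe_rank (A : Setting P R) (S : Finset P) :
    (A.rank S : ℕ∞) = A.matroid.eRk S := by
  refine ENat.natCast_toNat (ne_top_of_le_ne_top ?_ (A.matroid.eRk_le_encard S))
  rw [Set.encard_coe_eq_coe_finsetCard]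
  exact ENat.natCast_ne_top _

lemma Setting.isRank (A : Setting P R) : IsRank A.rank where
  mono {S T} hST := by
    have := A.matroid.eRk_mono (coe_subset.2 hST)
    rw [← A.coe_rank, ← A.coe_rank] at this
    exact_mod_cast this
  submod S T := by
    have := A.matroid.eRk_inter_add_eRk_union_le (S : Set P) T
    rw [← coe_inter, ← coe_union] at this
    simp only [← A.coe_rank] at this
    exact_mod_cast this
  le_card S := by
    have := A.matroid.eRk_le_encard S
    rw [← A.coe_rank, Set.encard_coe_eq_coe_finsetCard] at this
    exact_mod_cast this

/-- An independent subset `J` of `S` extends to a basis of `S`, and that to a basis of the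
matroid. -/
lemma Setting.exists_unmatched (A : Setting P R) {J S : Finset P} (hJ : A.rank J = J.card)
    (hJS : J ⊆ S) : ∃ M, A.IsMaxMatching M ∧ J ⊆ unmatched M ∧
      (S ∩ unmatched M).card = A.rank S := by
  have hi : A.matroid.Indep (J : Set P) := by
    rw [Matroid.indep_iff_eRk_eq_encard_of_finite J.finite_toSet, ← A.coe_rank, hJ,
      Set.encard_coe_eq_coe_finsetCard]
  obtain ⟨K, hK, hJK⟩ := hi.subset_isBasis_of_subset (coe_subset.2 hJS)
    (show (S : Set P) ⊆ A.matroid.E from Set.subset_univ _)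
  obtain ⟨B, hB, hKB⟩ := hK.exists_isBase
  obtain ⟨M, hM, rfl⟩ := matroid_isBase.1 hB
  refine ⟨M, hM, ?_, ?_⟩
  · rw [hKB] at hJK
    exact_mod_cast hJK.trans Set.inter_subset_left
  · have h1 := hK.encard_eq_eRk
    rw [hKB, Set.inter_comm, ← coe_inter, Set.encard_coe_eq_coe_finsetCard, ← A.coe_rank] at h1
    exact_mod_cast h1

lemma Setting.IsMaxMatching.rank_unmatched {A : Setting P R} {M : Finset (P × R)}
    (hM : A.IsMaxMatching M) : A.rank (unmatched M) = (unmatched M).card := by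
  have hB : A.matroid.IsBase (unmatched M : Set P) := ⟨M, hM, rfl⟩
  have h := hB.indep.eRk_eq_encard
  rw [← A.coe_rank, Set.encard_coe_eq_coe_finsetCard] at h
  exact_mod_cast h

lemma Setting.IsMaxMatching.rank_of_subset_unmatched {A : Setting P R} {M : Finset (P × R)}
    (hM : A.IsMaxMatching M) {S : Finset P} (hS : S ⊆ unmatched M) : A.rank S = S.card :=
  A.isRank.indep_subset hM.rank_unmatched.ge hS

lemma Setting.IsMaxMatching.rank_le {A : Setting P R} {M : Finset (P × R)}
    (hM : A.IsMaxMatching M) (S : Finset P) : A.rank S ≤ (unmatched M).card := by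
  obtain ⟨M', hM', _, hc⟩ := A.exists_unmatched (J := ∅) (S := S)
    (by simpa using A.isRank.le_card ∅) (empty_subset _)
  rw [← hc, hM.card_unmatched_eq hM']
  exact card_le_card inter_subset_right

end Matroid

/-! ### Consecutive nodes of a list -/

section Lists

variable {α : Type*} {l : List α} {a b c : α}

lemma rel_of_infix_pair {Q : α → α → Prop} (h : l.IsChain Q) (hab : [a, b] <:+: l) : Q a b := by
  have := h.infix hab
  simpa using this

lemma head_or_pred (h : a ∈ l) : l.head? = some a ∨ ∃ b, [b, a] <:+: l := by
  obtain ⟨s, t, rfl⟩ := List.append_of_mem h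
  rcases List.eq_nil_or_concat s with rfl | ⟨s', b, rfl⟩
  · exact Or.inl rfl
  · exact Or.inr ⟨b, s', t, by simp⟩

lemma last_or_succ (h : a ∈ l) : l.getLast? = some a ∨ ∃ b, [a, b] <:+: l := by
  obtain ⟨s, t, rfl⟩ := List.append_of_mem h
  rcases t with _ | ⟨b, t⟩
  · exact Or.inl (by simp)
  · exact Or.inr ⟨b, s, t, by simp⟩

lemma mem_of_infix_left (h : [a, b] <:+: l) : a ∈ l := h.subset (by simp)

lemma mem_of_infix_right (h : [a, b] <:+: l) : b ∈ l := h.subset (by simp)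

lemma succ_unique (hl : l.Nodup) (h : [a, b] <:+: l) (h' : [a, c] <:+: l) : b = c := by
  induction l with
  | nil => simp at h
  | cons x l ih =>
    rw [List.nodup_cons] at hl
    rw [List.infix_cons_iff] at h h'
    rcases h with h | h <;> rcases h' with h' | h'
    · obtain ⟨t, ht⟩ := h
      obtain ⟨t', ht'⟩ := h'
      simp only [List.cons_append, List.nil_append, List.cons.injEq] at ht ht'
      rw [← ht.2] at ht'
      exact (List.cons.inj ht'.2).1.symm
    · obtain ⟨t, ht⟩ := h
      simp only [List.cons_append, List.nil_append, List.cons.injEq] at ht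
      exact absurd (ht.1 ▸ mem_of_infix_left h') hl.1
    · obtain ⟨t, ht⟩ := h'
      simp only [List.cons_append, List.nil_append, List.cons.injEq] at ht
      exact absurd (ht.1 ▸ mem_of_infix_left h) hl.1
    · exact ih hl.2 h h'

lemma pred_unique (hl : l.Nodup) (h : [b, a] <:+: l) (h' : [c, a] <:+: l) : b = c := by
  refine succ_unique (l := l.reverse) (List.nodup_reverse.2 hl) (a := a) ?_ ?_
  · simpa using List.reverse_infix.2 h
  · simpa using List.reverse_infix.2 h'

lemma last_ne_of_succ (hl : l.Nodup) (h : [a, b] <:+: l) : l.getLast? ≠ some a := by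
  obtain ⟨s, t, rfl⟩ := h
  intro hlast
  have h1 : (b :: t).getLast? = some a := by
    rw [List.append_assoc, List.getLast?_append_of_ne_nil _ (by simp)] at hlast
    simpa using hlast
  have h2 : a ∈ b :: t := List.mem_of_getLast? h1
  have h3 : (a :: b :: t).Nodup := by
    rw [List.append_assoc] at hl
    exact hl.of_append_right
  exact (List.nodup_cons.1 h3).1 h2

end Lists

/-! ### Augmenting a maximum matching along node-disjoint paths -/

section Paths

variable {P : Type u} {R : Type w} [Fintype P] [Fintype R] [DecidableEq P] [DecidableEq R]
variable {A : Setting P R} {M : Finset (P × R)} {Y S : Finset P} {Γ : Finset (List (P ⊕ R))}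

open Classical in
/-- The last nodes of a set of paths. -/
noncomputable def sinks (Γ : Finset (List (P ⊕ R))) : Finset P :=
  univ.filter fun p => ∃ π ∈ Γ, π.getLast? = some (Sum.inl p)

lemma mem_sinks {p : P} : p ∈ sinks Γ ↔ ∃ π ∈ Γ, π.getLast? = some (Sum.inl p) := by
  simp [sinks]

lemma mem_sources {p : P} : p ∈ sources Γ ↔ ∃ π ∈ Γ, π.head? = some (Sum.inl p) := by
  simp [sources]

/-- Some path of `Γ` goes from `a` directly to `b`. -/
def Step (Γ : Finset (List (P ⊕ R))) (a b : P ⊕ R) : Prop := ∃ π ∈ Γ, [a, b] <:+: π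

lemma Setting.arc_from_player {p : P} {b : P ⊕ R} (h : A.Arc M (.inl p) b) :
    ∃ r, b = .inr r ∧ A.FatEdge p r ∧ (p, r) ∉ M := by
  rcases b with q | r
  · exact h.elim
  · exact ⟨r, rfl, h⟩

lemma Setting.arc_from_resource {r : R} {b : P ⊕ R} (h : A.Arc M (.inr r) b) :
    ∃ p, b = .inl p ∧ A.FatEdge p r ∧ (p, r) ∈ M := by
  rcases b with p | r'
  · exact ⟨p, rfl, h⟩
  · exact h.elim

lemma Setting.arc_to_player {p : P} {b : P ⊕ R} (h : A.Arc M b (.inl p)) :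
    ∃ r, b = .inr r ∧ A.FatEdge p r ∧ (p, r) ∈ M := by
  rcases b with q | r
  · exact h.elim
  · exact ⟨r, rfl, h⟩

namespace Setting.Feasible

variable (hΓ : A.Feasible M Y S Γ)
include hΓ

lemma mono {Y' S' : Finset P} {Δ : Finset (List (P ⊕ R))} (hΔ : Δ ⊆ Γ)
    (h : ∀ π ∈ Δ, A.IsPath M Y' S' π) : A.Feasible M Y' S' Δ :=
  ⟨h, fun π hπ π' hπ' => hΓ.2 π (hΔ hπ) π' (hΔ hπ')⟩

lemma path_eq {π π' : List (P ⊕ R)} (hπ : π ∈ Γ) (hπ' : π' ∈ Γ) {a : P ⊕ R} (ha : a ∈ π)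
    (ha' : a ∈ π') : π = π' := by
  by_contra hne
  exact hΓ.2 π hπ π' hπ' hne ha ha'

lemma step_arc {a b : P ⊕ R} (h : Step Γ a b) : A.Arc M a b := by
  obtain ⟨π, hπ, h⟩ := h
  exact rel_of_infix_pair (hΓ.1 π hπ).1 h

lemma step_succ_unique {a b c : P ⊕ R} (h : Step Γ a b) (h' : Step Γ a c) : b = c := by
  obtain ⟨π, hπ, h⟩ := h
  obtain ⟨π', hπ', h'⟩ := h'
  obtain rfl := hΓ.path_eq hπ hπ' (mem_of_infix_left h) (mem_of_infix_left h')
  exact succ_unique (hΓ.1 π hπ).2.1 h h'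

lemma step_pred_unique {a b c : P ⊕ R} (h : Step Γ b a) (h' : Step Γ c a) : b = c := by
  obtain ⟨π, hπ, h⟩ := h
  obtain ⟨π', hπ', h'⟩ := h'
  obtain rfl := hΓ.path_eq hπ hπ' (mem_of_infix_right h) (mem_of_infix_right h')
  exact pred_unique (hΓ.1 π hπ).2.1 h h'

lemma sources_subset : sources Γ ⊆ Y := by
  intro p hp
  obtain ⟨π, hπ, h⟩ := mem_sources.1 hp
  obtain ⟨q, hq, h'⟩ := (hΓ.1 π hπ).2.2.1
  rw [h] at h'
  simp only [Option.some.injEq, Sum.inl.injEq] at h'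
  exact h' ▸ hq

lemma sinks_subset : sinks Γ ⊆ S := by
  intro p hp
  obtain ⟨π, hπ, h⟩ := mem_sinks.1 hp
  obtain ⟨q, hq, h'⟩ := (hΓ.1 π hπ).2.2.2
  rw [h] at h'
  simp only [Option.some.injEq, Sum.inl.injEq] at h'
  exact h' ▸ hq

lemma card_sources : (sources Γ).card = Γ.card := by
  symm
  have h1 : ∀ π ∈ Γ, ∃ p, π.head? = some (Sum.inl p) := fun π hπ =>
    let ⟨p, _, h⟩ := (hΓ.1 π hπ).2.2.1
    ⟨p, h⟩
  choose f hf using h1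
  refine card_bij f (fun π hπ => mem_sources.2 ⟨π, hπ, hf π hπ⟩) (fun π hπ π' hπ' h => ?_)
    (fun p hp => ?_)
  · refine hΓ.path_eq hπ hπ' (List.mem_of_head? (hf π hπ)) ?_
    rw [h]
    exact List.mem_of_head? (hf π' hπ')
  · obtain ⟨π, hπ, h⟩ := mem_sources.1 hp
    refine ⟨π, hπ, ?_⟩
    rw [hf π hπ] at h
    simpa using h

lemma card_sinks : (sinks Γ).card = Γ.card := by
  symm
  have h1 : ∀ π ∈ Γ, ∃ p, π.getLast? = some (Sum.inl p) := fun π hπ =>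
    let ⟨p, _, h⟩ := (hΓ.1 π hπ).2.2.2
    ⟨p, h⟩
  choose f hf using h1
  refine card_bij f (fun π hπ => mem_sinks.2 ⟨π, hπ, hf π hπ⟩) (fun π hπ π' hπ' h => ?_)
    (fun p hp => ?_)
  · refine hΓ.path_eq hπ hπ' (List.mem_of_getLast? (hf π hπ)) ?_
    rw [h]
    exact List.mem_of_getLast? (hf π' hπ')
  · obtain ⟨π, hπ, h⟩ := mem_sinks.1 hp
    refine ⟨π, hπ, ?_⟩
    rw [hf π hπ] at h
    simpa using h

/-- A node of a path that is a player is the source of the path, or is entered through its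
matching edge. -/
lemma mem_sources_or_step {π : List (P ⊕ R)} (hπ : π ∈ Γ) {p : P} (hp : Sum.inl p ∈ π) :
    p ∈ sources Γ ∨ ∃ r, (p, r) ∈ M ∧ Step Γ (.inr r) (.inl p) := by
  rcases head_or_pred hp with h | ⟨b, hb⟩
  · exact Or.inl (mem_sources.2 ⟨π, hπ, h⟩)
  · obtain ⟨r, rfl, _, hr⟩ := A.arc_to_player (hΓ.step_arc ⟨π, hπ, hb⟩)
    exact Or.inr ⟨r, hr, π, hπ, hb⟩

lemma sinks_inter_unmatched_subset : sinks Γ ∩ unmatched M ⊆ sources Γ := by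
  intro p hp
  obtain ⟨hp, hpU⟩ := mem_inter.1 hp
  obtain ⟨π, hπ, h⟩ := mem_sinks.1 hp
  rcases hΓ.mem_sources_or_step hπ (List.mem_of_getLast? h) with h | ⟨r, hr, _⟩
  · exact h
  · exact absurd hr (mem_unmatched.1 hpU r)

lemma mem_flip {p : P} {r : R} : (p, r) ∈ flip M Γ ↔
    Step Γ (.inl p) (.inr r) ∨ ((p, r) ∈ M ∧ ¬ Step Γ (.inr r) (.inl p)) := by
  have h1 : Step Γ (.inl p) (.inr r) → (p, r) ∉ M := fun h => (hΓ.step_arc h).2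
  have h2 : Step Γ (.inr r) (.inl p) → (p, r) ∈ M := fun h => (hΓ.step_arc h).2
  have h3 : (p, r) ∈ pathEdges Γ ↔ Step Γ (.inl p) (.inr r) ∨ Step Γ (.inr r) (.inl p) := by
    simp only [pathEdges, mem_filter, mem_univ, true_and, Step, ← exists_or, ← and_or_left]
  rw [FairAlloc.flip, mem_symmDiff, h3]
  tauto

variable (hM : A.IsMatching M) (hY : Y ⊆ unmatched M)
include hM hY

lemma flip_isMatching : A.IsMatching (flip M Γ) := by
  have key1 : ∀ {p r r'}, Step Γ (.inl p) (.inr r) → (p, r') ∈ M →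
      Step Γ (.inr r') (.inl p) := by
    rintro p r r' ⟨π, hπ, h⟩ hr'
    rcases hΓ.mem_sources_or_step hπ (mem_of_infix_left h) with h' | ⟨r₀, hr₀, h'⟩
    · exact absurd hr' (mem_unmatched.1 (hY (hΓ.sources_subset h')) r')
    · rwa [hM.resource_eq hr' hr₀]
  have key2 : ∀ {p p' r}, Step Γ (.inl p) (.inr r) → (p', r) ∈ M →
      Step Γ (.inr r) (.inl p') := by
    rintro p p' r ⟨π, hπ, h⟩ hp'
    rcases last_or_succ (mem_of_infix_right h) with h' | ⟨b, hb⟩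
    · obtain ⟨q, _, hq⟩ := (hΓ.1 π hπ).2.2.2
      rw [h'] at hq
      simp at hq
    · obtain ⟨p₀, rfl, _, hp₀⟩ := A.arc_from_resource (hΓ.step_arc ⟨π, hπ, hb⟩)
      rw [hM.player_eq hp' hp₀]
      exact ⟨π, hπ, hb⟩
  refine ⟨?_, ?_, ?_⟩
  · rintro ⟨p, r⟩ h
    rcases hΓ.mem_flip.1 h with h | h
    · exact (hΓ.step_arc h).1
    · exact hM.1 _ h.1
  · rintro ⟨p, r⟩ h ⟨p', r'⟩ h' hp
    obtain rfl : p = p' := hp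
    rw [hΓ.mem_flip] at h h'
    rw [Prod.mk.injEq]
    refine ⟨rfl, ?_⟩
    rcases h with h | ⟨h, hn⟩ <;> rcases h' with h' | ⟨h', hn'⟩
    · exact Sum.inr.inj (hΓ.step_succ_unique h h')
    · exact absurd (key1 h h') hn'
    · exact absurd (key1 h' h) hn
    · exact hM.resource_eq h h'
  · rintro ⟨p, r⟩ h ⟨p', r'⟩ h' hp
    obtain rfl : r = r' := hp
    rw [hΓ.mem_flip] at h h'
    rw [Prod.mk.injEq]
    refine ⟨?_, rfl⟩
    rcases h with h | ⟨h, hn⟩ <;> rcases h' with h' | ⟨h', hn'⟩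
    · exact Sum.inl.inj (hΓ.step_pred_unique h h')
    · exact absurd (key2 h h') hn'
    · exact absurd (key2 h' h) hn
    · exact hM.player_eq h h'

/-- Flipping the edges of the paths trades the sources for the sinks. -/
lemma unmatched_flip : unmatched (flip M Γ) = (unmatched M \ sources Γ) ∪ sinks Γ := by
  ext p
  rw [mem_unmatched, mem_union, mem_sdiff]
  simp only [hΓ.mem_flip, not_or, not_and, not_not]
  constructor
  · intro h
    by_cases hp : ∃ π ∈ Γ, Sum.inl p ∈ π
    · obtain ⟨π, hπ, hp⟩ := hp
      rcases last_or_succ hp with h' | ⟨b, hb⟩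
      · exact Or.inr (mem_sinks.2 ⟨π, hπ, h'⟩)
      · obtain ⟨r, rfl, _⟩ := A.arc_from_player (hΓ.step_arc ⟨π, hπ, hb⟩)
        exact absurd ⟨π, hπ, hb⟩ (h r).1
    · refine Or.inl ⟨mem_unmatched.2 fun r hr => ?_, fun hs => ?_⟩
      · obtain ⟨π, hπ, h'⟩ := (h r).2 hr
        exact hp ⟨π, hπ, mem_of_infix_right h'⟩
      · obtain ⟨π, hπ, h'⟩ := mem_sources.1 hs
        exact hp ⟨π, hπ, List.mem_of_head? h'⟩
  · rintro (⟨hpU, hps⟩ | hp) r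
    · rw [mem_unmatched] at hpU
      refine ⟨?_, fun hr => absurd hr (hpU r)⟩
      rintro ⟨π, hπ, h⟩
      rcases hΓ.mem_sources_or_step hπ (mem_of_infix_left h) with h' | ⟨r₀, hr₀, h'⟩
      · exact hps h'
      · exact hpU _ hr₀
    · obtain ⟨π, hπ, h⟩ := mem_sinks.1 hp
      refine ⟨?_, fun hr => ?_⟩
      · rintro ⟨π', hπ', h'⟩
        obtain rfl := hΓ.path_eq hπ hπ' (List.mem_of_getLast? h) (mem_of_infix_left h')
        exact last_ne_of_succ (hΓ.1 π hπ).2.1 h' h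
      · rcases hΓ.mem_sources_or_step hπ (List.mem_of_getLast? h) with h' | ⟨r₀, hr₀, h'⟩
        · exact absurd hr (mem_unmatched.1 (hY (hΓ.sources_subset h')) r)
        · rwa [hM.resource_eq hr hr₀]

end Setting.Feasible

lemma Setting.Feasible.flip_isMaxMatching (hΓ : A.Feasible M Y S Γ) (hM : A.IsMaxMatching M)
    (hY : Y ⊆ unmatched M) : A.IsMaxMatching (flip M Γ) := by
  refine hM.of_card_unmatched_le (hΓ.flip_isMatching hM.1 hY) ?_
  rw [hΓ.unmatched_flip hM.1 hY]
  have h1 := card_union_le (unmatched M \ sources Γ) (sinks Γ)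
  have h2 := card_sdiff_add_card_eq_card (hΓ.sources_subset.trans hY)
  rw [hΓ.card_sinks] at h1
  rw [hΓ.card_sources] at h2
  lia

/-! ### The number of node-disjoint paths is a rank -/

/-- The arcs of the symmetric difference of two matchings, oriented as in `G_M`. -/
def diffArc (M N : Finset (P × R)) : P ⊕ R → P ⊕ R → Prop
  | .inl p, .inr r => (p, r) ∈ N ∧ (p, r) ∉ M
  | .inr r, .inl p => (p, r) ∈ M ∧ (p, r) ∉ N
  | _, _ => False

/-- The symmetric difference of two maximum matchings contains node-disjoint paths that lead
from the players missed by the first to the players missed by the second. -/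
lemma Setting.IsMaxMatching.exists_paths {N : Finset (P × R)} (hN : A.IsMaxMatching N)
    (hM : A.IsMaxMatching M) : ∃ π : P → List (P ⊕ R),
      (∀ p ∈ unmatched M, (π p).IsChain (diffArc M N) ∧ (π p).Nodup ∧
        (π p).head? = some (.inl p) ∧ ∃ q ∈ unmatched N, (π p).getLast? = some (.inl q)) ∧
      ∀ p ∈ unmatched M, ∀ p' ∈ unmatched M, p ≠ p' → (π p).Disjoint (π p') := by
  induction hn : (N \ M).card using Nat.strong_induction_on generalizing M with
  | _ n ih =>
  by_cases hsub : unmatched M ⊆ unmatched N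
  · refine ⟨fun p => [.inl p], fun p hp => ⟨by simp, by simp, rfl, p, hsub hp, rfl⟩, ?_⟩
    intro p _ p' _ hne
    simpa using fun h => hne h.symm
  obtain ⟨e, he, heN⟩ := not_subset.1 hsub
  obtain ⟨r, hr⟩ := notMem_unmatched.1 heN
  obtain ⟨p, hpe, hp, hM', hU⟩ := hM.swap he (hN.1.1 _ hr)
  have hpr : (p, r) ∉ N := fun h => hpe (hN.1.player_eq h hr)
  obtain ⟨π, hπ, hdisj⟩ := ih _ (hn ▸ card_sdiff_swap_lt hr (mem_unmatched.1 he r) hpr) hM' rfl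
  set M' := insert (e, r) (M.erase (p, r)) with hMdef
  have her : (e, r) ∈ M' := mem_insert_self _ _
  have harc : ∀ a b, diffArc M' N a b → diffArc M N a b := by
    rintro (a | a) (b | b) h
    · exact h
    · refine ⟨h.1, fun hab => h.2 (mem_insert_of_mem (mem_erase.2 ⟨?_, hab⟩))⟩
      rintro h'
      exact hpr (h' ▸ h.1)
    · refine ⟨?_, h.2⟩
      rcases mem_insert.1 h.1 with h' | h'
      · exact absurd (h' ▸ hr) h.2
      · exact mem_of_mem_erase h'
    · exact h
  have hne : ∀ q ∈ unmatched M', Sum.inl e ∉ π q ∧ Sum.inr r ∉ π q := by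
    intro q hq
    obtain ⟨hch, _, hhd, _⟩ := hπ q hq
    refine ⟨fun hmem => ?_, fun hmem => ?_⟩
    · rcases head_or_pred hmem with h | ⟨b, hb⟩
      · rw [hhd] at h
        obtain rfl : q = e := by simpa using h
        exact mem_unmatched.1 hq _ her
      · have := rel_of_infix_pair hch hb
        rcases b with b | b
        · exact this
        · have hbr := hM'.1.resource_eq this.1 her
          exact this.2 (hbr ▸ hr)
    · rcases head_or_pred hmem with h | ⟨b, hb⟩
      · rw [hhd] at h
        simp at h
      · have := rel_of_infix_pair hch hb
        rcases b with b | b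
        · have hbe := hN.1.player_eq this.1 hr
          exact this.2 (hbe ▸ her)
        · exact this
  have hpU' : p ∈ unmatched M' := by
    rw [hU]
    exact mem_insert_self _ _
  have hmemU : ∀ q ∈ unmatched M, q ≠ e → q ∈ unmatched M' ∧ q ≠ p := by
    intro q hq hqe
    refine ⟨?_, ?_⟩
    · rw [hU]
      exact mem_insert_of_mem (mem_erase.2 ⟨hqe, hq⟩)
    · rintro rfl
      exact mem_unmatched.1 hq _ hp
  have hcons : ∀ {q : P}, q ∈ unmatched M' → q ≠ p →
      (Sum.inl e :: Sum.inr r :: π p).Disjoint (π q) := by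
    intro q hq hqp
    rw [List.disjoint_cons_left, List.disjoint_cons_left]
    exact ⟨(hne q hq).1, (hne q hq).2, hdisj p hpU' q hq hqp.symm⟩
  refine ⟨fun q => if q = e then .inl e :: .inr r :: π p else π q, fun q hq => ?_,
    fun q hq q' hq' hqq => ?_⟩
  · by_cases hqe : q = e
    · subst hqe
      obtain ⟨hch, hnd, hhd, z, hz, hlast⟩ := hπ p hpU'
      simp only [if_true]
      obtain ⟨t, ht⟩ : ∃ t, π p = .inl p :: t := by
        cases hpp : π p with
        | nil => simp [hpp] at hhd
        | cons a t =>
          rw [hpp] at hhd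
          simp only [List.head?_cons, Option.some.injEq] at hhd
          exact ⟨t, by rw [hhd]⟩
      refine ⟨?_, ?_, rfl, z, hz, ?_⟩
      · have hch' := hch.imp harc
        rw [ht] at hch' ⊢
        rw [List.isChain_cons_cons, List.isChain_cons_cons]
        exact ⟨⟨hr, mem_unmatched.1 he r⟩, ⟨hp, hpr⟩, hch'⟩
      · rw [List.nodup_cons, List.nodup_cons, List.mem_cons, not_or]
        exact ⟨⟨by simp, (hne p hpU').1⟩, (hne p hpU').2, hnd⟩
      · rw [ht] at hlast ⊢
        simpa using hlast
    · simp only [if_neg hqe]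
      obtain ⟨hch, h⟩ := hπ q (hmemU q hq hqe).1
      exact ⟨hch.imp harc, h⟩
  · by_cases hqe : q = e
    · have hqe' : q' ≠ e := fun h => hqq (hqe.trans h.symm)
      simp only [if_pos hqe, if_neg hqe']
      exact hcons (hmemU q' hq' hqe').1 (hmemU q' hq' hqe').2
    · by_cases hqe' : q' = e
      · simp only [if_pos hqe', if_neg hqe]
        exact (hcons (hmemU q hq hqe).1 (hmemU q hq hqe).2).symm
      · simp only [if_neg hqe', if_neg hqe]
        exact hdisj q (hmemU q hq hqe).1 q' (hmemU q' hq' hqe').1 hqq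

lemma Setting.Feasible.card_add_le_rank (hΓ : A.Feasible M Y S Γ) (hM : A.IsMaxMatching M)
    (hY : Y ⊆ unmatched M) :
    Γ.card + (unmatched M \ Y).card ≤ A.rank ((unmatched M \ Y) ∪ S) := by
  have hdis : Disjoint (unmatched M \ Y) (sinks Γ) := by
    rw [disjoint_left]
    intro p hp hps
    obtain ⟨hpU, hpY⟩ := mem_sdiff.1 hp
    exact hpY (hΓ.sources_subset (hΓ.sinks_inter_unmatched_subset (mem_inter.2 ⟨hps, hpU⟩)))
  have hsub : (unmatched M \ Y) ∪ sinks Γ ⊆ unmatched (flip M Γ) := by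
    rw [hΓ.unmatched_flip hM.1 hY]
    exact union_subset_union (sdiff_subset_sdiff subset_rfl hΓ.sources_subset) subset_rfl
  have h1 := (hΓ.flip_isMaxMatching hM hY).rank_of_subset_unmatched hsub
  rw [card_union_of_disjoint hdis, hΓ.card_sinks] at h1
  have h2 := A.isRank.mono (union_subset_union (subset_refl (unmatched M \ Y)) hΓ.sinks_subset)
  lia

lemma Setting.IsMaxMatching.exists_feasible (hM : A.IsMaxMatching M) (hY : Y ⊆ unmatched M)
    (S : Finset P) : ∃ Γ, A.Feasible M Y S Γ ∧
      A.rank ((unmatched M \ Y) ∪ S) ≤ Γ.card + (unmatched M \ Y).card := by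
  classical
  set J := unmatched M \ Y with hJ
  obtain ⟨N, hN, hJN, hcard⟩ := A.exists_unmatched (J := J) (S := J ∪ S)
    (hM.rank_of_subset_unmatched sdiff_subset) subset_union_left
  obtain ⟨π, hπ, hdisj⟩ := hN.exists_paths hM
  have h1 : ∀ p : P, ∃ q, p ∈ unmatched M → q ∈ unmatched N ∧
      (π p).getLast? = some (.inl q) := by
    intro p
    by_cases hp : p ∈ unmatched M
    · obtain ⟨q, hq, h⟩ := (hπ p hp).2.2.2
      exact ⟨q, fun _ => ⟨hq, h⟩⟩
    · exact ⟨p, fun h => absurd h hp⟩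
  choose q hq using h1
  have hinj : Set.InjOn q (unmatched M : Set P) := by
    intro p hp p' hp' h
    by_contra hne
    refine hdisj p hp p' hp' hne (List.mem_of_getLast? (hq p hp).2) ?_
    rw [h]
    exact List.mem_of_getLast? (hq p' hp').2
  have himg : (unmatched M).image q = unmatched N := by
    refine eq_of_subset_of_card_le (fun x hx => ?_) ?_
    · obtain ⟨p, hp, rfl⟩ := mem_image.1 hx
      exact (hq p hp).1
    · rw [card_image_of_injOn hinj, hM.card_unmatched_eq hN]
  have htriv : ∀ p ∈ J, q p = p := by
    intro p hp
    have hpM := (mem_sdiff.1 hp).1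
    obtain ⟨hch, _, hhd, _⟩ := hπ p hpM
    have hl := (hq p hpM).2
    rcases last_or_succ (List.mem_of_head? hhd) with h | ⟨b, hb⟩
    · rw [h] at hl
      simpa using hl.symm
    · have := rel_of_infix_pair hch hb
      rcases b with b | b
      · exact this.elim
      · exact absurd this.1 (mem_unmatched.1 (hJN hp) b)
  set Y' := Y.filter fun p => q p ∈ S with hY'
  have hY'M : ∀ p ∈ Y', p ∈ unmatched M := fun p hp => hY (mem_filter.1 hp).1
  have hπinj : Set.InjOn π (Y' : Set P) := by
    intro p hp p' hp' h
    have h2 := (hπ p (hY'M p hp)).2.2.1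
    rw [h, (hπ p' (hY'M p' hp')).2.2.1] at h2
    simpa using h2.symm
  refine ⟨Y'.image π, ⟨?_, ?_⟩, ?_⟩
  · intro l hl
    obtain ⟨p, hp, rfl⟩ := mem_image.1 hl
    obtain ⟨hch, hnd, hhd, _⟩ := hπ p (hY'M p hp)
    refine ⟨hch.imp ?_, hnd, ⟨p, (mem_filter.1 hp).1, hhd⟩, q p, (mem_filter.1 hp).2,
      (hq p (hY'M p hp)).2⟩
    rintro (a | a) (b | b) h
    · exact h
    · exact ⟨hN.1.1 _ h.1, h.2⟩
    · exact ⟨hM.1.1 _ h.1, h.1⟩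
    · exact h
  · intro l hl l' hl' hne
    obtain ⟨p, hp, rfl⟩ := mem_image.1 hl
    obtain ⟨p', hp', rfl⟩ := mem_image.1 hl'
    exact hdisj p (hY'M p hp) p' (hY'M p' hp') (fun h => hne (h ▸ rfl))
  · rw [card_image_of_injOn hπinj, ← hcard]
    have hsub : (J ∪ S) ∩ unmatched N ⊆ Y'.image q ∪ J := by
      intro x hx
      obtain ⟨hx1, hx2⟩ := mem_inter.1 hx
      rw [mem_union]
      by_cases hxJ : x ∈ J
      · exact Or.inr hxJ
      have hxS := (mem_union.1 hx1).resolve_left hxJ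
      rw [← himg] at hx2
      obtain ⟨p, hp, rfl⟩ := mem_image.1 hx2
      refine Or.inl (mem_image_of_mem q (mem_filter.2 ⟨?_, hxS⟩))
      by_contra hpY
      have hpJ : p ∈ J := mem_sdiff.2 ⟨hp, hpY⟩
      rw [htriv p hpJ] at hxJ
      exact hxJ hpJ
    refine (card_le_card hsub).trans ((card_union_le _ _).trans ?_)
    exact Nat.add_le_add_right card_image_le _

/-- For a set `Y` of unmatched players, `f_M(Y, S)` is the rank of `S` after contraction of the
other unmatched players. -/
theorem Setting.IsMaxMatching.maxPaths_add (hM : A.IsMaxMatching M) (hY : Y ⊆ unmatched M)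
    (S : Finset P) : A.maxPaths M Y S + (unmatched M \ Y).card =
      A.rank ((unmatched M \ Y) ∪ S) := by
  have hbdd : ∀ n ∈ {n : ℕ | ∃ Γ : Finset (List (P ⊕ R)), A.Feasible M Y S Γ ∧ Γ.card = n},
      n ≤ A.rank ((unmatched M \ Y) ∪ S) - (unmatched M \ Y).card := by
    rintro n ⟨Γ, hΓ, rfl⟩
    have := hΓ.card_add_le_rank hM hY
    lia
  obtain ⟨Γ, hΓ, hc⟩ := hM.exists_feasible hY S
  have h1 : Γ.card ≤ A.maxPaths M Y S := le_csSup ⟨_, hbdd⟩ ⟨Γ, hΓ, rfl⟩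
  have h2 : A.maxPaths M Y S ≤ _ := csSup_le ⟨_, Γ, hΓ, rfl⟩ hbdd
  have h3 := hΓ.card_add_le_rank hM hY
  lia

end Paths

/-! ### Nested independent sets and transversals for a rank function -/

section RankArguments

variable {P : Type u} [Fintype P] [DecidableEq P] {r : Finset P → ℕ}

namespace IsRank

variable {α : Type*} [DecidableEq α] (h : IsRank r) (f : α → P)
include h

lemma rank_union_image_le (W : Finset P) (J : Finset α) :
    r (W ∪ J.image f) ≤ r W + J.card :=
  (h.union_le _ _).trans (Nat.add_le_add_left card_image_le _)

lemma indep_union_image_mono {W W' : Finset P} {J J' : Finset α} (hW : W' ⊆ W) (hJ : J' ⊆ J)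
    (hr : W.card + J.card ≤ r (W ∪ J.image f)) :
    r (W' ∪ J'.image f) = W'.card + J'.card := by
  have h1 := h.rank_union_image_le f (W' ∪ J'.image f) (J \ J')
  have h2 := h.union_le ((W' ∪ J'.image f) ∪ (J \ J').image f) (W \ W')
  have h3 : ((W' ∪ J'.image f) ∪ (J \ J').image f) ∪ (W \ W') = W ∪ J.image f := by
    have h31 : J.image f = J'.image f ∪ (J \ J').image f := by
      rw [← image_union, union_sdiff_of_subset hJ]
    have h32 : W = W' ∪ (W \ W') := (union_sdiff_of_subset hW).symm
    conv_rhs => rw [h31, h32]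
    ext; simp only [mem_union]; tauto
  rw [h3] at h2
  have h4 := card_sdiff_add_card_eq_card hW
  have h5 := card_sdiff_add_card_eq_card hJ
  have h6 := h.rank_union_image_le f W' J'
  have h7 := h.le_card W'
  lia

lemma exists_extension {W : Finset P} {J I : Finset α} (hJI : J ⊆ I)
    (hJ : r (W ∪ J.image f) = W.card + J.card) :
    ∃ K, J ⊆ K ∧ K ⊆ I ∧ r (W ∪ K.image f) = W.card + K.card ∧
      r (W ∪ K.image f) = r (W ∪ I.image f) := by
  induction hn : (I \ J).card using Nat.strong_induction_on generalizing J with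
  | _ n ih =>
  by_cases hsp : W ∪ I.image f ⊆ span r (W ∪ J.image f)
  · exact ⟨J, subset_rfl, hJI, hJ,
      le_antisymm (h.mono (union_subset_union subset_rfl (image_subset_image hJI)))
        (h.rank_le_of_subset_span hsp)⟩
  obtain ⟨p, hp, hpn⟩ := not_subset.1 hsp
  have hp' : p ∉ W ∪ J.image f := fun hh => hpn (subset_span r _ hh)
  rw [mem_union, not_or] at hp'
  obtain ⟨e, he, rfl⟩ := mem_image.1 ((mem_union.1 hp).resolve_left hp'.1)
  have heJ : e ∉ J := fun hh => hp'.2 (mem_image_of_mem f hh)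
  obtain ⟨K, hK, h'⟩ := ih (I \ insert e J).card (by
    rw [← hn]
    refine card_lt_card ⟨sdiff_subset_sdiff subset_rfl (subset_insert _ _), fun hs => ?_⟩
    have := hs (mem_sdiff.2 ⟨he, heJ⟩)
    simp at this) (J := insert e J) (insert_subset he hJI) (by
    rw [image_insert, union_insert, h.notMem_span.1 hpn, hJ, card_insert_of_notMem heJ, add_assoc])
    rfl
  exact ⟨K, (subset_insert _ _).trans hK, h'⟩

/-- For a decreasing sequence of independent sets `W i`, the sets `J i ⊆ I` of elements that
extend `W i` to a basis of `W i ∪ I` can be chosen increasing in `i`. -/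
lemma exists_nested {W : ℕ → Finset P} (hanti : Antitone W) (hW : r (W 0) = (W 0).card)
    (I : Finset α) (h0 : r (W 0 ∪ I.image f) = (W 0).card) :
    ∃ J : ℕ → Finset α, J 0 = ∅ ∧ ∀ i, J i ⊆ J (i + 1) ∧ J i ⊆ I ∧
      r (W i ∪ (J i).image f) = (W i).card + (J i).card ∧
      r (W i ∪ (J i).image f) = r (W i ∪ I.image f) := by
  let Good (i : ℕ) (J : Finset α) : Prop := J ⊆ I ∧
      r (W i ∪ J.image f) = (W i).card + J.card ∧ r (W i ∪ J.image f) = r (W i ∪ I.image f)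
  have step : ∀ i J, Good i J → ∃ K, Good (i + 1) K ∧ J ⊆ K := by
    rintro i J ⟨hJI, hJ, _⟩
    obtain ⟨K, hJK, hK⟩ := h.exists_extension f (W := W (i + 1)) hJI
      (h.indep_union_image_mono f (hanti (Nat.le_succ i)) subset_rfl hJ.ge)
    exact ⟨K, hK, hJK⟩
  choose! g hg using step
  let J : ℕ → Finset α := fun i => Nat.rec ∅ g i
  have hJ : ∀ i, Good i (J i) := by
    intro i
    induction i with
    | zero => exact ⟨empty_subset _, by simpa [J] using hW, by simpa [J, h0] using hW⟩
    | succ i ih => exact (hg i (J i) ih).1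
  exact ⟨J, rfl, fun i => ⟨(hg i (J i) (hJ i)).2, hJ i⟩⟩

end IsRank

/-- A layered family of sets: `F j k` is the `k`-th set of layer `j`, for `1 ≤ j ≤ i` and
`k < n j`. `Φ h` bounds from below the rank that `W h` has together with any set of a layer
above `h`, and the `k`-th set of layer `j` has rank at most `Φ j - (n j - k)`, up to `err j`. -/
structure LayeredFamily (r : Finset P → ℕ) (W : ℕ → Finset P) (F : ℕ → ℕ → Finset P)
    (n Φ err : ℕ → ℕ) (i : ℕ) : Prop where
  anti : Antitone W
  subset : ∀ j ∈ Icc 1 i, ∀ k, W j ⊆ F j k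
  base : r univ ≤ Φ 0
  upper : ∀ j ∈ Icc 1 i, ∀ k < n j, r (F j k) + n j ≤ Φ j + k + err j
  lower : ∀ j ∈ Icc 1 i, ∀ h < j, ∀ k, Φ h ≤ r (W h ∪ F j k)

/-- The positions `(j, k)` of a layered family. -/
def positions (n : ℕ → ℕ) (i : ℕ) : Finset (Σ _ : ℕ, ℕ) := (Icc 1 i).sigma fun j => range (n j)

/-- The common elements of the sets at the positions in `K`. -/
def commonSet (F : ℕ → ℕ → Finset P) (K : Finset (Σ _ : ℕ, ℕ)) : Finset P :=
  univ.filter fun p => ∀ κ ∈ K, p ∈ F κ.1 κ.2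

/-- Submodularity, applied layer by layer: intersecting the sets at the positions in `K` lowers
the rank by `K.card`, up to the error terms. -/
lemma LayeredFamily.exists_rank_commonSet_le (h : IsRank r) {W : ℕ → Finset P}
    {F : ℕ → ℕ → Finset P} {n Φ err : ℕ → ℕ} {i : ℕ} (hF : LayeredFamily r W F n Φ err i) :
    ∀ j ≤ i, ∀ K ⊆ positions n j, ∃ l ≤ j, W l ⊆ commonSet F K ∧
      r (commonSet F K) + K.card ≤ Φ l + ∑ m ∈ Icc 1 j, err m := by
  intro j
  induction j with
  | zero =>
    intro _ K hK
    have hK' : K = ∅ := subset_empty.1 (hK.trans (by simp [positions]))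
    subst hK'
    refine ⟨0, le_rfl, by simp [commonSet], ?_⟩
    simpa [commonSet] using hF.base
  | succ j ih =>
    intro hj K hK
    have hjmem : j + 1 ∈ Icc 1 i := mem_Icc.2 ⟨by lia, hj⟩
    set K₁ := K.filter fun κ => κ.1 = j + 1 with hK₁
    set K₀ := K.filter fun κ => ¬ κ.1 = j + 1 with hK₀
    have hcard : K₁.card + K₀.card = K.card := card_filter_add_card_filter_not _
    have hK₀' : K₀ ⊆ positions n j := by
      intro κ hκ
      obtain ⟨hκ, hne⟩ := mem_filter.1 hκ
      have := hK hκ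
      simp only [positions, mem_sigma, mem_Icc] at this ⊢
      exact ⟨⟨this.1.1, by lia⟩, this.2⟩
    obtain ⟨l, hl, hWl, hrl⟩ := ih (by lia) K₀ hK₀'
    have hsum : ∑ m ∈ Icc 1 (j + 1), err m = ∑ m ∈ Icc 1 j, err m + err (j + 1) :=
      sum_Icc_succ_top (by lia) _
    rcases K₁.eq_empty_or_nonempty with hemp | hne
    · have hKK : K₀ = K := by
        rw [hK₀, filter_true_of_mem]
        intro κ hκ hκ'
        have : κ ∈ K₁ := mem_filter.2 ⟨hκ, hκ'⟩
        simp [hemp] at this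
      rw [hKK] at hWl hrl
      exact ⟨l, by lia, hWl, by lia⟩
    -- only the first set of layer `j + 1` is used: the bound for its rank already leaves room
    -- for all positions of the layer from there on
    obtain ⟨κ, hκ, hmin⟩ := exists_min_image K₁ (fun κ => κ.2) hne
    obtain ⟨hκK, hκj⟩ := mem_filter.1 hκ
    have hκn : κ.2 < n (j + 1) := by
      have := hK hκK
      rw [positions, mem_sigma, mem_range, hκj] at this
      exact this.2
    have hK₁card : K₁.card ≤ n (j + 1) - κ.2 := by
      rw [← Nat.card_Ico]
      refine card_le_card_of_injOn (fun κ => κ.2) (fun κ' hκ' => ?_) ?_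
      · obtain ⟨h1, h2⟩ := mem_filter.1 hκ'
        have := hK h1
        rw [positions, mem_sigma, mem_range, h2] at this
        rw [coe_Ico]
        exact ⟨hmin κ' hκ', this.2⟩
      · rintro ⟨a, b⟩ ha ⟨a', b'⟩ ha' hab
        have h1 := (mem_filter.1 ha).2
        have h2 := (mem_filter.1 ha').2
        simp only at h1 h2 hab
        rw [h1, h2, hab]
    have hinter : commonSet F K ⊆ commonSet F K₀ ∩ F (j + 1) κ.2 := by
      intro p hp
      have hp := (mem_filter.1 hp).2
      refine mem_inter.2 ⟨mem_filter.2 ⟨mem_univ _, fun κ' hκ' => hp κ' (mem_filter.1 hκ').1⟩, ?_⟩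
      have := hp κ hκK
      rwa [hκj] at this
    refine ⟨j + 1, le_rfl, ?_, ?_⟩
    · intro p hp
      refine mem_filter.2 ⟨mem_univ _, fun κ' hκ' => ?_⟩
      by_cases hj' : κ'.1 = j + 1
      · rw [hj']
        exact hF.subset _ hjmem _ hp
      · exact (mem_filter.1 (hWl (hF.anti (by lia) hp))).2 κ' (mem_filter.2 ⟨hκ', hj'⟩)
    · have h1 := h.mono hinter
      have h2 := h.submod (commonSet F K₀) (F (j + 1) κ.2)
      have h3 := hF.lower _ hjmem l (by lia) κ.2
      have h4 := h.mono (union_subset_union hWl (subset_refl (F (j + 1) κ.2)))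
      have h5 := hF.upper _ hjmem _ hκn
      lia

/-- A weighted form of Hall's theorem. If an independent set `T` of full rank is given, the
positions of a layered family can be matched injectively, with `∑ err` exceptions, to elements
of `T` outside of the sets at these positions; a bound for the weight of a position by the
weight of every such element then carries over to the sums. -/
lemma LayeredFamily.sum_le (h : IsRank r) {W : ℕ → Finset P}
    {F : ℕ → ℕ → Finset P} {n Φ err : ℕ → ℕ} {i : ℕ} (hF : LayeredFamily r W F n Φ err i)
    {T : Finset P} (hT : r T = T.card) (hΦ : ∀ l ≤ i, Φ l ≤ T.card)
    {wt : ℕ → ℕ → ℝ} {c : P → ℝ} {B : ℝ} (hwt : ∀ j k, wt j k ≤ B) (hB : 0 ≤ B)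
    (hc : ∀ t ∈ T, 0 ≤ c t)
    (hwc : ∀ j ∈ Icc 1 i, ∀ k < n j, ∀ t ∈ T, t ∉ F j k → wt j k ≤ c t) :
    ∑ j ∈ Icc 1 i, ∑ k ∈ range (n j), wt j k ≤
      ∑ t ∈ T, c t + (∑ m ∈ Icc 1 i, err m : ℕ) * B := by
  set e := ∑ m ∈ Icc 1 i, err m with he
  let t : positions n i → Finset (P ⊕ Fin e) := fun κ =>
    (T \ F κ.1.1 κ.1.2).disjSum univ
  have hall : ∀ s : Finset (positions n i), s.card ≤ (s.biUnion t).card := by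
    intro s
    rcases s.eq_empty_or_nonempty with rfl | ⟨κ₀, hκ₀⟩
    · simp
    set K : Finset (Σ _ : ℕ, ℕ) := s.map (Function.Embedding.subtype _) with hK
    have hKsub : K ⊆ positions n i := by
      intro κ hκ
      obtain ⟨κ', _, rfl⟩ := mem_map.1 hκ
      exact κ'.2
    obtain ⟨l, hl, _, hr⟩ := hF.exists_rank_commonSet_le h i le_rfl K hKsub
    have hsub : (T \ commonSet F K).disjSum (univ : Finset (Fin e)) ⊆ s.biUnion t := by
      intro x hx
      rcases x with p | m
      · rw [inl_mem_disjSum, mem_sdiff] at hx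
        obtain ⟨hpT, hp⟩ := hx
        simp only [commonSet, mem_filter, mem_univ, true_and, not_forall] at hp
        obtain ⟨κ, hκ, hp⟩ := hp
        obtain ⟨κ', hκ', rfl⟩ := mem_map.1 hκ
        exact mem_biUnion.2 ⟨κ', hκ', inl_mem_disjSum.2 (mem_sdiff.2 ⟨hpT, hp⟩)⟩
      · exact mem_biUnion.2 ⟨κ₀, hκ₀, inr_mem_disjSum.2 (mem_univ _)⟩
    have h1 := card_le_card hsub
    rw [card_disjSum, card_univ, Fintype.card_fin] at h1
    have h2 : (T ∩ commonSet F K).card ≤ r (commonSet F K) := by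
      rw [← h.indep_subset hT.ge inter_subset_left]
      exact h.mono inter_subset_right
    have h3 := card_sdiff_add_card_inter T (commonSet F K)
    have h4 : K.card = s.card := card_map _
    have h5 := hΦ l hl
    lia
  obtain ⟨φ, hinj, hφ⟩ := (all_card_le_biUnion_card_iff_exists_injective t).1 hall
  let g : P ⊕ Fin e → ℝ := Sum.elim c fun _ => B
  have h1 : ∑ j ∈ Icc 1 i, ∑ k ∈ range (n j), wt j k =
      ∑ κ : positions n i, wt κ.1.1 κ.1.2 := by
    rw [← sum_sigma (Icc 1 i) (fun j => range (n j)) (fun κ => wt κ.1 κ.2)]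
    exact (sum_coe_sort (positions n i) (fun κ => wt κ.1 κ.2)).symm
  have h2 : ∀ κ : positions n i, wt κ.1.1 κ.1.2 ≤ g (φ κ) := by
    intro κ
    have hκ := hφ κ
    have hpos : κ.1 ∈ (Icc 1 i).sigma fun j => range (n j) := κ.2
    rw [mem_sigma, mem_range] at hpos
    cases hx : φ κ with
    | inl p =>
      rw [hx, inl_mem_disjSum, mem_sdiff] at hκ
      exact hwc _ hpos.1 _ hpos.2 p hκ.1 hκ.2
    | inr m => exact hwt _ _
  rw [h1]
  calc ∑ κ : positions n i, wt κ.1.1 κ.1.2 ≤ ∑ κ : positions n i, g (φ κ) :=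
        sum_le_sum fun κ _ => h2 κ
    _ = ∑ x ∈ univ.image φ, g x := (sum_image fun _ _ _ _ hh => hinj hh).symm
    _ ≤ ∑ x ∈ T.disjSum (univ : Finset (Fin e)), g x := by
        refine sum_le_sum_of_subset_of_nonneg (fun x hx => ?_) (fun x hx _ => ?_)
        · obtain ⟨κ, _, rfl⟩ := mem_image.1 hx
          exact disjSum_mono sdiff_subset subset_rfl (hφ κ)
        · rcases x with p | m
          · exact hc p (inl_mem_disjSum.1 hx)
          · exact hB
    _ = ∑ t ∈ T, c t + (e : ℝ) * B := by
        rw [sum_disjSum]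
        simp [g]

end RankArguments

section Invariants

variable {P : Type u} {R : Type w} [Fintype P] [Fintype R] [DecidableEq P] [DecidableEq R]

/-! ### Values and players of sets of edges -/

section Basics

lemma mem_players {S : Finset (Edge P R)} {p : P} : p ∈ players S ↔ ∃ e ∈ S, e.1 = p := by
  rw [players, mem_image]

lemma players_mono {S T : Finset (Edge P R)} (h : S ⊆ T) : players S ⊆ players T :=
  image_subset_image h

lemma players_union (S T : Finset (Edge P R)) : players (S ∪ T) = players S ∪ players T :=
  image_union _ _

lemma players_insert (e : Edge P R) (S : Finset (Edge P R)) :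
    players (insert e S) = insert e.1 (players S) := image_insert _ _ _

@[simp] lemma players_empty : players (∅ : Finset (Edge P R)) = ∅ := image_empty _

lemma mem_resources {S : Finset (Edge P R)} {r : R} : r ∈ resources S ↔ ∃ e ∈ S, r ∈ e.2 := by
  rw [resources, mem_biUnion]

lemma resources_mono {S T : Finset (Edge P R)} (h : S ⊆ T) : resources S ⊆ resources T :=
  biUnion_subset_biUnion_of_subset_left _ h

lemma disjoint_resources {S : Finset (Edge P R)} {B : Finset R} :
    Disjoint B (resources S) ↔ ∀ e ∈ S, Disjoint B e.2 := by
  rw [resources, disjoint_biUnion_right]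

variable {A : Setting P R}

lemma Setting.value_mono {B B' : Finset R} (h : B ⊆ B') : A.value B ≤ A.value B' :=
  sum_le_sum_of_subset_of_nonneg h fun r _ _ => A.v_nonneg r

lemma Setting.value_nonneg (B : Finset R) : 0 ≤ A.value B := sum_nonneg fun r _ => A.v_nonneg r

lemma Setting.MinimalSet.value_le {B : Finset R} (hu : 0 ≤ A.tau / A.lam) (h : A.MinimalSet B)
    (hthin : ∀ r ∈ B, ¬ A.Fat r) : A.value B ≤ 2 * (A.tau / A.lam) := by
  rcases B.eq_empty_or_nonempty with rfl | ⟨r, hr⟩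
  · simp only [Setting.value, sum_empty]
    linarith
  · have h1 := h.2 _ (erase_ssubset hr)
    have h2 : A.v r + A.value (B.erase r) = A.value B := add_sum_erase _ _ hr
    have h3 : A.v r < A.tau / A.lam := not_le.1 (hthin r hr)
    linarith

lemma Setting.exists_minimalSet {B : Finset R} (h : A.tau / A.lam ≤ A.value B) :
    ∃ B' ⊆ B, A.MinimalSet B' := by
  classical
  obtain ⟨B', hB', hmin⟩ := exists_min_image
    (B.powerset.filter fun B' => A.tau / A.lam ≤ A.value B') card
    ⟨B, mem_filter.2 ⟨mem_powerset_self B, h⟩⟩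
  rw [mem_filter, mem_powerset] at hB'
  refine ⟨B', hB'.1, hB'.2, fun C hC => ?_⟩
  by_contra hle
  have := hmin C (mem_filter.2 ⟨mem_powerset.2 (hC.1.trans hB'.1), not_lt.1 hle⟩)
  exact absurd (card_lt_card hC) (not_lt.2 this)

end Basics

/-! ### Invariants of the algorithm -/

/-- The unmatched players outside of `Y_{≤ j}`. -/
def State.rest (s : State P R) (j : ℕ) : Finset P := unmatched s.M \ players (s.Yle j)

/-- The closure of the unmatched players outside of `Y_{≤ j}` and the players of `ℐ`. A player `p`
satisfies `f_M(Y_{≤ j}, I ∪ {p}) = f_M(Y_{≤ j}, I) + 1` if and only if it is not in this set. -/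
noncomputable def Setting.reach (A : Setting P R) (s : State P R) (j : ℕ) : Finset P :=
  span A.rank (s.rest j ∪ players s.I)

/-- The number of edges in the layers `𝒳_1, …, 𝒳_k`. -/
def State.sizeX (s : State P R) (k : ℕ) : ℕ := ∑ h ∈ Icc 1 k, (s.layer h).X.card

lemma Setting.IsMaxMatching.maxPaths_succ_iff {A : Setting P R} {M : Finset (P × R)}
    {Y S : Finset P} {p : P} (hM : A.IsMaxMatching M) (hY : Y ⊆ unmatched M) :
    A.maxPaths M Y (S ∪ {p}) = A.maxPaths M Y S + 1 ↔
      p ∉ span A.rank ((unmatched M \ Y) ∪ S) := by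
  have h1 := hM.maxPaths_add hY S
  have h2 := hM.maxPaths_add hY (S ∪ {p})
  rw [A.isRank.notMem_span]
  have h3 : (unmatched M \ Y) ∪ (S ∪ {p}) = insert p ((unmatched M \ Y) ∪ S) := by
    ext; simp only [mem_union, mem_insert, mem_singleton]; tauto
  rw [h3] at h2
  lia

/-- What is remembered about the construction of layer `j + 1`: the list `L` of the edges that
were put into `𝒳_{j+1}`, in this order, and the values `W` of the set of unmatched players outside
of `Y_{≤ j}` and `J` of `ℐ` at the time when the first edge of `L` was chosen. Edges of `L` may have
left `𝒳_{j+1}` since, but then their players are in the closure of the current `ℐ`. The fields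
`before` and `after` say that a player who was still addable had no uncovered thin resources of a
value larger than that of the edge chosen next (or of `τ`), resp. less than `τ/λ` at the end. -/
structure Setting.Record (A : Setting P R) (s : State P R) (j : ℕ) (L : List (Edge P R))
    (W : Finset P) (J : Finset (Edge P R)) : Prop where
  subset : (s.layer (j + 1)).X ⊆ L.toFinset
  nodup : L.Nodup
  indep : (s.rest j).card + J.card + L.length ≤ A.rank (W ∪ players J ∪ players L.toFinset)
  start : W ∪ players J ⊆ A.reach s j
  removed : ∀ e ∈ L, e ∉ (s.layer (j + 1)).X → e.1 ∈ A.reach s j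
  value_le : ∀ e ∈ L, A.value e.2 ≤ A.tau + A.tau / A.lam
  value_le_of_mem : ∀ e ∈ J, A.value e.2 ≤ 2 * (A.tau / A.lam)
  before : ∀ L₁ e L₂, L = L₁ ++ e :: L₂ →
    ∀ q ∉ span A.rank (W ∪ players J ∪ players (s.Xle j) ∪ players L₁.toFinset), ∀ O : Finset R,
      (∀ r ∈ O, A.desires q r ∧ ¬ A.Fat r) →
      Disjoint O (resources (s.Xle j ∪ s.Yle j ∪ J ∪ L₁.toFinset)) →
      A.tau ≤ A.value e.2 ∨ A.value O ≤ A.value e.2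
  after : ∀ q ∉ span A.rank (W ∪ players J ∪ players (s.Xle j) ∪ players L.toFinset),
    ∀ O : Finset R, (∀ r ∈ O, A.desires q r ∧ ¬ A.Fat r) →
      Disjoint O (resources (s.Xle j ∪ s.Yle j ∪ J ∪ L.toFinset)) → A.value O < A.tau / A.lam

/-- The invariants of the states of the algorithm started with the player `p₀`. By `I_indep`, the
set `ℐ` is independent over the unmatched players outside of `Y_{≤ ℓ}`, and `X_rank` is the lower
bound `f_M(Y_{≤ j}, X_{≤ j+1} ∪ I) ≥ |𝒳_{≤ j+1}|`. The fields `X_blocked` and `X_meets` express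
that an edge of `𝒳_j` is blocked, and that the edges of `ℰ` that block it are in `𝒴_j`. -/
structure Setting.Inv (A : Setting P R) (p₀ : P) (s : State P R) : Prop where
  max : A.IsMaxMatching s.M
  pos : 1 ≤ s.ℓ
  X_one : (s.layer 1).X = ∅
  Y_one : (s.layer 1).Y = {(p₀, ∅)}
  start_mem : p₀ ∈ unmatched s.M
  E_mem : ∀ e ∈ s.E, e.1 ∈ unmatched s.M ∧ e.1 ≠ p₀
  E_inj : ∀ e ∈ s.E, ∀ f ∈ s.E, e.1 = f.1 → e = f
  Y_subset : ∀ j, 2 ≤ j → j ≤ s.ℓ → (s.layer j).Y ⊆ s.E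
  Y_disjoint : ∀ j k, 1 ≤ j → j < k → k ≤ s.ℓ →
    Disjoint (players (s.layer j).Y) (players (s.layer k).Y)
  E_value : ∀ e ∈ s.E, A.value e.2 ≤ 2 * (A.tau / A.lam)
  I_value : ∀ e ∈ s.I, A.value e.2 ≤ 2 * (A.tau / A.lam)
  X_disjoint : ∀ j k, 1 ≤ j → j ≤ s.ℓ → 1 ≤ k → k ≤ s.ℓ → ∀ e ∈ (s.layer j).X,
    ∀ f ∈ (s.layer k).X, (j = k → e ≠ f) → Disjoint e.2 f.2
  I_disjoint_X : ∀ e ∈ s.I, ∀ j, 1 ≤ j → j ≤ s.ℓ → ∀ f ∈ (s.layer j).X, Disjoint e.2 f.2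
  X_thin : ∀ j, 1 ≤ j → j ≤ s.ℓ → ∀ e ∈ (s.layer j).X, ∀ r ∈ e.2, ¬ A.Fat r
  X_blocked : ∀ j, 1 ≤ j → j ≤ s.ℓ → ∀ e ∈ (s.layer j).X,
    A.value (e.2 \ resources (s.layer j).Y) < A.tau / A.lam
  X_meets : ∀ j, 1 ≤ j → j ≤ s.ℓ → ∀ e ∈ (s.layer j).X, ∀ f ∈ s.E, ¬ Disjoint f.2 e.2 →
    f ∈ (s.layer j).Y
  I_indep : (s.rest s.ℓ).card + s.I.card ≤ A.rank (s.rest s.ℓ ∪ players s.I)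
  X_rank : ∀ j, 1 ≤ j → j < s.ℓ → (s.rest j).card + s.sizeX (j + 1) ≤
    A.rank (s.rest j ∪ players s.I ∪ players (s.Xle (j + 1)))
  record : ∀ j, 1 ≤ j → j < s.ℓ → ∃ L W J, A.Record s j L W J

section StateLemmas

variable {A : Setting P R} {s s' : State P R} {p₀ : P}

lemma State.mem_Xle {k : ℕ} {e : Edge P R} :
    e ∈ s.Xle k ↔ ∃ h, 1 ≤ h ∧ h ≤ k ∧ e ∈ (s.layer h).X := by
  simp [State.Xle, and_assoc]

lemma State.mem_Yle {k : ℕ} {e : Edge P R} :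
    e ∈ s.Yle k ↔ ∃ h, 1 ≤ h ∧ h ≤ k ∧ e ∈ (s.layer h).Y := by
  simp [State.Yle, and_assoc]

lemma State.Xle_mono {j k : ℕ} (h : j ≤ k) : s.Xle j ⊆ s.Xle k := fun e he => by
  obtain ⟨i, h1, h2, h3⟩ := State.mem_Xle.1 he
  exact State.mem_Xle.2 ⟨i, h1, h2.trans h, h3⟩

lemma State.Yle_mono {j k : ℕ} (h : j ≤ k) : s.Yle j ⊆ s.Yle k := fun e he => by
  obtain ⟨i, h1, h2, h3⟩ := State.mem_Yle.1 he
  exact State.mem_Yle.2 ⟨i, h1, h2.trans h, h3⟩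

lemma State.Xle_succ (k : ℕ) : s.Xle (k + 1) = s.Xle k ∪ (s.layer (k + 1)).X := by
  ext e
  rw [mem_union, State.mem_Xle, State.mem_Xle]
  constructor
  · rintro ⟨h, h1, h2, h3⟩
    rcases Nat.lt_or_ge k h with hk | hk
    · obtain rfl : h = k + 1 := by lia
      exact Or.inr h3
    · exact Or.inl ⟨h, h1, hk, h3⟩
  · rintro (⟨h, h1, h2, h3⟩ | h)
    · exact ⟨h, h1, by lia, h3⟩
    · exact ⟨k + 1, by lia, le_rfl, h⟩

lemma State.Yle_succ (k : ℕ) : s.Yle (k + 1) = s.Yle k ∪ (s.layer (k + 1)).Y := by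
  ext e
  rw [mem_union, State.mem_Yle, State.mem_Yle]
  constructor
  · rintro ⟨h, h1, h2, h3⟩
    rcases Nat.lt_or_ge k h with hk | hk
    · obtain rfl : h = k + 1 := by lia
      exact Or.inr h3
    · exact Or.inl ⟨h, h1, hk, h3⟩
  · rintro (⟨h, h1, h2, h3⟩ | h)
    · exact ⟨h, h1, by lia, h3⟩
    · exact ⟨k + 1, by lia, le_rfl, h⟩

lemma State.sizeX_succ (k : ℕ) : s.sizeX (k + 1) = s.sizeX k + (s.layer (k + 1)).X.card :=
  sum_Icc_succ_top (by lia) _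

lemma State.Xle_congr {k : ℕ} (h : ∀ i, 1 ≤ i → i ≤ k → s'.layer i = s.layer i) :
    s'.Xle k = s.Xle k :=
  biUnion_congr rfl fun i hi => by rw [h i (mem_Icc.1 hi).1 (mem_Icc.1 hi).2]

lemma State.Yle_congr {k : ℕ} (h : ∀ i, 1 ≤ i → i ≤ k → s'.layer i = s.layer i) :
    s'.Yle k = s.Yle k :=
  biUnion_congr rfl fun i hi => by rw [h i (mem_Icc.1 hi).1 (mem_Icc.1 hi).2]

lemma State.sizeX_congr {k : ℕ} (h : ∀ i, 1 ≤ i → i ≤ k → s'.layer i = s.layer i) :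
    s'.sizeX k = s.sizeX k :=
  sum_congr rfl fun i hi => by rw [h i (mem_Icc.1 hi).1 (mem_Icc.1 hi).2]

lemma State.rest_anti (s : State P R) : Antitone s.rest := fun _ _ h =>
  sdiff_subset_sdiff subset_rfl (players_mono (State.Yle_mono h))

lemma State.rest_zero : s.rest 0 = unmatched s.M := by simp [State.rest, State.Yle]

lemma State.rest_subset (s : State P R) (j : ℕ) : s.rest j ⊆ unmatched s.M := sdiff_subset

lemma Setting.subset_reach (A : Setting P R) (s : State P R) (j : ℕ) :
    s.rest j ∪ players s.I ⊆ A.reach s j := IsRank.subset_span _ _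

namespace Setting.Inv

variable (h : A.Inv p₀ s)
include h

lemma players_Y_subset {j : ℕ} (hj : 1 ≤ j) (hjl : j ≤ s.ℓ) :
    players (s.layer j).Y ⊆ unmatched s.M := by
  intro p hp
  obtain ⟨e, he, rfl⟩ := mem_players.1 hp
  rcases hj.eq_or_lt with rfl | hj
  · rw [h.Y_one, mem_singleton] at he
    rw [he]
    exact h.start_mem
  · exact (h.E_mem e (h.Y_subset j hj hjl he)).1

lemma players_Yle_subset {j : ℕ} (hjl : j ≤ s.ℓ) : players (s.Yle j) ⊆ unmatched s.M := by
  intro p hp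
  obtain ⟨e, he, rfl⟩ := mem_players.1 hp
  obtain ⟨i, h1, h2, h3⟩ := State.mem_Yle.1 he
  exact h.players_Y_subset h1 (h2.trans hjl) (mem_players.2 ⟨e, h3, rfl⟩)

lemma card_rest_add {j : ℕ} (hjl : j ≤ s.ℓ) :
    (s.rest j).card + (players (s.Yle j)).card = (unmatched s.M).card :=
  card_sdiff_add_card_eq_card (h.players_Yle_subset hjl)

lemma disjoint_players_Yle {j : ℕ} (hjl : j + 1 ≤ s.ℓ) :
    Disjoint (players (s.Yle j)) (players (s.layer (j + 1)).Y) := by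
  rw [disjoint_left]
  intro p hp hp'
  obtain ⟨e, he, rfl⟩ := mem_players.1 hp
  obtain ⟨i, h1, h2, h3⟩ := State.mem_Yle.1 he
  exact disjoint_left.1 (h.Y_disjoint i (j + 1) h1 (by lia) hjl) (mem_players.2 ⟨e, h3, rfl⟩) hp'

lemma card_players_Yle_succ {j : ℕ} (hjl : j + 1 ≤ s.ℓ) : (players (s.Yle (j + 1))).card =
    (players (s.Yle j)).card + (players (s.layer (j + 1)).Y).card := by
  rw [State.Yle_succ, players_union, card_union_of_disjoint (h.disjoint_players_Yle hjl)]

lemma rank_rest (j : ℕ) : A.rank (s.rest j) = (s.rest j).card :=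
  h.max.rank_of_subset_unmatched (s.rest_subset j)

/-- A later state inherits the record of layer `j + 1`, provided that the layers below are
unchanged and the closures have grown. -/
lemma record_transfer {j : ℕ} (hj : 1 ≤ j) (hjl : j < s.ℓ)
    (hlayer : ∀ i, 1 ≤ i → i ≤ j → s'.layer i = s.layer i)
    (hX : (s'.layer (j + 1)).X ⊆ (s.layer (j + 1)).X)
    (hcard : (s'.rest j).card = (s.rest j).card)
    (hreach : s.rest j ∪ players s.I ⊆ A.reach s' j)
    (hrem : ∀ e ∈ (s.layer (j + 1)).X, e ∉ (s'.layer (j + 1)).X → e.1 ∈ A.reach s' j) :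
    ∃ L W J, A.Record s' j L W J := by
  obtain ⟨L, W, J, hr⟩ := h.record j hj hjl
  have hle : A.reach s j ⊆ A.reach s' j := A.isRank.span_subset_span hreach
  refine ⟨L, W, J, hX.trans hr.subset, hr.nodup, by rw [hcard]; exact hr.indep,
    hr.start.trans hle, fun e he he' => ?_, hr.value_le, hr.value_le_of_mem, ?_, ?_⟩
  · by_cases hes : e ∈ (s.layer (j + 1)).X
    · exact hrem e hes he'
    · exact hle (hr.removed e he hes)
  · rw [State.Xle_congr hlayer, State.Yle_congr hlayer]
    exact hr.before
  · rw [State.Xle_congr hlayer, State.Yle_congr hlayer]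
    exact hr.after

lemma X_rank_transfer {j : ℕ} (hj : 1 ≤ j) (hjl : j < s.ℓ)
    (hlayer : ∀ i, 1 ≤ i → i ≤ j → s'.layer i = s.layer i)
    (hX : (s'.layer (j + 1)).X ⊆ (s.layer (j + 1)).X)
    (hcard : (s'.rest j).card = (s.rest j).card)
    (hreach : s.rest j ∪ players s.I ⊆ A.reach s' j)
    (hrem : ∀ e ∈ (s.layer (j + 1)).X, e ∉ (s'.layer (j + 1)).X → e.1 ∈ A.reach s' j) :
    (s'.rest j).card + s'.sizeX (j + 1) ≤
      A.rank (s'.rest j ∪ players s'.I ∪ players (s'.Xle (j + 1))) := by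
  have h1 := h.X_rank j hj hjl
  have h2 : s'.sizeX (j + 1) ≤ s.sizeX (j + 1) := by
    rw [State.sizeX_succ, State.sizeX_succ, State.sizeX_congr hlayer]
    exact Nat.add_le_add_left (card_le_card hX) _
  have h3 : s.rest j ∪ players s.I ∪ players (s.Xle (j + 1)) ⊆
      span A.rank (s'.rest j ∪ players s'.I ∪ players (s'.Xle (j + 1))) := by
    have hmono : A.reach s' j ⊆
        span A.rank (s'.rest j ∪ players s'.I ∪ players (s'.Xle (j + 1))) :=
      A.isRank.span_mono subset_union_left
    refine union_subset (hreach.trans hmono) ?_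
    intro p hp
    obtain ⟨e, he, rfl⟩ := mem_players.1 hp
    by_cases he' : e ∈ s'.Xle (j + 1)
    · exact IsRank.subset_span _ _ (mem_union_right _ (mem_players.2 ⟨e, he', rfl⟩))
    · rw [State.Xle_succ, State.Xle_congr hlayer, mem_union, not_or] at he'
      rw [State.Xle_succ, mem_union] at he
      exact hmono (hrem e (he.resolve_left he'.1) he'.2)
  have h4 := A.isRank.rank_le_of_subset_span h3
  lia

end Setting.Inv

lemma Setting.inv_init {M : Finset (P × R)} {E : Finset (Edge P R)} (hu : 0 ≤ A.tau / A.lam)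
    (hME : A.IsPartialAllocation M E) (hM : ∀ m ∈ M, m.1 ≠ p₀) (hE : ∀ e ∈ E, e.1 ≠ p₀) :
    A.Inv p₀ ⟨M, E, ∅, 1, fun _ => ⟨∅, {(p₀, ∅)}, 0, 0⟩⟩ where
  max := hME.maxMatching
  pos := le_rfl
  X_one := rfl
  Y_one := rfl
  start_mem := mem_unmatched.2 fun r hr => hM _ hr rfl
  E_mem e he := ⟨mem_unmatched.2 fun r hr => hME.player_unmatched e he _ hr rfl, hE e he⟩
  E_inj := hME.player_disjoint
  Y_subset j h2 h1 := absurd (h2.trans h1) (by simp)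
  Y_disjoint j k h1 h2 h3 := absurd (h1.trans_lt (h2.trans_le h3)) (by simp)
  E_value e he := (hME.minimal e he).value_le hu fun r hr => ((hME.thin e he).1 r hr).2
  I_value e he := absurd he (notMem_empty e)
  X_disjoint _ _ _ _ _ _ e he := absurd he (notMem_empty e)
  I_disjoint_X e he := absurd he (notMem_empty e)
  X_thin _ _ _ e he := absurd he (notMem_empty e)
  X_blocked _ _ _ e he := absurd he (notMem_empty e)
  X_meets _ _ _ e he := absurd he (notMem_empty e)
  I_indep := by
    rw [players_empty, union_empty, card_empty, add_zero]
    exact (hME.maxMatching.rank_of_subset_unmatched sdiff_subset).ge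
  X_rank j h1 h2 := absurd (h1.trans_lt h2) (by simp)
  record j h1 h2 := absurd (h1.trans_lt h2) (by simp)

end StateLemmas

end Invariants

/-! ### The build routine preserves the invariants -/

section Build

variable {P : Type u} {R : Type w} [Fintype P] [Fintype R] [DecidableEq P] [DecidableEq R]
variable {A : Setting P R} {s s' : State P R} {p₀ : P}

lemma toFinset_append_singleton {α : Type*} [DecidableEq α] (L : List α) (e : α) :
    (L ++ [e]).toFinset = insert e L.toFinset := by
  ext; simp

lemma Setting.Inv.addablePlayer_iff (h : A.Inv p₀ s) {c : Partial P R} {p : P} :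
    A.AddablePlayer s c p ↔ p ∉ span A.rank (s.rest s.ℓ ∪ players c.I ∪ players (s.Xle s.ℓ) ∪
      players c.X) := by
  have h1 : s.rest s.ℓ ∪ players c.I ∪ players (s.Xle s.ℓ) ∪ players c.X =
      (unmatched s.M \ players (s.Yle s.ℓ)) ∪ targets s c := by
    rw [targets, players_union, State.rest]
    ext; simp only [mem_union]; tauto
  rw [h1]
  exact h.max.maxPaths_succ_iff (h.players_Yle_subset le_rfl)

lemma Setting.AddableEdge.anti (h : A.Inv p₀ s) {c c' : Partial P R} {e : Edge P R}
    (hI : c.I = c'.I) (hX : c.X ⊆ c'.X) (he : A.AddableEdge s c' e) : A.AddableEdge s c e := by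
  refine ⟨he.1, ?_, he.2.2.1, he.2.2.2.mono_right (resources_mono ?_)⟩
  · have := he.2.1
    rw [h.addablePlayer_iff] at this ⊢
    rw [hI]
    exact fun hp => this (A.isRank.span_mono (union_subset_union subset_rfl (players_mono hX)) hp)
  · rw [hI]
    exact union_subset_union (union_subset_union (union_subset_union subset_rfl hX) subset_rfl)
      subset_rfl

/-- The properties of `ℐ` during the first phase of the construction of a layer. -/
structure Setting.FirstPhase (A : Setting P R) (s : State P R) (c : Partial P R) : Prop where
  X_eq : c.X = ∅
  subset : s.I ⊆ c.I
  value_le : ∀ e ∈ c.I, A.value e.2 ≤ 2 * (A.tau / A.lam)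
  disjoint_X : ∀ e ∈ c.I, ∀ f ∈ s.Xle s.ℓ, Disjoint e.2 f.2
  indep : (s.rest s.ℓ).card + c.I.card ≤ A.rank (s.rest s.ℓ ∪ players c.I)

lemma Setting.Inv.firstPhase (h : A.Inv p₀ s) (hu : 0 ≤ A.tau / A.lam) {c : Partial P R}
    (hc : Relation.ReflTransGen (A.AddUnblocked s) ⟨s.I, ∅⟩ c) : A.FirstPhase s c := by
  induction hc with
  | refl =>
    refine ⟨rfl, subset_rfl, h.I_value, fun e he f hf => ?_, h.I_indep⟩
    obtain ⟨i, h1, h2, h3⟩ := State.mem_Xle.1 hf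
    exact h.I_disjoint_X e he i h1 h2 f h3
  | @tail c _ _ hstep ih =>
    obtain ⟨p, B, B', hB, hB', hmin, -, rfl⟩ := hstep
    have hp : p ∉ span A.rank (s.rest s.ℓ ∪ players c.I) := fun hp =>
      (h.addablePlayer_iff.1 hB.2.1) (A.isRank.span_mono
        (subset_union_left.trans subset_union_left) hp)
    have hpI : (p, B') ∉ c.I := fun hh =>
      hp (IsRank.subset_span _ _ (mem_union_right _ (mem_players.2 ⟨_, hh, rfl⟩)))
    refine ⟨ih.X_eq, ih.subset.trans (subset_insert _ _), ?_, ?_, ?_⟩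
    · intro e he
      rcases mem_insert.1 he with rfl | he
      · exact hmin.value_le hu fun r hr => (hB.1.1 r (hB' hr)).2
      · exact ih.value_le e he
    · intro e he f hf
      rcases mem_insert.1 he with rfl | he
      · refine Disjoint.mono_left hB' (disjoint_resources.1 hB.2.2.2 f ?_)
        simp only [mem_union]
        exact Or.inl (Or.inl (Or.inl hf))
      · exact ih.disjoint_X e he f hf
    · have := ih.indep
      simp only
      rw [card_insert_of_notMem hpI, players_insert, union_insert, A.isRank.notMem_span.1 hp]
      lia

/-- The properties of the list `L` of the edges chosen so far for the new layer, where `J` is the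
set `ℐ` after the first phase. -/
structure Setting.Selected (A : Setting P R) (s : State P R) (J : Finset (Edge P R))
    (L : List (Edge P R)) : Prop where
  nodup : L.Nodup
  indep : (s.rest s.ℓ).card + J.card + L.length ≤
    A.rank (s.rest s.ℓ ∪ players J ∪ players L.toFinset)
  rank : A.rank (s.rest s.ℓ ∪ players J ∪ players (s.Xle s.ℓ)) + L.length ≤
    A.rank (s.rest s.ℓ ∪ players J ∪ players (s.Xle s.ℓ) ∪ players L.toFinset)
  thin : ∀ e ∈ L, ∀ r ∈ e.2, ¬ A.Fat r
  value_le : ∀ e ∈ L, A.value e.2 ≤ A.tau + A.tau / A.lam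
  blocked : ∀ e ∈ L, A.value (e.2 \ resources s.E) < A.tau / A.lam
  disjoint : ∀ e ∈ L, Disjoint e.2 (resources (s.Xle s.ℓ ∪ s.Yle s.ℓ ∪ J))
  pairwise : ∀ e ∈ L, ∀ f ∈ L, e ≠ f → Disjoint e.2 f.2
  before : ∀ L₁ e L₂, L = L₁ ++ e :: L₂ → ∀ q ∉ span A.rank
    (s.rest s.ℓ ∪ players J ∪ players (s.Xle s.ℓ) ∪ players L₁.toFinset), ∀ O : Finset R,
      (∀ r ∈ O, A.desires q r ∧ ¬ A.Fat r) →
      Disjoint O (resources (s.Xle s.ℓ ∪ s.Yle s.ℓ ∪ J ∪ L₁.toFinset)) →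
      A.tau ≤ A.value e.2 ∨ A.value O ≤ A.value e.2

lemma resources_partial (c : Partial P R) :
    resources ((s.Xle s.ℓ ∪ c.X) ∪ s.Yle s.ℓ ∪ c.I) =
      resources (s.Xle s.ℓ ∪ s.Yle s.ℓ ∪ c.I ∪ c.X) := by
  congr 1
  ext; simp only [mem_union]; tauto

/-- A player `q` that is addable, but has no addable edge, has less than `τ/λ` in uncovered thin
resources: otherwise some of them would form an addable edge. -/
lemma Setting.value_lt_of_no_addableEdge (hu : 0 ≤ A.tau / A.lam)
    (huτ : A.tau / A.lam ≤ A.tau) {c : Partial P R} {q : P}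
    (hq : A.AddablePlayer s c q) (hno : ∀ B, ¬ A.AddableEdge s c (q, B)) {O : Finset R}
    (hO : ∀ r ∈ O, A.desires q r ∧ ¬ A.Fat r)
    (hdis : Disjoint O (resources (s.Xle s.ℓ ∪ s.Yle s.ℓ ∪ c.I ∪ c.X))) :
    A.value O < A.tau / A.lam := by
  by_contra hle
  obtain ⟨B, hB, hmin⟩ := A.exists_minimalSet (not_lt.1 hle)
  refine hno B ⟨⟨fun r hr => hO r (hB hr), hmin.1⟩, hq, ?_, ?_⟩
  · have := hmin.value_le hu fun r hr => (hO r (hB hr)).2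
    simp only
    linarith
  · rw [resources_partial]
    exact hdis.mono_left hB

/-- The greedy choice of the next edge `(p, cand p)`: an addable player has no uncovered thin
resources of larger value, unless the value of the chosen edge exceeds `τ`. -/
lemma Setting.value_le_of_greedy (hu : 0 ≤ A.tau / A.lam) (huτ : A.tau / A.lam ≤ A.tau)
    {c : Partial P R} (hblk : ∀ e, A.AddableEdge s c e → ¬ A.Unblocked s.E e)
    {cand : P → Finset R}
    (hcand : ∀ q, (∃ B, A.AddableEdge s c (q, B)) → A.MaximalBlocked s c q (cand q)) {p : P}
    (hp : ∃ B, A.AddableEdge s c (p, B))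
    (hmax : ∀ q, (∃ B, A.AddableEdge s c (q, B)) → A.value (cand q) ≤ A.value (cand p))
    {q : P} (hq : A.AddablePlayer s c q) {O : Finset R}
    (hO : ∀ r ∈ O, A.desires q r ∧ ¬ A.Fat r)
    (hdis : Disjoint O (resources (s.Xle s.ℓ ∪ s.Yle s.ℓ ∪ c.I ∪ c.X))) :
    A.tau ≤ A.value (cand p) ∨ A.value O ≤ A.value (cand p) := by
  by_cases hqB : ∃ B, A.AddableEdge s c (q, B)
  · by_contra! hcon
    have hle := hmax q hqB
    obtain ⟨⟨hadd, -⟩, hmaxq⟩ := hcand q hqB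
    have hsub : ¬ O ⊆ cand q := fun hsub => by
      have := A.value_mono hsub
      linarith
    obtain ⟨r, hrO, hr⟩ := not_subset.1 hsub
    -- a thin resource may be added to an edge of value less than `τ`
    have hval : A.value (insert r (cand q)) = A.v r + A.value (cand q) := sum_insert hr
    have hvr : A.v r < A.tau / A.lam := not_le.1 (hO r hrO).2
    have hadd' : A.AddableEdge s c (q, insert r (cand q)) := by
      refine ⟨⟨?_, ?_⟩, hadd.2.1, ?_, ?_⟩
      · intro r' hr'
        rcases mem_insert.1 hr' with rfl | hr'
        · exact hO r' hrO
        · exact hadd.1.1 r' hr'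
      · exact hadd.1.2.trans (A.value_mono (subset_insert _ _))
      · simp only
        linarith
      · rw [resources_partial]
        have h1 := hadd.2.2.2
        rw [resources_partial] at h1
        exact disjoint_insert_left.2 ⟨disjoint_left.1 hdis hrO, h1⟩
    exact hmaxq _ hadd' (hblk _ hadd') (ssubset_insert hr)
  · right
    have h1 := A.value_lt_of_no_addableEdge hu huτ hq (not_exists.1 hqB) hO hdis
    have h2 : A.tau / A.lam ≤ A.value (cand p) := (hcand p hp).1.1.1.2
    linarith

lemma Setting.Selected.append (h : A.Inv p₀ s) {J : Finset (Edge P R)} {L : List (Edge P R)}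
    (hu : 0 ≤ A.tau / A.lam) (huτ : A.tau / A.lam ≤ A.tau) (hL : A.Selected s J L)
    (hblk : ∀ e, A.AddableEdge s ⟨J, L.toFinset⟩ e → ¬ A.Unblocked s.E e) {cand : P → Finset R}
    (hcand : ∀ q, (∃ B, A.AddableEdge s ⟨J, L.toFinset⟩ (q, B)) →
      A.MaximalBlocked s ⟨J, L.toFinset⟩ q (cand q)) {p : P}
    (hp : ∃ B, A.AddableEdge s ⟨J, L.toFinset⟩ (p, B))
    (hmax : ∀ q, (∃ B, A.AddableEdge s ⟨J, L.toFinset⟩ (q, B)) →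
      A.value (cand q) ≤ A.value (cand p)) :
    A.Selected s J (L ++ [(p, cand p)]) := by
  obtain ⟨⟨hadd, hnb⟩, -⟩ := hcand p hp
  have hpn := h.addablePlayer_iff.1 hadd.2.1
  simp only at hpn
  have hpn' : p ∉ span A.rank (s.rest s.ℓ ∪ players J ∪ players L.toFinset) := fun hh =>
    hpn (A.isRank.span_mono (union_subset_union subset_union_left subset_rfl) hh)
  have hpL : (p, cand p) ∉ L := fun hh => hpn (IsRank.subset_span _ _
    (mem_union_right _ (mem_players.2 ⟨_, List.mem_toFinset.2 hh, rfl⟩)))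
  have hdis := hadd.2.2.2
  rw [resources_partial, disjoint_resources] at hdis
  have hmem : ∀ e, e ∈ L ++ [(p, cand p)] ↔ e ∈ L ∨ e = (p, cand p) := by simp
  refine ⟨?_, ?_, ?_, ?_, ?_, ?_, ?_, ?_, ?_⟩
  · rw [List.nodup_append]
    refine ⟨hL.nodup, by simp, ?_⟩
    rintro a ha b hb rfl
    rw [List.mem_singleton] at hb
    exact hpL (hb ▸ ha)
  · have := hL.indep
    rw [toFinset_append_singleton, players_insert, union_insert, A.isRank.notMem_span.1 hpn',
      List.length_append, List.length_singleton]
    lia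
  · have := hL.rank
    rw [toFinset_append_singleton, players_insert, union_insert, A.isRank.notMem_span.1 hpn,
      List.length_append, List.length_singleton]
    lia
  · intro e he
    rcases (hmem e).1 he with he | rfl
    · exact hL.thin e he
    · exact fun r hr => (hadd.1.1 r hr).2
  · intro e he
    rcases (hmem e).1 he with he | rfl
    · exact hL.value_le e he
    · exact hadd.2.2.1
  · intro e he
    rcases (hmem e).1 he with he | rfl
    · exact hL.blocked e he
    · by_contra hle
      exact hnb ⟨_, sdiff_subset, not_lt.1 hle, sdiff_disjoint⟩
  · intro e he
    rcases (hmem e).1 he with he | rfl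
    · exact hL.disjoint e he
    · exact disjoint_resources.2 fun f hf => hdis f (mem_union_left _ hf)
  · have key : ∀ f ∈ L, Disjoint (cand p) f.2 := fun f hf =>
      hdis f (mem_union_right _ (List.mem_toFinset.2 hf))
    intro e he f hf hef
    rcases (hmem e).1 he with he | rfl <;> rcases (hmem f).1 hf with hf | rfl
    · exact hL.pairwise e he f hf hef
    · exact (key e he).symm
    · exact key f hf
    · exact absurd rfl hef
  · intro L₁ e L₂ hLL q hq O hO hdisO
    rcases List.eq_nil_or_concat L₂ with rfl | ⟨L₂', e', rfl⟩
    · obtain ⟨rfl, he⟩ := List.append_inj' hLL rfl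
      obtain rfl : (p, cand p) = e := by simpa using he
      exact A.value_le_of_greedy hu huτ hblk hcand hp hmax (h.addablePlayer_iff.2 hq) hO hdisO
    · have hLL' : L ++ [(p, cand p)] = (L₁ ++ e :: L₂') ++ [e'] := by simpa using hLL
      exact hL.before L₁ e L₂' (List.append_inj' hLL' rfl).1 q hq O hO hdisO

lemma Setting.Inv.selected (h : A.Inv p₀ s) (hu : 0 ≤ A.tau / A.lam)
    (huτ : A.tau / A.lam ≤ A.tau) {c₁ c : Partial P R} (hc₁ : A.FirstPhase s c₁)
    (hblk : ∀ e, A.AddableEdge s c₁ e → ¬ A.Unblocked s.E e)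
    (hc : Relation.ReflTransGen (A.AddBlocked s) c₁ c) :
    ∃ L : List (Edge P R), c = ⟨c₁.I, L.toFinset⟩ ∧ A.Selected s c₁.I L := by
  induction hc with
  | refl =>
    refine ⟨[], ?_, ?_⟩
    · rw [List.toFinset_nil, ← hc₁.X_eq]
    · refine ⟨List.nodup_nil, by simpa using hc₁.indep, by simp, by simp, by simp, by simp,
        by simp, by simp, by simp⟩
  | tail _ hstep ih =>
    obtain ⟨L, rfl, hL⟩ := ih
    obtain ⟨cand, hcand, p, hp, hmax, rfl⟩ := hstep
    refine ⟨L ++ [(p, cand p)], by rw [toFinset_append_singleton],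
      hL.append h hu huτ (fun e he => hblk e (Setting.AddableEdge.anti h (c := c₁)
        (c' := ⟨c₁.I, L.toFinset⟩) rfl ?_ he)) hcand hp hmax⟩
    rw [hc₁.X_eq]
    exact empty_subset _

/-- The inequality of `X_rank` for the sources `Y_{≤ ℓ}` of the next layer. -/
lemma Setting.Inv.card_rest_add_sizeX_le (h : A.Inv p₀ s) {J : Finset (Edge P R)}
    (hJ : s.I ⊆ J) : (s.rest s.ℓ).card + s.sizeX s.ℓ ≤
      A.rank (s.rest s.ℓ ∪ players J ∪ players (s.Xle s.ℓ)) := by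
  obtain ⟨m, hm⟩ : ∃ m, s.ℓ = m + 1 := ⟨s.ℓ - 1, by have := h.pos; lia⟩
  rcases Nat.eq_zero_or_pos m with rfl | hmpos
  · have h1 : s.sizeX s.ℓ = 0 := by
      rw [hm]
      simp [State.sizeX, h.X_one]
    rw [h1, add_zero, ← h.rank_rest]
    exact A.isRank.mono (subset_union_left.trans subset_union_left)
  · have h1 := h.X_rank m hmpos (by lia)
    have h2 := card_sdiff_add_card_eq_card (s.rest_anti (Nat.le_succ m))
    have h3 := A.isRank.union_le (s.rest (m + 1) ∪ players s.I ∪ players (s.Xle (m + 1)))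
      (s.rest m \ s.rest (m + 1))
    have h4 : s.rest m ∪ players s.I ∪ players (s.Xle (m + 1)) ⊆
        s.rest (m + 1) ∪ players s.I ∪ players (s.Xle (m + 1)) ∪ (s.rest m \ s.rest (m + 1)) := by
      intro p
      simp only [mem_union, mem_sdiff]
      tauto
    have h5 := A.isRank.mono h4
    have h6 := A.isRank.mono (union_subset_union (union_subset_union (subset_refl (s.rest (m + 1)))
      (players_mono hJ)) (subset_refl (players (s.Xle (m + 1)))))
    rw [hm]
    simp only [Nat.succ_eq_add_one] at *
    lia

theorem Setting.Inv.build (h : A.Inv p₀ s) (hu : 0 ≤ A.tau / A.lam)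
    (huτ : A.tau / A.lam ≤ A.tau) (hb : A.Build s s') : A.Inv p₀ s' := by
  obtain ⟨c₁, c₂, hc₁, hblk, hc₂, hno, hs'⟩ := hb
  have hF := h.firstPhase hu hc₁
  obtain ⟨L, rfl, hL⟩ := h.selected hu huτ hF hblk hc₂
  have hM : s'.M = s.M := by rw [hs']
  have hE : s'.E = s.E := by rw [hs']
  have hI : s'.I = c₁.I := by rw [hs']
  have hℓ : s'.ℓ = s.ℓ + 1 := by rw [hs']
  have hold : ∀ i, i ≤ s.ℓ → s'.layer i = s.layer i := fun i hi => by
    rw [hs']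
    exact Function.update_of_ne (by lia) _ _
  have hnew : s'.layer (s.ℓ + 1) = A.newLayer s ⟨c₁.I, L.toFinset⟩ := by
    rw [hs']
    exact Function.update_self _ _ _
  have hnewX : (s'.layer (s.ℓ + 1)).X = L.toFinset := by rw [hnew]; rfl
  have hnewY : ∀ f, f ∈ (s'.layer (s.ℓ + 1)).Y ↔ f ∈ s.E ∧ ∃ e ∈ L, ¬ Disjoint f.2 e.2 := by
    intro f
    rw [hnew]
    simp [Setting.newLayer]
  have hYle : ∀ j ≤ s.ℓ, s'.Yle j = s.Yle j := fun j hj =>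
    State.Yle_congr fun i _ hi => hold i (by lia)
  have hXle : ∀ j ≤ s.ℓ, s'.Xle j = s.Xle j := fun j hj =>
    State.Xle_congr fun i _ hi => hold i (by lia)
  have hrest : ∀ j ≤ s.ℓ, s'.rest j = s.rest j := fun j hj => by
    rw [State.rest, State.rest, hM, hYle j hj]
  have hreach : ∀ j ≤ s.ℓ, s.rest j ∪ players s.I ⊆ A.reach s' j := fun j hj => by
    refine Subset.trans ?_ (A.subset_reach s' j)
    rw [hrest j hj, hI]
    exact union_subset_union subset_rfl (players_mono hF.subset)
  have hlast : ∀ {j}, 1 ≤ j → j ≤ s'.ℓ → j ≤ s.ℓ ∨ j = s.ℓ + 1 := fun _ _ => by lia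
  -- every case distinction below separates the new layer from the old ones
  refine
    { max := hM ▸ h.max
      pos := by lia
      X_one := by rw [hold 1 h.pos, h.X_one]
      Y_one := by rw [hold 1 h.pos, h.Y_one]
      start_mem := hM ▸ h.start_mem
      E_mem := by rw [hM, hE]; exact h.E_mem
      E_inj := by rw [hE]; exact h.E_inj
      E_value := by rw [hE]; exact h.E_value
      I_value := by rw [hI]; exact hF.value_le
      Y_subset := ?Y_subset
      Y_disjoint := ?Y_disjoint
      X_disjoint := ?X_disjoint
      I_disjoint_X := ?I_disjoint_X
      X_thin := ?X_thin
      X_blocked := ?X_blocked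
      X_meets := ?X_meets
      I_indep := ?I_indep
      X_rank := ?X_rank
      record := ?record }
  case Y_subset =>
    intro j hj hjl
    rcases hlast (by lia) hjl with hj' | rfl
    · rw [hold j hj', hE]
      exact h.Y_subset j hj hj'
    · intro f hf
      rw [hE]
      exact ((hnewY f).1 hf).1
  case Y_disjoint =>
    intro j k hj hjk hk
    rcases hlast (by lia) hk with hk' | rfl
    · rw [hold j (by lia), hold k hk']
      exact h.Y_disjoint j k hj hjk hk'
    · rw [hold j (by lia), disjoint_left]
      intro p hp hp'
      obtain ⟨e, he, rfl⟩ := mem_players.1 hp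
      obtain ⟨f, hf, hfe⟩ := mem_players.1 hp'
      obtain ⟨hfE, g, hg, hfg⟩ := (hnewY f).1 hf
      rcases hj.eq_or_lt with rfl | hj1
      · rw [h.Y_one, mem_singleton] at he
        exact (h.E_mem f hfE).2 (by rw [hfe, he])
      · have heE := h.Y_subset j hj1 (by lia) he
        obtain rfl := h.E_inj f hfE e heE hfe
        refine hfg ((disjoint_resources.1 (hL.disjoint g hg) f ?_).symm)
        exact mem_union_left _ (mem_union_right _ (State.mem_Yle.2 ⟨j, hj, by lia, he⟩))
  case X_disjoint =>
    intro j k hj hjl hk hkl e he f hf hef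
    have key : ∀ e ∈ L, ∀ i, 1 ≤ i → i ≤ s.ℓ → ∀ f ∈ (s.layer i).X, Disjoint e.2 f.2 :=
      fun e he i h1 h2 f hf => disjoint_resources.1 (hL.disjoint e he) f
        (mem_union_left _ (mem_union_left _ (State.mem_Xle.2 ⟨i, h1, h2, hf⟩)))
    rcases hlast hj hjl with hj' | rfl <;> rcases hlast hk hkl with hk' | rfl
    · rw [hold _ hj'] at he
      rw [hold _ hk'] at hf
      exact h.X_disjoint j k hj hj' hk hk' e he f hf hef
    · rw [hold _ hj'] at he
      rw [hnewX, List.mem_toFinset] at hf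
      exact (key f hf j hj hj' e he).symm
    · rw [hold _ hk'] at hf
      rw [hnewX, List.mem_toFinset] at he
      exact key e he k hk hk' f hf
    · rw [hnewX, List.mem_toFinset] at he hf
      exact hL.pairwise e he f hf (hef rfl)
  case I_disjoint_X =>
    intro e he j hj hjl f hf
    rw [hI] at he
    rcases hlast hj hjl with hj' | rfl
    · rw [hold _ hj'] at hf
      exact hF.disjoint_X e he f (State.mem_Xle.2 ⟨j, hj, hj', hf⟩)
    · rw [hnewX, List.mem_toFinset] at hf
      exact (disjoint_resources.1 (hL.disjoint f hf) e (mem_union_right _ he)).symm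
  case X_thin =>
    intro j hj hjl e he
    rcases hlast hj hjl with hj' | rfl
    · rw [hold _ hj'] at he
      exact h.X_thin j hj hj' e he
    · rw [hnewX, List.mem_toFinset] at he
      exact hL.thin e he
  case X_blocked =>
    intro j hj hjl e he
    rcases hlast hj hjl with hj' | rfl
    · rw [hold _ hj'] at he ⊢
      exact h.X_blocked j hj hj' e he
    · rw [hnewX, List.mem_toFinset] at he
      refine lt_of_le_of_lt (A.value_mono fun r hr => ?_) (hL.blocked e he)
      obtain ⟨hre, hr⟩ := mem_sdiff.1 hr
      refine mem_sdiff.2 ⟨hre, fun hrE => hr ?_⟩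
      obtain ⟨f, hf, hrf⟩ := mem_resources.1 hrE
      exact mem_resources.2 ⟨f, (hnewY f).2 ⟨hf, e, he, not_disjoint_iff.2 ⟨r, hrf, hre⟩⟩, hrf⟩
  case X_meets =>
    intro j hj hjl e he f hf hfe
    rw [hE] at hf
    rcases hlast hj hjl with hj' | rfl
    · rw [hold _ hj'] at he ⊢
      exact h.X_meets j hj hj' e he f hf hfe
    · rw [hnewX, List.mem_toFinset] at he
      exact (hnewY f).2 ⟨hf, e, he, hfe⟩
  case I_indep =>
    have h1 := A.isRank.indep_union_image_mono Prod.fst (W := s.rest s.ℓ) (W' := s'.rest s'.ℓ)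
      (J := c₁.I) (J' := c₁.I) (by
        rw [hℓ, ← hrest s.ℓ le_rfl]
        exact s'.rest_anti (Nat.le_succ _)) subset_rfl hF.indep
    rw [hI]
    exact h1.ge
  case X_rank =>
    intro j hj hjl
    rcases (show j < s.ℓ ∨ j = s.ℓ by lia) with hj' | rfl
    · refine h.X_rank_transfer hj hj' (fun i _ hi => hold i (by lia)) ?_ ?_ (hreach j hj'.le) ?_
      · rw [hold _ hj']
      · rw [hrest j hj'.le]
      · intro e he he'
        rw [hold _ hj'] at he'
        exact absurd he he'
    · have h1 := h.card_rest_add_sizeX_le hF.subset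
      have h2 := hL.rank
      rw [State.sizeX_succ, State.sizeX_congr (fun i _ hi => hold i hi), hrest _ le_rfl, hI,
        State.Xle_succ, hXle _ le_rfl, hnewX, players_union, List.toFinset_card_of_nodup hL.nodup,
        ← union_assoc]
      lia
  case record =>
    intro j hj hjl
    rcases (show j < s.ℓ ∨ j = s.ℓ by lia) with hj' | rfl
    · refine h.record_transfer hj hj' (fun i _ hi => hold i (by lia)) ?_ ?_ (hreach j hj'.le) ?_
      · rw [hold _ hj']
      · rw [hrest j hj'.le]
      · intro e he he'
        rw [hold _ hj'] at he'
        exact absurd he he'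
    · refine ⟨L, s.rest s.ℓ, c₁.I, ⟨?_, hL.nodup, ?_, ?_, ?_, hL.value_le, hF.value_le, ?_, ?_⟩⟩
      · rw [hnewX]
      · rw [hrest _ le_rfl]
        exact hL.indep
      · have := A.subset_reach s' s.ℓ
        rwa [hrest _ le_rfl, hI] at this
      · intro e he he'
        rw [hnewX, List.mem_toFinset] at he'
        exact absurd he he'
      · rw [hXle _ le_rfl, hYle _ le_rfl]
        exact hL.before
      · rw [hXle _ le_rfl, hYle _ le_rfl]
        intro q hq O hO hdis
        exact A.value_lt_of_no_addableEdge hu huτ (c := ⟨c₁.I, L.toFinset⟩)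
          (h.addablePlayer_iff.2 hq) (fun B => hno _) hO hdis

end Build

/-! ### The collapse routine preserves the invariants -/

section Collapse

variable {P : Type u} {R : Type w} [Fintype P] [Fintype R] [DecidableEq P] [DecidableEq R]
variable {A : Setting P R} {s s' : State P R} {p₀ : P}

lemma mem_famLe {D : ℕ → Finset (Edge P R)} {k : ℕ} {e : Edge P R} :
    e ∈ famLe D k ↔ ∃ i, 1 ≤ i ∧ i ≤ k ∧ e ∈ D i := by
  simp [famLe, and_assoc]

lemma famLe_succ (D : ℕ → Finset (Edge P R)) (k : ℕ) :
    famLe D (k + 1) = famLe D k ∪ D (k + 1) := by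
  ext e
  rw [mem_union, mem_famLe, mem_famLe]
  constructor
  · rintro ⟨h, h1, h2, h3⟩
    rcases Nat.lt_or_ge k h with hk | hk
    · obtain rfl : h = k + 1 := by lia
      exact Or.inr h3
    · exact Or.inl ⟨h, h1, hk, h3⟩
  · rintro (⟨h, h1, h2, h3⟩ | h)
    · exact ⟨h, h1, by lia, h3⟩
    · exact ⟨k + 1, by lia, le_rfl, h⟩

lemma famLe_mono (D : ℕ → Finset (Edge P R)) {j k : ℕ} (h : j ≤ k) : famLe D j ⊆ famLe D k :=
  fun e he => by
    obtain ⟨i, h1, h2, h3⟩ := mem_famLe.1 he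
    exact mem_famLe.2 ⟨i, h1, h2.trans h, h3⟩

/-- The effect of the release loop: `ℐ` grows by edges whose resources come from the released
edges, stays independent, and its closure contains the players of all released edges. -/
lemma Setting.Release.spec {M : Finset (P × R)} {E : Finset (Edge P R)} {Y : Finset P}
    {es : List (Edge P R)} {I J : Finset (Edge P R)} (hM : A.IsMaxMatching M)
    (hY : Y ⊆ unmatched M) (h : A.Release M E Y es I J) :
    I ⊆ J ∧ (∀ e ∈ es, e.1 ∈ span A.rank ((unmatched M \ Y) ∪ players J)) ∧
      (∀ f ∈ J, f ∈ I ∨ ∃ e ∈ es, f.2 ⊆ e.2 ∧ A.MinimalSet f.2) ∧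
      ∀ W ⊆ unmatched M \ Y, W.card + I.card ≤ A.rank (W ∪ players I) →
        W.card + J.card ≤ A.rank (W ∪ players J) := by
  induction h with
  | nil I => exact ⟨subset_rfl, by simp, fun f hf => Or.inl hf, fun _ _ h => h⟩
  | add p B B' es I J hp hB' hmin _ _ ih =>
    obtain ⟨h1, h2, h3, h4⟩ := ih
    rw [hM.maxPaths_succ_iff hY] at hp
    refine ⟨(subset_insert _ _).trans h1, ?_, ?_, ?_⟩
    · intro e he
      rcases List.mem_cons.1 he with rfl | he
      · exact IsRank.subset_span _ _ (mem_union_right _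
          (mem_players.2 ⟨_, h1 (mem_insert_self _ _), rfl⟩))
      · exact h2 e he
    · intro f hf
      rcases h3 f hf with hf | ⟨e, he, hfe⟩
      · rcases mem_insert.1 hf with rfl | hf
        · exact Or.inr ⟨(p, B), List.mem_cons_self, hB', hmin⟩
        · exact Or.inl hf
      · exact Or.inr ⟨e, List.mem_cons_of_mem _ he, hfe⟩
    · intro W hW hI
      refine h4 W hW ?_
      have hpW : p ∉ span A.rank (W ∪ players I) := fun hh =>
        hp (A.isRank.span_mono (union_subset_union hW subset_rfl) hh)
      have hpI : (p, B') ∉ I := fun hh =>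
        hpW (IsRank.subset_span _ _ (mem_union_right _ (mem_players.2 ⟨_, hh, rfl⟩)))
      rw [card_insert_of_notMem hpI, players_insert, union_insert, A.isRank.notMem_span.1 hpW]
      lia
  | skip p B es I J hp _ ih =>
    obtain ⟨h1, h2, h3, h4⟩ := ih
    rw [Ne, hM.maxPaths_succ_iff hY, not_not] at hp
    refine ⟨h1, ?_, ?_, h4⟩
    · intro e he
      rcases List.mem_cons.1 he with rfl | he
      · exact A.isRank.span_mono (union_subset_union subset_rfl (players_mono h1)) hp
      · exact h2 e he
    · intro f hf
      rcases h3 f hf with hf | ⟨e, he, hfe⟩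
      · exact Or.inl hf
      · exact Or.inr ⟨e, List.mem_cons_of_mem _ he, hfe⟩

section Canonical

variable {D : ℕ → Finset (Edge P R)}

lemma Setting.IsCanonicalDecomp.subset_I (hD : A.IsCanonicalDecomp s D) {i : ℕ} (hi : 1 ≤ i)
    (hil : i ≤ s.ℓ) : D i ⊆ s.I := fun e he => by
  rw [← hD.1]
  exact mem_famLe.2 ⟨i, hi, hil, he⟩

lemma Setting.IsCanonicalDecomp.eq_of_player_eq (hpos : 1 ≤ s.ℓ)
    (hD : A.IsCanonicalDecomp s D) {e f : Edge P R} (he : e ∈ s.I) (hf : f ∈ s.I)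
    (h : e.1 = f.1) : e = f := by
  have h1 := (hD.2.2 s.ℓ (mem_Icc.2 ⟨hpos, le_rfl⟩)).2.2
  rw [hD.1] at h1
  exact card_image_iff.1 h1 he hf h

lemma Setting.IsCanonicalDecomp.disjoint_players (hpos : 1 ≤ s.ℓ)
    (hD : A.IsCanonicalDecomp s D) {i j : ℕ} (hi : i ∈ Icc 1 s.ℓ) (hj : j ∈ Icc 1 s.ℓ)
    (hij : i ≠ j) : Disjoint (players (D i)) (players (D j)) := by
  rw [disjoint_left]
  intro p hp hp'
  obtain ⟨e, he, rfl⟩ := mem_players.1 hp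
  obtain ⟨f, hf, hfe⟩ := mem_players.1 hp'
  obtain rfl := hD.eq_of_player_eq hpos
    (hD.subset_I (mem_Icc.1 hj).1 (mem_Icc.1 hj).2 hf)
    (hD.subset_I (mem_Icc.1 hi).1 (mem_Icc.1 hi).2 he) hfe
  exact disjoint_left.1 (hD.2.1 i hi j hj hij) he hf

/-- The rank condition behind a canonical decomposition. -/
lemma Setting.IsCanonicalDecomp.rank_eq (h : A.Inv p₀ s) (hD : A.IsCanonicalDecomp s D) {i : ℕ}
    (hi : 1 ≤ i) (hil : i ≤ s.ℓ) :
    A.rank (s.rest i ∪ players s.I) = (s.rest i).card + (famLe D i).card ∧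
      A.rank (s.rest i ∪ players (famLe D i)) = (s.rest i).card + (famLe D i).card := by
  obtain ⟨h1, h2, h3⟩ := hD.2.2 i (mem_Icc.2 ⟨hi, hil⟩)
  have h4 := h.max.maxPaths_add (h.players_Yle_subset hil) (players s.I)
  have h5 := h.max.maxPaths_add (h.players_Yle_subset hil) (players (famLe D i))
  rw [← State.rest] at h4 h5
  lia

variable {Γ : ℕ → Finset (List (P ⊕ R))}

lemma Setting.IsCanonicalSolution.feasible (hΓ : A.IsCanonicalSolution s D Γ) {i : ℕ}
    (hi : i ∈ Icc 1 s.ℓ) :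
    A.Feasible s.M (players (s.layer i).Y) (players (D i)) (Γ i) :=
  hΓ.2.2.mono (subset_biUnion_of_mem Γ hi) (hΓ.1 i hi).2

lemma Setting.IsCanonicalSolution.sinks_eq (hΓ : A.IsCanonicalSolution s D Γ) {i : ℕ}
    (hi : i ∈ Icc 1 s.ℓ) : sinks (Γ i) = players (D i) := by
  refine eq_of_subset_of_card_le (hΓ.feasible hi).sinks_subset ?_
  rw [(hΓ.feasible hi).card_sinks, (hΓ.1 i hi).1]

/-- The players of `ℐ_i` that are unmatched are sources of trivial paths. -/
lemma Setting.IsCanonicalSolution.inter_unmatched (hΓ : A.IsCanonicalSolution s D Γ) {i : ℕ}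
    (hi : i ∈ Icc 1 s.ℓ) {p : P} (hp : p ∈ players (D i)) (hpU : p ∈ unmatched s.M) :
    p ∈ sources (Γ i) :=
  (hΓ.feasible hi).sinks_inter_unmatched_subset
    (mem_inter.2 ⟨by rwa [hΓ.sinks_eq hi], hpU⟩)

/-- Flipping `Γ_t` does not change the closure of the sets `(U ∖ Y_{≤ j}) ∪ I` for `j < t`,
even if `ℐ` is cut down to `ℐ_{≤ j}`: flipping `Γ_1, …, Γ_j` as well shows that the new set is
still independent. -/
lemma Setting.IsCanonicalSolution.subset_span (h : A.Inv p₀ s) (hD : A.IsCanonicalDecomp s D)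
    (hΓ : A.IsCanonicalSolution s D Γ) {j t : ℕ} (hj : 1 ≤ j) (hjt : j < t) (ht : t ≤ s.ℓ)
    (hcard : ((s.rest j \ sources (Γ t)) ∪ players (D t)).card = (s.rest j).card) :
    s.rest j ∪ players s.I ⊆ span A.rank
      ((s.rest j \ sources (Γ t)) ∪ players (D t) ∪ players (famLe D j)) := by
  have htm : t ∈ Icc 1 s.ℓ := mem_Icc.2 ⟨by lia, ht⟩
  have hmem : ∀ i ∈ insert t (Icc 1 j), i ∈ Icc 1 s.ℓ := by
    intro i hi
    rcases mem_insert.1 hi with rfl | hi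
    · exact htm
    · rw [mem_Icc] at hi ⊢
      lia
  set Δ := (insert t (Icc 1 j)).biUnion Γ with hΔ
  have hΔf : A.Feasible s.M (players (s.Yle s.ℓ)) (players s.I) Δ := by
    refine hΓ.2.2.mono (biUnion_subset_biUnion_of_subset_left _ hmem) fun π hπ => ?_
    obtain ⟨i, hi, hπ⟩ := mem_biUnion.1 hπ
    exact hΓ.2.2.1 π (mem_biUnion.2 ⟨i, hmem i hi, hπ⟩)
  have hsink : ∀ i ∈ insert t (Icc 1 j), players (D i) ⊆ sinks Δ := by
    intro i hi p hp
    rw [← hΓ.sinks_eq (hmem i hi)] at hp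
    obtain ⟨π, hπ, hl⟩ := mem_sinks.1 hp
    exact mem_sinks.2 ⟨π, mem_biUnion.2 ⟨i, hi, hπ⟩, hl⟩
  have hZ : (s.rest j \ sources (Γ t)) ∪ players (D t) ∪ players (famLe D j) ⊆
      unmatched (flip s.M Δ) := by
    rw [hΔf.unmatched_flip h.max.1 (h.players_Yle_subset le_rfl)]
    refine union_subset (union_subset ?_ ?_) ?_
    · intro p hp
      obtain ⟨hpr, hpt⟩ := mem_sdiff.1 hp
      obtain ⟨hpU, hpY⟩ := mem_sdiff.1 hpr
      refine mem_union_left _ (mem_sdiff.2 ⟨hpU, fun hps => ?_⟩)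
      obtain ⟨π, hπ, hhd⟩ := mem_sources.1 hps
      obtain ⟨i, hi, hπ⟩ := mem_biUnion.1 hπ
      have hpi : p ∈ sources (Γ i) := mem_sources.2 ⟨π, hπ, hhd⟩
      rcases mem_insert.1 hi with rfl | hij
      · exact hpt hpi
      · have := (hΓ.feasible (hmem i hi)).sources_subset hpi
        obtain ⟨e, he, rfl⟩ := mem_players.1 this
        rw [mem_Icc] at hij
        exact hpY (mem_players.2 ⟨e, State.mem_Yle.2 ⟨i, hij.1, hij.2, he⟩, rfl⟩)
    · exact (hsink t (mem_insert_self _ _)).trans subset_union_right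
    · intro p hp
      obtain ⟨e, he, rfl⟩ := mem_players.1 hp
      obtain ⟨i, h1, h2, h3⟩ := mem_famLe.1 he
      exact mem_union_right _ (hsink i (mem_insert_of_mem (mem_Icc.2 ⟨h1, h2⟩))
        (mem_players.2 ⟨e, h3, rfl⟩))
  have hdisj : Disjoint ((s.rest j \ sources (Γ t)) ∪ players (D t)) (players (famLe D j)) := by
    rw [disjoint_left]
    intro p hp hp'
    obtain ⟨e, he, rfl⟩ := mem_players.1 hp'
    obtain ⟨i, h1, h2, h3⟩ := mem_famLe.1 he
    have him : i ∈ Icc 1 s.ℓ := mem_Icc.2 ⟨h1, by lia⟩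
    have hei : e.1 ∈ players (D i) := mem_players.2 ⟨e, h3, rfl⟩
    rcases mem_union.1 hp with hp | hp
    · obtain ⟨hpU, hpY⟩ := mem_sdiff.1 (mem_sdiff.1 hp).1
      have := (hΓ.feasible him).sources_subset (hΓ.inter_unmatched him hei hpU)
      obtain ⟨f, hf, hfe⟩ := mem_players.1 this
      exact hpY (mem_players.2 ⟨f, State.mem_Yle.2 ⟨i, h1, h2, hf⟩, hfe⟩)
    · exact disjoint_left.1 (hD.disjoint_players h.pos htm him (by lia)) hp hei
  have hr1 := (hΔf.flip_isMaxMatching h.max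
    (h.players_Yle_subset le_rfl)).rank_of_subset_unmatched hZ
  rw [card_union_of_disjoint hdisj, hcard] at hr1
  have hr2 := (hD.rank_eq h hj (by lia)).1
  have hr3 := (hD.2.2 j (mem_Icc.2 ⟨hj, by lia⟩)).2.2
  have hsub : (s.rest j \ sources (Γ t)) ∪ players (D t) ∪ players (famLe D j) ⊆
      s.rest j ∪ players s.I := by
    refine union_subset (union_subset (sdiff_subset.trans subset_union_left)
      ((players_mono (hD.subset_I (by lia) ht)).trans subset_union_right))
      ((players_mono ?_).trans subset_union_right)
    rw [← hD.1]
    exact famLe_mono D (by lia)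
  exact A.isRank.subset_span_of_rank_le hsub (by lia)

end Canonical

theorem Setting.Inv.collapse (h : A.Inv p₀ s) (hu : 0 ≤ A.tau / A.lam) (hc : A.Collapse s s') :
    A.Inv p₀ s' := by
  obtain ⟨t, D, Γ, V, E', M', es, I', ht2, hcol, -, hD, hΓ, hM', hV, hE', -, hes, hrel, hs'⟩ := hc
  have htl : t ≤ s.ℓ := hcol.2.1
  have htm : t ∈ Icc 1 s.ℓ := mem_Icc.2 ⟨by lia, htl⟩
  have hM : s'.M = M' := by rw [hs']
  have hE : s'.E = E' := by rw [hs']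
  have hI : s'.I = I' := by rw [hs']
  have hℓ : s'.ℓ = t := by rw [hs']
  have hold : ∀ i, i < t → s'.layer i = s.layer i := fun i hi => by
    rw [hs']
    exact Function.update_of_ne hi.ne _ _
  have hX : ∀ e, e ∈ (s'.layer t).X ↔ e ∈ (s.layer t).X ∧ ¬ A.Unblocked E' e := by
    intro e
    rw [hs']
    simp
  have hY : ∀ e, e ∈ (s'.layer t).Y ↔ e ∈ (s.layer t).Y ∧ e.1 ∉ sources (Γ t) := by
    intro e
    rw [hs']
    simp only [Function.update_self, mem_sdiff, hV, mem_filter, not_and]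
    tauto
  have hes' : ∀ e, e ∈ es ↔ e ∈ (s.layer t).X ∧ A.Unblocked E' e := by
    intro e
    rw [← List.mem_toFinset, hes]
    simp
  have hXle' : ∀ i, 1 ≤ i → i ≤ t → (s'.layer i).X ⊆ (s.layer i).X := by
    intro i _ hi e he
    rcases hi.eq_or_lt with rfl | hi
    · exact ((hX e).1 he).1
    · rwa [hold i hi] at he
  have hYle' : ∀ i, 1 ≤ i → i ≤ t → (s'.layer i).Y ⊆ (s.layer i).Y := by
    intro i _ hi e he
    rcases hi.eq_or_lt with rfl | hi
    · exact ((hY e).1 he).1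
    · rwa [hold i hi] at he
  -- the new matching
  have hYU : players (s.layer t).Y ⊆ unmatched s.M := h.players_Y_subset (by lia) htl
  have hfeas := hΓ.feasible htm
  have hmax : A.IsMaxMatching M' := hM' ▸ hfeas.flip_isMaxMatching h.max hYU
  have hU : unmatched M' = (unmatched s.M \ sources (Γ t)) ∪ players (D t) := by
    rw [hM', hfeas.unmatched_flip h.max.1 hYU, hΓ.sinks_eq htm]
  have hσY : sources (Γ t) ⊆ players (s.layer t).Y := hfeas.sources_subset
  have hTU : ∀ p ∈ players (D t), p ∈ unmatched s.M → p ∈ sources (Γ t) := fun p hp hpU =>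
    hΓ.inter_unmatched htm hp hpU
  have hσj : ∀ j, 1 ≤ j → j < t → ∀ p ∈ players (s.layer j).Y, p ∉ sources (Γ t) :=
    fun j hj hjt p hp hps =>
      disjoint_left.1 (h.Y_disjoint j t hj hjt htl) hp (hσY hps)
  have hσle : ∀ j < t, ∀ p ∈ players (s.Yle j), p ∉ sources (Γ t) := by
    intro j hj p hp
    obtain ⟨e, he, rfl⟩ := mem_players.1 hp
    obtain ⟨i, h1, h2, h3⟩ := State.mem_Yle.1 he
    exact hσj i h1 (by lia) _ (mem_players.2 ⟨e, h3, rfl⟩)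
  have hDI : D t ⊆ s.I := hD.subset_I (by lia) htl
  -- the new set of thin edges
  have hE'mem : ∀ e ∈ E', (e ∈ s.E ∧ e.1 ∉ sources (Γ t)) ∨ e ∈ D t := by
    intro e he
    rw [hE', mem_sdiff, mem_union, hV, mem_filter, not_and] at he
    rcases he with ⟨heE | heD, heV⟩
    · refine Or.inl ⟨heE, fun hes => ?_⟩
      obtain ⟨f, hf, hfe⟩ := mem_players.1 (hσY hes)
      obtain rfl := h.E_inj f (h.Y_subset t ht2 htl hf) e heE hfe
      exact heV hf hes
    · exact Or.inr heD
  have hYE : ∀ j, 2 ≤ j → j ≤ t → (s'.layer j).Y ⊆ E' := by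
    intro j hj hjt e he
    have heY := hYle' j (by lia) hjt he
    rw [hE', mem_sdiff, hV, mem_filter, not_and]
    refine ⟨mem_union_left _ (h.Y_subset j hj (by lia) heY), fun _ => ?_⟩
    rcases hjt.eq_or_lt with rfl | hjt
    · exact ((hY e).1 he).2
    · exact hσj j (by lia) hjt _ (mem_players.2 ⟨e, heY, rfl⟩)
  -- the sets of unmatched players outside of `Y_{≤ j}`
  have hYlej : ∀ j < t, s'.Yle j = s.Yle j := fun j hj =>
    State.Yle_congr fun i _ hi => hold i (by lia)
  have hYleU : ∀ j < t, players (s.Yle j) ⊆ unmatched M' := by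
    intro j hj p hp
    rw [hU]
    exact mem_union_left _ (mem_sdiff.2 ⟨h.players_Yle_subset (by lia) hp, hσle j hj p hp⟩)
  have hrest : ∀ j < t, s'.rest j = (s.rest j \ sources (Γ t)) ∪ players (D t) := by
    intro j hj
    have h1 : Disjoint (players (D t)) (players (s.Yle j)) := disjoint_left.2 fun p hp hpY =>
      hσle j hj p hpY (hTU p hp (h.players_Yle_subset (by lia) hpY))
    rw [State.rest, State.rest, hM, hYlej j hj, hU, union_sdiff_distrib,
      sdiff_eq_self_of_disjoint h1, sdiff_right_comm]
  have hcard : ∀ j < t, (s'.rest j).card = (s.rest j).card := by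
    intro j hj
    have h1 := card_sdiff_add_card_eq_card (hYleU j hj)
    have h2 := h.card_rest_add (j := j) (by lia)
    have h3 := h.max.card_unmatched_eq hmax
    rw [State.rest, hM, hYlej j hj]
    lia
  obtain ⟨m, rfl⟩ : ∃ m, t = m + 1 := ⟨t - 1, by lia⟩
  simp only [Nat.add_sub_cancel] at hrel
  obtain ⟨hrI, hrspan, hrmem, hrindep⟩ := hrel.spec hmax (hYleU m (by lia))
  have hrest_m : unmatched M' \ players (s.Yle m) = s'.rest m := by
    rw [State.rest, hM, hYlej m (by lia)]
  rw [hrest_m] at hrspan hrindep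
  have hfamI : famLe D m ⊆ s.I := by
    rw [← hD.1]
    exact famLe_mono D (by lia)
  have hI'mem : ∀ f ∈ I', f ∈ s.I ∨ ∃ e ∈ (s.layer (m + 1)).X, A.Unblocked E' e ∧ f.2 ⊆ e.2 ∧
      A.MinimalSet f.2 := by
    intro f hf
    rcases hrmem f hf with hf | ⟨e, he, hfe⟩
    · exact Or.inl (hfamI hf)
    · exact Or.inr ⟨e, ((hes' e).1 he).1, ((hes' e).1 he).2, hfe⟩
  have hreach : ∀ j, 1 ≤ j → j < m + 1 → s.rest j ∪ players s.I ⊆ A.reach s' j := by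
    intro j hj hjt
    refine (hΓ.subset_span h hD hj hjt htl (by rw [← hrest j hjt, hcard j hjt])).trans ?_
    rw [← hrest j hjt, Setting.reach, hI]
    exact A.isRank.span_mono (union_subset_union subset_rfl
      (players_mono ((famLe_mono D (by lia)).trans hrI)))
  have hremoved : ∀ j, 1 ≤ j → j < m + 1 → ∀ e ∈ (s.layer (j + 1)).X,
      e ∉ (s'.layer (j + 1)).X → e.1 ∈ A.reach s' j := by
    intro j hj hjt e he he'
    rcases (show j + 1 < m + 1 ∨ j = m by lia) with hjm | rfl
    · rw [hold _ hjm] at he'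
      exact absurd he he'
    · rw [hX, not_and, not_not] at he'
      have := hrspan e ((hes' e).2 ⟨he, he' he⟩)
      rwa [Setting.reach, hI]
  have hmeets : ∀ j, 1 ≤ j → j ≤ m + 1 → ∀ e ∈ (s'.layer j).X, ∀ f ∈ E', ¬ Disjoint f.2 e.2 →
      f ∈ (s'.layer j).Y := by
    intro j hj hjt e he f hf hfe
    have heX := hXle' j hj hjt he
    rcases hE'mem f hf with ⟨hfE, hfσ⟩ | hfD
    · have hfY := h.X_meets j hj (by lia) e heX f hfE hfe
      rcases hjt.eq_or_lt with rfl | hjt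
      · exact (hY f).2 ⟨hfY, hfσ⟩
      · rwa [hold j hjt]
    · exact absurd (h.I_disjoint_X f (hDI hfD) j hj (by lia) e heX) hfe
  refine
    { max := by rw [hM]; exact hmax
      pos := by lia
      X_one := by rw [hold 1 (by lia), h.X_one]
      Y_one := by rw [hold 1 (by lia), h.Y_one]
      start_mem := ?start_mem
      E_mem := ?E_mem
      E_inj := ?E_inj
      Y_subset := by rw [hℓ, hE]; exact hYE
      Y_disjoint := ?Y_disjoint
      E_value := ?E_value
      I_value := ?I_value
      X_disjoint := ?X_disjoint
      I_disjoint_X := ?I_disjoint_X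
      X_thin := ?X_thin
      X_blocked := ?X_blocked
      X_meets := by rw [hℓ, hE]; exact hmeets
      I_indep := ?I_indep
      X_rank := ?X_rank
      record := ?record }
  case start_mem =>
    rw [hM]
    refine hYleU 1 (by lia) (mem_players.2 ⟨(p₀, ∅), State.mem_Yle.2 ⟨1, le_rfl, le_rfl, ?_⟩, rfl⟩)
    rw [h.Y_one]
    exact mem_singleton_self _
  case E_mem =>
    intro e he
    rw [hE] at he
    rw [hM, hU]
    rcases hE'mem e he with ⟨heE, hes⟩ | heD
    · exact ⟨mem_union_left _ (mem_sdiff.2 ⟨(h.E_mem e heE).1, hes⟩), (h.E_mem e heE).2⟩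
    · have heT : e.1 ∈ players (D (m + 1)) := mem_players.2 ⟨e, heD, rfl⟩
      refine ⟨mem_union_right _ heT, fun hep => ?_⟩
      -- `p₀` is unmatched, so only a trivial path ends in it, but `p₀` is not in `Y_t`
      obtain ⟨f, hf, hfe⟩ := mem_players.1 (hσY (hTU _ heT (hep ▸ h.start_mem)))
      exact (h.E_mem f (h.Y_subset _ ht2 htl hf)).2 (hfe.trans hep)
  case E_inj =>
    intro e he f hf hef
    rw [hE] at he hf
    have key : ∀ e ∈ s.E, e.1 ∉ sources (Γ (m + 1)) → ∀ f ∈ D (m + 1), e.1 ≠ f.1 := by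
      intro e he hes f hf hef
      exact hes (hTU _ (mem_players.2 ⟨f, hf, hef.symm⟩) (h.E_mem e he).1)
    rcases hE'mem e he with ⟨heE, hes⟩ | heD <;> rcases hE'mem f hf with ⟨hfE, hfs⟩ | hfD
    · exact h.E_inj e heE f hfE hef
    · exact absurd hef (key e heE hes f hfD)
    · exact absurd hef.symm (key f hfE hfs e heD)
    · exact hD.eq_of_player_eq h.pos (hDI heD) (hDI hfD) hef
  case Y_disjoint =>
    intro j k hj hjk hk
    rw [hℓ] at hk
    exact (h.Y_disjoint j k hj hjk (by lia)).mono (players_mono (hYle' j hj (by lia)))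
      (players_mono (hYle' k (by lia) hk))
  case E_value =>
    intro e he
    rw [hE] at he
    rcases hE'mem e he with ⟨heE, -⟩ | heD
    · exact h.E_value e heE
    · exact h.I_value e (hDI heD)
  case I_value =>
    intro f hf
    rw [hI] at hf
    rcases hI'mem f hf with hf | ⟨e, he, -, hfe, hmin⟩
    · exact h.I_value f hf
    · exact hmin.value_le hu fun r hr => h.X_thin _ (by lia) htl e he r (hfe hr)
  case X_disjoint =>
    rw [hℓ]
    intro j k hj hjt hk hkt e he f hf
    exact h.X_disjoint j k hj (by lia) hk (by lia) e (hXle' j hj hjt he) f (hXle' k hk hkt hf)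
  case I_disjoint_X =>
    rw [hI, hℓ]
    intro f hf j hj hjt g hg
    have hgX := hXle' j hj hjt hg
    rcases hI'mem f hf with hf | ⟨e, he, hub, hfe, -⟩
    · exact h.I_disjoint_X f hf j hj (by lia) g hgX
    · refine (h.X_disjoint (m + 1) j (by lia) htl hj (by lia) e he g hgX ?_).mono_left hfe
      rintro rfl rfl
      exact ((hX e).1 hg).2 hub
  case X_thin =>
    rw [hℓ]
    intro j hj hjt e he
    exact h.X_thin j hj (by lia) e (hXle' j hj hjt he)
  case X_blocked =>
    rw [hℓ]
    intro j hj hjt e he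
    rcases hjt.eq_or_lt with rfl | hjt'
    · have hnb := ((hX e).1 he).2
      have hlt : A.value (e.2 \ resources E') < A.tau / A.lam := by
        by_contra hle
        exact hnb ⟨_, sdiff_subset, not_lt.1 hle, sdiff_disjoint⟩
      refine lt_of_le_of_lt (A.value_mono fun r hr => ?_) hlt
      obtain ⟨hre, hr⟩ := mem_sdiff.1 hr
      refine mem_sdiff.2 ⟨hre, fun hrE => hr ?_⟩
      obtain ⟨f, hf, hrf⟩ := mem_resources.1 hrE
      exact mem_resources.2 ⟨f, hmeets _ hj hjt e he f hf (not_disjoint_iff.2 ⟨r, hrf, hre⟩), hrf⟩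
    · rw [hold j hjt'] at he ⊢
      exact h.X_blocked j hj (by lia) e he
  case I_indep =>
    have hsub : s'.rest (m + 1) ⊆ s.rest (m + 1) ∪ players (D (m + 1)) := by
      intro p hp
      obtain ⟨hpU, hpY⟩ := mem_sdiff.1 hp
      rw [hM, hU, mem_union] at hpU
      rcases hpU with hpU | hpT
      · obtain ⟨hpU, hps⟩ := mem_sdiff.1 hpU
        refine mem_union_left _ (mem_sdiff.2 ⟨hpU, fun hp' => hpY ?_⟩)
        obtain ⟨e, he, rfl⟩ := mem_players.1 hp'
        refine mem_players.2 ⟨e, ?_, rfl⟩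
        rw [State.Yle_succ, mem_union] at he ⊢
        rw [hYlej m (by lia)]
        exact he.imp id fun he => (hY e).2 ⟨he, hps⟩
      · exact mem_union_right _ hpT
    have hsup : s.rest (m + 1) ∪ players (D (m + 1)) ⊆ s'.rest (m + 1) := by
      intro p hp
      have hYsub : players (s'.Yle (m + 1)) ⊆ players (s.Yle (m + 1)) := by
        refine players_mono fun e he => ?_
        obtain ⟨i, h1, h2, h3⟩ := State.mem_Yle.1 he
        exact State.mem_Yle.2 ⟨i, h1, h2, hYle' i h1 h2 h3⟩
      rcases mem_union.1 hp with hp | hp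
      · obtain ⟨hpU, hpY⟩ := mem_sdiff.1 hp
        refine mem_sdiff.2 ⟨?_, fun hp' => hpY (hYsub hp')⟩
        rw [hM, hU]
        refine mem_union_left _ (mem_sdiff.2 ⟨hpU, fun hps => hpY ?_⟩)
        rw [State.Yle_succ, players_union]
        exact mem_union_right _ (hσY hps)
      · refine mem_sdiff.2 ⟨by rw [hM, hU]; exact mem_union_right _ hp, fun hp' => ?_⟩
        have hpσ := hTU p hp (h.players_Yle_subset htl (hYsub hp'))
        obtain ⟨e, he, rfl⟩ := mem_players.1 hp'
        rw [State.Yle_succ, mem_union, hYlej m (by lia)] at he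
        rcases he with he | he
        · exact hσle m (by lia) _ (mem_players.2 ⟨e, he, rfl⟩) hpσ
        · exact ((hY e).1 he).2 hpσ
    have heq : s'.rest (m + 1) = s.rest (m + 1) ∪ players (D (m + 1)) := hsub.antisymm hsup
    have h1 := (hD.rank_eq h (by lia) htl).2
    have h2 : (famLe D (m + 1)).card ≥ (famLe D m).card + (D (m + 1)).card := by
      rw [famLe_succ, card_union_of_disjoint]
      rw [disjoint_left]
      intro e he he'
      obtain ⟨i, hi1, hi2, hi3⟩ := mem_famLe.1 he
      exact disjoint_left.1 (hD.2.1 i (mem_Icc.2 ⟨hi1, by lia⟩) (m + 1) htm (by lia)) hi3 he'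
    have h3 : s.rest (m + 1) ∪ players (famLe D (m + 1)) =
        s'.rest (m + 1) ∪ players (famLe D m) := by
      rw [heq, famLe_succ, players_union, ← union_assoc, union_right_comm]
    have h4 := card_union_le (s.rest (m + 1)) (players (D (m + 1)))
    have h5 : (players (D (m + 1))).card ≤ (D (m + 1)).card := card_image_le
    rw [← heq] at h4
    rw [hℓ, hI]
    refine hrindep _ (s'.rest_anti (Nat.le_succ m)) ?_
    rw [← h3]
    lia
  case X_rank =>
    rw [hℓ]
    intro j hj hjt
    exact h.X_rank_transfer hj (by lia) (fun i _ hi => hold i (by lia))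
      (hXle' _ (by lia) (by lia)) (hcard j hjt) (hreach j hj hjt) (hremoved j hj hjt)
  case record =>
    rw [hℓ]
    intro j hj hjt
    exact h.record_transfer hj (by lia) (fun i _ hi => hold i (by lia))
      (hXle' _ (by lia) (by lia)) (hcard j hjt) (hreach j hj hjt) (hremoved j hj hjt)

/-- Every state of the algorithm satisfies the invariants. -/
theorem Setting.IsState.exists_inv (hs : A.IsState s) (hu : 0 ≤ A.tau / A.lam)
    (huτ : A.tau / A.lam ≤ A.tau) : ∃ p₀, A.Inv p₀ s := by
  induction hs with
  | init M E p₀ hME hM hE => exact ⟨p₀, Setting.inv_init hu hME hM hE⟩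
  | build s s' _ _ hb ih =>
    obtain ⟨p₀, h⟩ := ih
    exact ⟨p₀, h.build hu huτ hb⟩
  | collapse s s' _ hc ih =>
    obtain ⟨p₀, h⟩ := ih
    exact ⟨p₀, h.collapse hu hc⟩

end Collapse

/-! ### Canonical decompositions and collapsible layers -/

section Decomposition

variable {P : Type u} {R : Type w} [Fintype P] [Fintype R] [DecidableEq P] [DecidableEq R]
variable {A : Setting P R} {s : State P R} {p₀ : P}

/-- Every state has a canonical decomposition, because `ℐ` is independent over the unmatched
players outside of `Y_{≤ ℓ}`. -/
lemma Setting.Inv.exists_isCanonicalDecomp (h : A.Inv p₀ s) :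
    ∃ D, A.IsCanonicalDecomp s D := by
  have hr0 : A.rank (s.rest 0) = (s.rest 0).card := h.rank_rest 0
  obtain ⟨J, hJ0, hJ⟩ := A.isRank.exists_nested Prod.fst s.rest_anti hr0 s.I (by
    refine le_antisymm ((h.max.rank_le _).trans (by rw [State.rest_zero])) ?_
    rw [← hr0]
    exact A.isRank.mono subset_union_left)
  have hmono : Monotone J := monotone_nat_of_le_succ fun i => (hJ i).1
  have hfam : ∀ k, famLe (fun i => J i \ J (i - 1)) k = J k := by
    intro k
    induction k with
    | zero => simp [famLe, hJ0]
    | succ k ih =>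
      rw [famLe_succ, ih, Nat.add_sub_cancel, union_sdiff_of_subset (hJ k).1]
  refine ⟨fun i => J i \ J (i - 1), ?_, ?_, ?_⟩
  · rw [hfam]
    refine eq_of_subset_of_card_le (hJ _).2.1 ?_
    have h1 := h.I_indep
    have h2 := (hJ s.ℓ).2.2.1
    have h3 := (hJ s.ℓ).2.2.2
    rw [h2] at h3
    have h4 : A.rank (s.rest s.ℓ ∪ players s.I) = (s.rest s.ℓ).card + (J s.ℓ).card := h3.symm
    lia
  · have key : ∀ i j, i < j → Disjoint (J i \ J (i - 1)) (J j \ J (j - 1)) := fun i j hij =>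
      disjoint_left.2 fun e he he' =>
        (mem_sdiff.1 he').2 (hmono (by lia : i ≤ j - 1) (mem_sdiff.1 he).1)
    intro i _ j _ hij
    rcases Nat.lt_or_gt_of_ne hij with hij | hij
    · exact key i j hij
    · exact (key j i hij).symm
  · intro i hi
    rw [hfam]
    have h1 := h.max.maxPaths_add (h.players_Yle_subset (mem_Icc.1 hi).2) (players (J i))
    have h2 := h.max.maxPaths_add (h.players_Yle_subset (mem_Icc.1 hi).2) (players s.I)
    rw [← State.rest] at h1 h2
    have h3 : A.rank (s.rest i ∪ players (J i)) = _ := (hJ i).2.2.1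
    have h4 : A.rank (s.rest i ∪ players (J i)) = A.rank (s.rest i ∪ players s.I) :=
      (hJ i).2.2.2
    have h5 := A.isRank.union_le (s.rest i) (players (J i))
    have h6 := A.isRank.le_card (s.rest i)
    have h7 : (players (J i)).card ≤ (J i).card := card_image_le
    lia

/-- If no layer up to `L_i` is collapsible, then `ℐ` is small over `Y_{≤ j}` for `j ≤ i`. -/
lemma Setting.Inv.rank_le_of_not_collapsible (h : A.Inv p₀ s) {i : ℕ} (hil : i ≤ s.ℓ)
    (hnc : ∀ j, 1 ≤ j → j ≤ i → ¬ A.Collapsible s j) {j : ℕ} (hj : 1 ≤ j) (hji : j ≤ i) :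
    (A.rank (s.rest j ∪ players s.I) : ℝ) ≤
      (s.rest j).card + A.mu * (players (s.Yle j)).card := by
  obtain ⟨D, hD⟩ := h.exists_isCanonicalDecomp
  have hlayer : ∀ k, 1 ≤ k → k ≤ i →
      ((D k).card : ℝ) ≤ A.mu * (players (s.layer k).Y).card := by
    intro k hk hki
    have h1 := fun hle => hnc k hk hki ⟨hk, hki.trans hil, D, hD, hle⟩
    have h2 : (players (D k)).card = (D k).card := card_image_of_injOn fun e he f hf hef =>
      hD.eq_of_player_eq h.pos (hD.subset_I hk (hki.trans hil) he)
        (hD.subset_I hk (hki.trans hil) hf) hef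
    rw [h2] at h1
    exact (not_le.1 h1).le
  have hfam : ∀ k ≤ i, ((famLe D k).card : ℝ) ≤ A.mu * (players (s.Yle k)).card := by
    intro k
    induction k with
    | zero => intro _; simp [famLe, State.Yle]
    | succ k ih =>
      intro hk
      have h1 := ih (by lia)
      have h2 := hlayer (k + 1) (by lia) hk
      have h3 : (famLe D (k + 1)).card ≤ (famLe D k).card + (D (k + 1)).card := by
        rw [famLe_succ]
        exact card_union_le _ _
      have h4 : ((famLe D (k + 1)).card : ℝ) ≤ (famLe D k).card + (D (k + 1)).card := by
        exact_mod_cast h3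
      rw [h.card_players_Yle_succ (by lia)]
      push_cast
      linarith
  rw [(hD.rank_eq h hj (hji.trans hil)).1]
  push_cast
  linarith [hfam j hji]

/-- The edges that left `𝒳_{j+1}` and those that were in `ℐ` when it was constructed are
bounded by the rank of the current `ℐ`. -/
lemma Setting.Record.card_le {j : ℕ} {L : List (Edge P R)} {W : Finset P} {J : Finset (Edge P R)}
    (hr : A.Record s j L W J) : (s.rest j).card + J.card +
      (L.toFinset \ (s.layer (j + 1)).X).card ≤ A.rank (s.rest j ∪ players s.I) := by
  have h1 := hr.indep
  have h2 : W ∪ players J ∪ players (L.toFinset \ (s.layer (j + 1)).X) ⊆ A.reach s j := by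
    refine union_subset hr.start fun p hp => ?_
    obtain ⟨e, he, rfl⟩ := mem_players.1 hp
    obtain ⟨he, heX⟩ := mem_sdiff.1 he
    exact hr.removed e (List.mem_toFinset.1 he) heX
  have h3 := A.isRank.rank_le_of_subset_span h2
  have h4 : W ∪ players J ∪ players L.toFinset =
      (W ∪ players J ∪ players (L.toFinset \ (s.layer (j + 1)).X)) ∪
        players (s.layer (j + 1)).X := by
    conv_lhs => rw [← sdiff_union_of_subset hr.subset, players_union, ← union_assoc]
  have h5 := A.isRank.union_le (W ∪ players J ∪ players (L.toFinset \ (s.layer (j + 1)).X))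
    (players (s.layer (j + 1)).X)
  have h6 : (players (s.layer (j + 1)).X).card ≤ (s.layer (j + 1)).X.card := card_image_le
  have h7 := card_sdiff_add_card_eq_card hr.subset
  rw [List.toFinset_card_of_nodup hr.nodup] at h7
  rw [h4] at h1
  lia

end Decomposition

/-! ### The value of the covered resources -/

section Values

variable {P : Type u} {R : Type w} [Fintype P] [Fintype R] [DecidableEq P] [DecidableEq R]
variable {A : Setting P R} {s : State P R} {p₀ : P}

lemma Setting.value_union_le (B C : Finset R) : A.value (B ∪ C) ≤ A.value B + A.value C := by
  have h1 : A.value (B ∪ C) + A.value (B ∩ C) = A.value B + A.value C := sum_union_inter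
  linarith [A.value_nonneg (B ∩ C)]

lemma Setting.value_biUnion_le {ι : Type*} [DecidableEq ι] (S : Finset ι) (f : ι → Finset R) :
    A.value (S.biUnion f) ≤ ∑ i ∈ S, A.value (f i) := by
  induction S using Finset.induction_on with
  | empty => simp [Setting.value]
  | insert i S hi ih =>
    rw [biUnion_insert, sum_insert hi]
    linarith [A.value_union_le (f i) (S.biUnion f)]

lemma Setting.value_resources_le {S : Finset (Edge P R)} {b : ℝ}
    (hS : ∀ e ∈ S, A.value e.2 ≤ b) : A.value (resources S) ≤ S.card * b := by
  refine (A.value_biUnion_le S Prod.snd).trans ((sum_le_sum hS).trans ?_)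
  rw [sum_const, nsmul_eq_mul]

lemma Setting.value_inter_add_sdiff (B C : Finset R) :
    A.value (B ∩ C) + A.value (B \ C) = A.value B := sum_inter_add_sum_sdiff B C A.v

lemma sum_Icc_shift {N : Type*} [AddCommMonoid N] {f : ℕ → N} (hf : f 1 = 0) (k : ℕ) :
    ∑ j ∈ Icc 1 k, f (j + 1) = ∑ h ∈ Icc 1 (k + 1), f h := by
  induction k with
  | zero => simp [hf]
  | succ k ih =>
    rw [sum_Icc_succ_top (by lia), ih, ← sum_Icc_succ_top (by lia)]

namespace Setting.Inv

variable (h : A.Inv p₀ s)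
include h

lemma card_Yle {k : ℕ} (hk : k ≤ s.ℓ) : (players (s.Yle k)).card = (s.Yle k).card := by
  have hmem : ∀ e ∈ s.Yle k, e = (p₀, ∅) ∨ e ∈ s.E := by
    intro e he
    obtain ⟨i, h1, h2, h3⟩ := State.mem_Yle.1 he
    rcases h1.eq_or_lt with rfl | h1
    · rw [h.Y_one, mem_singleton] at h3
      exact Or.inl h3
    · exact Or.inr (h.Y_subset i h1 (h2.trans hk) h3)
  refine card_image_of_injOn fun e he f hf hef => ?_
  rcases hmem e he with rfl | heE <;> rcases hmem f hf with rfl | hfE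
  · rfl
  · exact absurd hef.symm (h.E_mem f hfE).2
  · exact absurd hef (h.E_mem e heE).2
  · exact h.E_inj e heE f hfE hef

lemma value_resources_Yle (hu : 0 ≤ A.tau / A.lam) {k : ℕ} (hk : k ≤ s.ℓ) :
    A.value (resources (s.Yle k)) ≤ (players (s.Yle k)).card * (2 * (A.tau / A.lam)) := by
  rw [h.card_Yle hk]
  refine A.value_resources_le fun e he => ?_
  obtain ⟨i, h1, h2, h3⟩ := State.mem_Yle.1 he
  rcases h1.eq_or_lt with rfl | h1
  · rw [h.Y_one, mem_singleton] at h3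
    rw [h3]
    simp only [Setting.value, sum_empty]
    linarith
  · exact h.E_value e (h.Y_subset i h1 (h2.trans hk) h3)

/-- The edges of `𝒳` are disjoint and have less than `τ/λ` outside of the resources of `𝒴`. -/
lemma sum_value_X_le {k : ℕ} (hk : k ≤ s.ℓ) :
    ∑ i ∈ Icc 1 k, ∑ e ∈ (s.layer i).X, A.value e.2 ≤
      s.sizeX k * (A.tau / A.lam) + A.value (resources (s.Yle k)) := by
  have h1 : ∀ i ∈ Icc 1 k, ∀ e ∈ (s.layer i).X, A.value e.2 ≤
      A.tau / A.lam + A.value (e.2 ∩ resources (s.layer i).Y) := by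
    intro i hi e he
    rw [mem_Icc] at hi
    have := h.X_blocked i hi.1 (hi.2.trans hk) e he
    linarith [A.value_inter_add_sdiff e.2 (resources (s.layer i).Y)]
  have h2 : ∑ i ∈ Icc 1 k, ∑ e ∈ (s.layer i).X, A.value (e.2 ∩ resources (s.layer i).Y) ≤
      A.value (resources (s.Yle k)) := by
    rw [← sum_sigma (Icc 1 k) (fun i => (s.layer i).X)
      (fun κ => A.value (κ.2.2 ∩ resources (s.layer κ.1).Y))]
    have h3 : A.value (((Icc 1 k).sigma fun i => (s.layer i).X).biUnion
        fun κ => κ.2.2 ∩ resources (s.layer κ.1).Y) =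
        ∑ κ ∈ (Icc 1 k).sigma fun i => (s.layer i).X,
          A.value (κ.2.2 ∩ resources (s.layer κ.1).Y) := by
      refine sum_biUnion fun κ hκ κ' hκ' hne => ?_
      rw [mem_coe, mem_sigma, mem_Icc] at hκ hκ'
      refine (h.X_disjoint κ.1 κ'.1 hκ.1.1 (hκ.1.2.trans hk) hκ'.1.1 (hκ'.1.2.trans hk) κ.2 hκ.2
        κ'.2 hκ'.2 fun h1 h2 => hne (Sigma.ext h1 (heq_of_eq h2))).mono inter_subset_left
        inter_subset_left
    rw [← h3]
    refine A.value_mono (biUnion_subset.2 fun κ hκ => ?_)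
    rw [mem_sigma, mem_Icc] at hκ
    exact inter_subset_right.trans (resources_mono fun e he =>
      State.mem_Yle.2 ⟨κ.1, hκ.1.1, hκ.1.2, he⟩)
  have h4 := sum_le_sum fun i hi => sum_le_sum (h1 i hi)
  simp only [sum_add_distrib, sum_const, nsmul_eq_mul] at h4
  rw [← sum_mul, ← Nat.cast_sum] at h4
  have h5 : (∑ i ∈ Icc 1 k, (s.layer i).X.card) = s.sizeX k := rfl
  rw [h5] at h4
  linarith

lemma value_covered_le {k : ℕ} (hk : k ≤ s.ℓ) :
    A.value (resources (s.Yle k) ∪ resources (s.Xle k)) ≤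
      A.value (resources (s.Yle k)) + s.sizeX k * (A.tau / A.lam) := by
  have hsub : resources (s.Yle k) ∪ resources (s.Xle k) ⊆ resources (s.Yle k) ∪
      (Icc 1 k).biUnion fun i => (s.layer i).X.biUnion
        fun e => e.2 \ resources (s.layer i).Y := by
    refine union_subset subset_union_left fun r hr => ?_
    obtain ⟨e, he, hre⟩ := mem_resources.1 hr
    obtain ⟨i, h1, h2, h3⟩ := State.mem_Xle.1 he
    by_cases hrY : r ∈ resources (s.layer i).Y
    · exact mem_union_left _ (resources_mono (fun f hf => State.mem_Yle.2 ⟨i, h1, h2, hf⟩) hrY)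
    · exact mem_union_right _ (mem_biUnion.2 ⟨i, mem_Icc.2 ⟨h1, h2⟩,
        mem_biUnion.2 ⟨e, h3, mem_sdiff.2 ⟨hre, hrY⟩⟩⟩)
  refine (A.value_mono hsub).trans ((A.value_union_le _ _).trans ?_)
  refine add_le_add_right ((A.value_biUnion_le _ _).trans ?_) _
  have h1 : ∀ i ∈ Icc 1 k, A.value ((s.layer i).X.biUnion fun e => e.2 \ resources (s.layer i).Y) ≤
      (s.layer i).X.card * (A.tau / A.lam) := by
    intro i hi
    rw [mem_Icc] at hi
    refine (A.value_biUnion_le _ _).trans ((sum_le_sum fun e he =>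
      (h.X_blocked i hi.1 (hi.2.trans hk) e he).le).trans ?_)
    rw [sum_const, nsmul_eq_mul]
  refine (sum_le_sum h1).trans ?_
  rw [← sum_mul, ← Nat.cast_sum]
  rfl

end Setting.Inv

end Values

/-! ### The players without a fat resource in an optimal allocation -/

section Optimum

variable {P : Type u} {R : Type w} [Fintype P] [Fintype R] [DecidableEq P] [DecidableEq R]

open Classical in
/-- The resources that player `p` desires and receives in the allocation `a`. -/
noncomputable def Setting.share (A : Setting P R) (a : R → P) (p : P) : Finset R :=
  univ.filter fun r => a r = p ∧ A.desires p r

lemma Setting.mem_share {A : Setting P R} {a : R → P} {p : P} {r : R} :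
    r ∈ A.share a p ↔ a r = p ∧ A.desires p r := by simp [Setting.share]

lemma Setting.exists_allocation (A : Setting P R) [Nonempty P] (h : A.tau ≤ A.optValue) :
    ∃ a : R → P, ∀ p, A.tau ≤ A.value (A.share a p) := by
  classical
  obtain ⟨a, ha⟩ := exists_eq_ciSup_of_finite (f := fun a : R → P => A.allocValue a)
  refine ⟨a, fun p => ?_⟩
  have h1 : A.tau ≤ A.allocValue a := by
    rw [ha]
    exact h
  refine h1.trans ((ciInf_le (Set.finite_range _).bddBelow p).trans ?_)
  rw [Setting.value, Setting.share, sum_filter]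

/-- Some maximum matching misses only players who receive no fat resource. -/
lemma Setting.exists_isMaxMatching_thin (A : Setting P R) (a : R → P) :
    ∃ M, A.IsMaxMatching M ∧ ∀ p ∈ unmatched M, ∀ r ∈ A.share a p, ¬ A.Fat r := by
  classical
  obtain ⟨M₀, hM₀⟩ := A.exists_isMaxMatching
  have hg : ∀ p : P, ∃ r : Option R, ∀ r', r' ∈ A.share a p → A.Fat r' →
      ∃ r'' ∈ A.share a p, r = some r'' ∧ A.Fat r'' := by
    intro p
    by_cases hp : ∃ r ∈ A.share a p, A.Fat r
    · obtain ⟨r, hr, hf⟩ := hp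
      exact ⟨some r, fun _ _ _ => ⟨r, hr, rfl, hf⟩⟩
    · exact ⟨none, fun r hr hf => absurd ⟨r, hr, hf⟩ hp⟩
  choose g hg using hg
  let N : Finset (P × R) := univ.filter fun m => g m.1 = some m.2 ∧ m.2 ∈ A.share a m.1 ∧ A.Fat m.2
  have hN : A.IsMatching N := by
    refine ⟨?_, ?_, ?_⟩
    · intro m hm
      have hm := (mem_filter.1 hm).2
      exact ⟨(mem_share.1 hm.2.1).2, hm.2.2⟩
    · rintro ⟨p, r⟩ hm ⟨p', r'⟩ hm' hpp
      obtain rfl : p = p' := hpp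
      have hm := (mem_filter.1 hm).2
      have hm' := (mem_filter.1 hm').2
      rw [Prod.mk.injEq]
      exact ⟨rfl, Option.some.inj (hm.1.symm.trans hm'.1)⟩
    · rintro ⟨p, r⟩ hm ⟨p', r'⟩ hm' hrr
      obtain rfl : r = r' := hrr
      have hm := (mem_filter.1 hm).2
      have hm' := (mem_filter.1 hm').2
      rw [Prod.mk.injEq]
      exact ⟨(mem_share.1 hm.2.1).1.symm.trans (mem_share.1 hm'.2.1).1, rfl⟩
  obtain ⟨M, hM, hsub⟩ := hN.exists_isMaxMatching hM₀
  refine ⟨M, hM, fun p hp r hr hf => ?_⟩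
  obtain ⟨r', hr', hgr, hf'⟩ := hg p r hr hf
  exact mem_unmatched.1 (hsub hp) r' (mem_filter.2 ⟨mem_univ _, hgr, hr', hf'⟩)

end Optimum

/-! ### Lists -/

section ListLemmas

variable {α : Type*}

lemma exists_split_of_lt_length_filter (f : α → Bool) (l : List α) {k : ℕ}
    (hk : k < (l.filter f).length) : ∃ l₁ e l₂, l = l₁ ++ e :: l₂ ∧
      l₁.filter f = (l.filter f).take k ∧ (l.filter f)[k]? = some e := by
  induction l generalizing k with
  | nil => simp at hk
  | cons a l ih =>
    by_cases ha : f a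
    · rw [List.filter_cons_of_pos ha] at hk ⊢
      rcases k with _ | k
      · exact ⟨[], a, l, rfl, by simp, by simp⟩
      · obtain ⟨l₁, e, l₂, h1, h2, h3⟩ := ih (by simpa using hk)
        exact ⟨a :: l₁, e, l₂, by rw [h1]; rfl, by rw [List.filter_cons_of_pos ha, h2]; rfl,
          by simpa using h3⟩
    · rw [List.filter_cons_of_neg ha] at hk ⊢
      obtain ⟨l₁, e, l₂, h1, h2, h3⟩ := ih hk
      exact ⟨a :: l₁, e, l₂, by rw [h1]; rfl, by rw [List.filter_cons_of_neg ha, h2], h3⟩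

lemma sum_range_getD (l : List ℝ) (d : ℝ) (m : ℕ) :
    ∑ k ∈ range (l.length + m), l.getD k d = l.sum + m * d := by
  induction l with
  | nil => simp
  | cons a l ih =>
    rw [List.length_cons, add_right_comm, sum_range_succ']
    simp only [List.getD_cons_succ, List.getD_cons_zero, List.sum_cons]
    rw [ih]
    ring

end ListLemmas

/-! ### Counting the unsatisfied players against an optimal allocation -/

section Counting

variable {P : Type u} {R : Type w} [Fintype P] [Fintype R] [DecidableEq P] [DecidableEq R]
variable {A : Setting P R} {s : State P R} {p₀ : P}

/-- The edges of the list `L` that are still in `𝒳_{j+1}`, in the order of `L`. -/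
def State.kept (s : State P R) (j : ℕ) (L : List (Edge P R)) : List (Edge P R) :=
  L.filter fun e => decide (e ∈ (s.layer (j + 1)).X)

/-- The closure of the unmatched players outside of `Y_{≤ j}`, of `I`, of `X_{≤ j}` and of the
first `k` players of the edges that are still in `𝒳_{j+1}`. It contains all players that were not
addable when the next of these edges was chosen. -/
noncomputable def Setting.reachX (A : Setting P R) (s : State P R) (j : ℕ) (L : List (Edge P R))
    (k : ℕ) : Finset P :=
  span A.rank (s.rest j ∪ players s.I ∪ players (s.Xle j) ∪
    players ((s.kept j L).take k).toFinset)

/-- The number `f_M(Y_{≤ j}, I)`, as the rank that `I` adds to the unmatched players outside of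
`Y_{≤ j}`. -/
noncomputable def Setting.excess (A : Setting P R) (s : State P R) (j : ℕ) : ℕ :=
  A.rank (s.rest j ∪ players s.I) - (s.rest j).card

namespace Setting.Record

variable {j : ℕ} {L : List (Edge P R)} {W : Finset P} {J : Finset (Edge P R)}
variable (hr : A.Record s j L W J)
include hr

lemma toFinset_kept : (s.kept j L).toFinset = (s.layer (j + 1)).X := by
  ext e
  simp only [State.kept, List.mem_toFinset, List.mem_filter, decide_eq_true_eq]
  exact ⟨And.right, fun he => ⟨List.mem_toFinset.1 (hr.subset he), he⟩⟩

lemma nodup_kept : (s.kept j L).Nodup := hr.nodup.filter _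

lemma length_kept : (s.kept j L).length = (s.layer (j + 1)).X.card := by
  rw [← hr.toFinset_kept, List.toFinset_card_of_nodup hr.nodup_kept]

lemma sum_kept (f : Edge P R → ℝ) :
    ((s.kept j L).map f).sum = ∑ e ∈ (s.layer (j + 1)).X, f e := by
  rw [← hr.toFinset_kept, List.sum_toFinset _ hr.nodup_kept]

/-- Edges that left `𝒳_{j+1}` do not contribute to the closure, since their players are in
`reach`. -/
lemma span_subset_reachX {L₁ L₂ : List (Edge P R)} {k : ℕ} (hL : L = L₁ ++ L₂)
    (hk : s.kept j L₁ = (s.kept j L).take k) :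
    span A.rank (W ∪ players J ∪ players (s.Xle j) ∪ players L₁.toFinset) ⊆
      A.reachX s j L k := by
  refine A.isRank.span_subset_span ?_
  have hreach : A.reach s j ⊆ A.reachX s j L k :=
    A.isRank.span_mono (subset_union_left.trans subset_union_left)
  refine union_subset (union_subset (hr.start.trans hreach) ?_) ?_
  · exact (subset_union_right.trans subset_union_left).trans (IsRank.subset_span _ _)
  · intro p hp
    obtain ⟨e, he, rfl⟩ := mem_players.1 hp
    rw [List.mem_toFinset] at he
    by_cases heX : e ∈ (s.layer (j + 1)).X
    · refine IsRank.subset_span _ _ (mem_union_right _ (mem_players.2 ⟨e, ?_, rfl⟩))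
      rw [List.mem_toFinset, ← hk]
      exact List.mem_filter.2 ⟨he, decide_eq_true heX⟩
    · exact hreach (hr.removed e (by rw [hL]; exact List.mem_append_left _ he) heX)

/-- A player outside of `reachX` whose share is worth at least `τ` loses at least `τ` minus the
value of the next edge to the covered resources `C`. -/
lemma le_value_inter {C O : Finset R}
    (hC : resources (s.Xle j ∪ s.Yle j ∪ J ∪ L.toFinset) ⊆ C) {q : P} {k : ℕ}
    (hq : q ∉ A.reachX s j L k) (hO : ∀ r ∈ O, A.desires q r ∧ ¬ A.Fat r)
    (hval : A.tau ≤ A.value O) :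
    A.tau - ((s.kept j L).map fun e => A.value e.2).getD k (A.tau / A.lam) ≤
      A.value (O ∩ C) := by
  have h1 := A.value_inter_add_sdiff O C
  have hO' : ∀ r ∈ O \ C, A.desires q r ∧ ¬ A.Fat r := fun r hr => hO r (mem_sdiff.1 hr).1
  rcases Nat.lt_or_ge k (s.kept j L).length with hk | hk
  · obtain ⟨L₁, e, L₂, hL, hL₁, he⟩ := exists_split_of_lt_length_filter _ L hk
    have h2 : ((s.kept j L).map fun e => A.value e.2).getD k (A.tau / A.lam) = A.value e.2 := by
      rw [List.getD_eq_getElem?_getD, List.getElem?_map]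
      change (Option.map _ ((List.filter _ L)[k]?)).getD _ = _
      rw [he]
      rfl
    rw [h2]
    have h3 := hr.before L₁ e L₂ hL q
      (fun hh => hq (hr.span_subset_reachX (L₂ := e :: L₂) hL hL₁ hh)) (O \ C) hO'
      (disjoint_sdiff_self_left.mono_right ((resources_mono (union_subset_union subset_rfl
        fun f hf => ?_)).trans hC))
    · rcases h3 with h3 | h3
      · linarith [A.value_nonneg (O ∩ C)]
      · linarith
    · rw [List.mem_toFinset] at hf ⊢
      rw [hL]
      exact List.mem_append_left _ hf
  · have h2 : ((s.kept j L).map fun e => A.value e.2).getD k (A.tau / A.lam) =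
        A.tau / A.lam := List.getD_eq_default _ _ (by rwa [List.length_map])
    rw [h2]
    have h3 := hr.after q (fun hh => hq (hr.span_subset_reachX (L₁ := L) (L₂ := []) (by simp)
      (List.take_of_length_le hk).symm hh)) (O \ C) hO'
      (disjoint_sdiff_self_left.mono_right hC)
    linarith

end Setting.Record

namespace Setting.Inv

variable (h : A.Inv p₀ s)
include h

lemma rank_rest_add (j : ℕ) : A.rank (s.rest j ∪ players s.I) = (s.rest j).card + A.excess s j := by
  have h1 := A.isRank.mono (subset_union_left (s₁ := s.rest j) (s₂ := players s.I))
  rw [h.rank_rest] at h1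
  rw [Setting.excess]
  lia

/-- `|𝒳_{≤ i+1}| ≤ |Y_{≤ i}|`, by `X_rank` and the rank of the matroid. -/
lemma sizeX_le {i : ℕ} (hi : 1 ≤ i) (hil : i + 1 ≤ s.ℓ) :
    s.sizeX (i + 1) ≤ (players (s.Yle i)).card := by
  have h1 := h.X_rank i hi hil
  have h2 := h.max.rank_le (s.rest i ∪ players s.I ∪ players (s.Xle (i + 1)))
  have h3 := h.card_rest_add (j := i) (by lia)
  lia

lemma sizeX_one : s.sizeX 1 = 0 := by simp [State.sizeX, h.X_one]

lemma card_rest_add_sizeX_succ_le {i : ℕ} (hil : i + 1 ≤ s.ℓ) :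
    (s.rest i).card + s.sizeX (i + 1) ≤ (unmatched s.M).card := by
  rcases Nat.eq_zero_or_pos i with rfl | hi
  · rw [State.rest_zero, h.sizeX_one, add_zero]
  · have h2 := h.sizeX_le hi hil
    have h3 := h.card_rest_add (j := i) (by lia)
    lia

/-- The closures `reachX` form a layered family. The top layer has `m` more positions than
`𝒳_{i+1}` has edges; they belong to the end of its construction. -/
lemma layeredFamily {i : ℕ} (hil : i + 1 ≤ s.ℓ) (L : ℕ → List (Edge P R)) (m : ℕ)
    {Φ n : ℕ → ℕ}
    (hΦ : ∀ l, Φ l = (s.rest l).card + s.sizeX (l + 1) + if l = i then m else 0)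
    (hn : ∀ l, n l = (s.layer (l + 1)).X.card + if l = i then m else 0) :
    LayeredFamily A.rank s.rest (fun j => A.reachX s j (L j)) n Φ (A.excess s) i where
  anti := s.rest_anti
  subset j _ k := (subset_union_left.trans (subset_union_left.trans subset_union_left)).trans
    (IsRank.subset_span _ _)
  base := by
    have h1 := h.max.rank_le univ
    rw [hΦ, State.rest_zero]
    lia
  upper j _ k _ := by
    have h1 : A.rank (A.reachX s j (L j) k) = _ := A.isRank.rank_span _
    have h2 := A.isRank.union_le (s.rest j ∪ players s.I ∪ players (s.Xle j))
      (players ((s.kept j (L j)).take k).toFinset)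
    have h3 := A.isRank.union_le (s.rest j ∪ players s.I) (players (s.Xle j))
    have h4 : (players ((s.kept j (L j)).take k).toFinset).card ≤ k :=
      card_image_le.trans ((List.toFinset_card_le _).trans (List.length_take_le _ _))
    have h5 : (players (s.Xle j)).card ≤ s.sizeX j := card_image_le.trans card_biUnion_le
    have h6 := h.rank_rest_add j
    have h7 := s.sizeX_succ j
    rw [hΦ, hn]
    lia
  lower j hj l hl k := by
    rw [mem_Icc] at hj
    rw [hΦ, if_neg (by lia), add_zero]
    rcases Nat.eq_zero_or_pos l with rfl | hl0
    · rw [h.sizeX_one, add_zero, ← h.rank_rest 0]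
      exact A.isRank.mono subset_union_left
    · refine (h.X_rank l hl0 (by lia)).trans (A.isRank.mono ?_)
      rw [union_assoc]
      refine union_subset_union subset_rfl ((union_subset_union subset_rfl
        (players_mono (State.Xle_mono (by lia : l + 1 ≤ j)))).trans ?_)
      refine Subset.trans ?_ (IsRank.subset_span A.rank _)
      rw [union_assoc (s.rest j)]
      exact subset_union_right.trans subset_union_left

/-- The layers of the stack are compared with an allocation of value `τ`: every player of
`Y_{≤ i}` accounts for a player who has no fat resource and who loses resources worth `τ` to the
resources covered by the layers, up to the value of an edge of `𝒳` or `τ/λ`. -/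
lemma tau_mul_card_le {i : ℕ} (hi : 1 ≤ i) (hil : i + 1 ≤ s.ℓ) (hu : 0 ≤ A.tau / A.lam)
    (hut : A.tau / A.lam ≤ A.tau) (hopt : A.tau ≤ A.optValue) :
    ((players (s.Yle i)).card : ℝ) * A.tau ≤
      2 * (A.tau / A.lam) * (players (s.Yle i)).card +
      4 * (A.tau / A.lam) * (players (s.Yle (i + 1))).card +
      (∑ j ∈ Icc 1 i, A.excess s j : ℕ) * (2 * A.tau + A.tau / A.lam) := by
  classical
  set u := A.tau / A.lam with hudef
  have : Nonempty P := ⟨p₀⟩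
  obtain ⟨a, ha⟩ := A.exists_allocation hopt
  obtain ⟨M, hM, hthin⟩ := A.exists_isMaxMatching_thin a
  have hrec : ∀ j, ∃ L W J, j ∈ Icc 1 i → A.Record s j L W J := by
    intro j
    by_cases hj : j ∈ Icc 1 i
    · obtain ⟨L, W, J, hr⟩ := h.record j (mem_Icc.1 hj).1 (by have := (mem_Icc.1 hj).2; lia)
      exact ⟨L, W, J, fun _ => hr⟩
    · exact ⟨[], ∅, ∅, fun hh => absurd hh hj⟩
  choose L W J hr using hrec
  set junk : ℕ → Finset R := fun j =>
    resources (J j) ∪ resources ((L j).toFinset \ (s.layer (j + 1)).X) with hjunk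
  set C : Finset R := (resources (s.Yle (i + 1)) ∪ resources (s.Xle (i + 1))) ∪
    (Icc 1 i).biUnion junk with hC
  set y := (players (s.Yle i)).card with hy
  set m := y - s.sizeX (i + 1) with hm
  have hsize := h.sizeX_le hi hil
  have hCj : ∀ j ∈ Icc 1 i,
      resources (s.Xle j ∪ s.Yle j ∪ J j ∪ (L j).toFinset) ⊆ C := by
    intro j hj r hrr
    have hji := (mem_Icc.1 hj).2
    obtain ⟨e, he, hre⟩ := mem_resources.1 hrr
    have hX : e ∈ s.Xle (i + 1) → r ∈ C := fun he =>
      mem_union_left _ (mem_union_right _ (mem_resources.2 ⟨e, he, hre⟩))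
    have hJ : r ∈ junk j → r ∈ C := fun hh => mem_union_right _ (mem_biUnion.2 ⟨j, hj, hh⟩)
    simp only [mem_union] at he
    rcases he with ((he | he) | he) | he
    · exact hX (State.Xle_mono (by lia) he)
    · exact mem_union_left _ (mem_union_left _
        (mem_resources.2 ⟨e, State.Yle_mono (by lia) he, hre⟩))
    · exact hJ (mem_union_left _ (mem_resources.2 ⟨e, he, hre⟩))
    · by_cases heX : e ∈ (s.layer (j + 1)).X
      · exact hX (State.mem_Xle.2 ⟨j + 1, by lia, by lia, heX⟩)
      · exact hJ (mem_union_right _ (mem_resources.2 ⟨e, mem_sdiff.2 ⟨he, heX⟩, hre⟩))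
  have hvalC : A.value C ≤ A.value (resources (s.Yle (i + 1))) + s.sizeX (i + 1) * u +
      (∑ j ∈ Icc 1 i, A.excess s j : ℕ) * (A.tau + u) := by
    have h1 := A.value_union_le (resources (s.Yle (i + 1)) ∪ resources (s.Xle (i + 1)))
      ((Icc 1 i).biUnion junk)
    have h2 := h.value_covered_le hil
    have h3 : ∀ j ∈ Icc 1 i, A.value (junk j) ≤ A.excess s j * (A.tau + u) := by
      intro j hj
      have hrj := hr j hj
      have h4 := hrj.card_le
      rw [h.rank_rest_add j] at h4
      have h5 : (J j).card + ((L j).toFinset \ (s.layer (j + 1)).X).card ≤ A.excess s j := by lia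
      have h6 : ((J j).card : ℝ) + ((L j).toFinset \ (s.layer (j + 1)).X).card ≤
        A.excess s j := by exact_mod_cast h5
      have h7 := A.value_union_le (resources (J j))
        (resources ((L j).toFinset \ (s.layer (j + 1)).X))
      have h8 : A.value (resources (J j)) ≤ (J j).card * (A.tau + u) :=
        A.value_resources_le fun e he => (hrj.value_le_of_mem e he).trans (by linarith)
      have h9 : A.value (resources ((L j).toFinset \ (s.layer (j + 1)).X)) ≤
          ((L j).toFinset \ (s.layer (j + 1)).X).card * (A.tau + u) :=
        A.value_resources_le fun e he =>
          hrj.value_le e (List.mem_toFinset.1 (mem_sdiff.1 he).1)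
      have h10 := mul_le_mul_of_nonneg_right h6 (by linarith : 0 ≤ A.tau + u)
      rw [add_mul] at h10
      linarith
    have h4 := (A.value_biUnion_le (Icc 1 i) junk).trans (sum_le_sum h3)
    rw [← sum_mul, ← Nat.cast_sum] at h4
    linarith
  -- the top layer gets `m` extra positions, of weight `τ - τ/λ`, so that there are `y` in total
  have hT : (unmatched M).card = (unmatched s.M).card := hM.card_unmatched_eq h.max
  have hsum := (h.layeredFamily hil L m (fun _ => rfl) (fun _ => rfl)).sum_le A.isRank
    (T := unmatched M) hM.rank_unmatched
    (fun l hl => by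
      rw [hT]
      by_cases hli : l = i
      · have h3 := h.card_rest_add (j := i) (by lia)
        subst hli
        rw [if_pos rfl]
        lia
      · rw [if_neg hli, add_zero]
        exact h.card_rest_add_sizeX_succ_le (by lia))
    (wt := fun j k => A.tau - ((s.kept j (L j)).map fun e => A.value e.2).getD k u)
    (c := fun t => A.value (A.share a t ∩ C)) (B := A.tau)
    (fun j k => by
      refine sub_le_self _ ?_
      rw [List.getD_eq_getElem?_getD, List.getElem?_map]
      cases (s.kept j (L j))[k]? with
      | none => exact hu
      | some e => exact A.value_nonneg _)
    (hu.trans hut) (fun t _ => A.value_nonneg _)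
    (fun j hj k _ t ht hk => (hr j hj).le_value_inter (hCj j hj) hk
      (fun r hrt => ⟨(mem_share.1 hrt).2, hthin t ht r hrt⟩) (ha t))
  have hTC : ∑ t ∈ unmatched M, A.value (A.share a t ∩ C) ≤ A.value C := by
    have h1 : A.value ((unmatched M).biUnion fun t => A.share a t ∩ C) =
        ∑ t ∈ unmatched M, A.value (A.share a t ∩ C) := by
      refine sum_biUnion fun t _ t' _ hne => disjoint_left.2 fun r hrt hrt' => hne ?_
      exact (mem_share.1 (mem_inter.1 hrt).1).1.symm.trans (mem_share.1 (mem_inter.1 hrt').1).1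
    rw [← h1]
    exact A.value_mono (biUnion_subset.2 fun t _ => inter_subset_right)
  have hinner : ∀ j ∈ Icc 1 i,
      ∑ k ∈ range ((s.layer (j + 1)).X.card + if j = i then m else 0),
        (A.tau - ((s.kept j (L j)).map fun e => A.value e.2).getD k u) =
      (s.layer (j + 1)).X.card * A.tau - ∑ e ∈ (s.layer (j + 1)).X, A.value e.2 +
        if j = i then m * (A.tau - u) else 0 := by
    intro j hj
    have hrj := hr j hj
    have h1 : (s.layer (j + 1)).X.card = ((s.kept j (L j)).map fun e => A.value e.2).length := by
      rw [List.length_map, hrj.length_kept]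
    rw [sum_sub_distrib, sum_const, card_range, nsmul_eq_mul]
    rw [← hrj.sum_kept fun e => A.value e.2]
    rw [h1, sum_range_getD]
    split_ifs <;> push_cast <;> ring
  rw [sum_congr rfl hinner, sum_add_distrib, sum_sub_distrib, ← sum_mul, ← Nat.cast_sum,
    sum_ite_eq' (Icc 1 i) i, if_pos (mem_Icc.2 ⟨hi, le_rfl⟩),
    sum_Icc_shift (f := fun j => (s.layer j).X.card) (by rw [h.X_one, card_empty]),
    sum_Icc_shift (f := fun j => ∑ e ∈ (s.layer j).X, A.value e.2)
      (by rw [h.X_one, sum_empty])] at hsum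
  change (s.sizeX (i + 1) : ℝ) * A.tau - _ + _ ≤ _ at hsum
  have hX := h.sum_value_X_le hil
  have hY := h.value_resources_Yle hu hil
  have hmy : (m : ℝ) = y - s.sizeX (i + 1) := by
    rw [hm, Nat.cast_sub hsize]
  rw [hmy] at hsum
  rw [← hudef] at hX hY
  nlinarith

/-- The growth of the sets `Y_j` turns the bound for each `Y_{≤ j}` into one for their sum. -/
lemma mul_sum_card_le {q : ℝ} {i : ℕ} (hi : 1 ≤ i) (hil : i ≤ s.ℓ)
    (hgrowth : ∀ j, 1 ≤ j → j < i →
      q * (players (s.Yle j)).card ≤ (players (s.layer (j + 1)).Y).card) :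
    q * ∑ j ∈ Icc 1 i, ((players (s.Yle j)).card : ℝ) ≤ (1 + q) * (players (s.Yle i)).card := by
  induction i, hi using Nat.le_induction with
  | base =>
    rw [Icc_self, sum_singleton]
    nlinarith [Nat.cast_nonneg (α := ℝ) (players (s.Yle 1)).card]
  | succ k hk ih =>
    have h1 := ih (by lia) fun j hj hjk => hgrowth j hj (by lia)
    have h2 := hgrowth k hk (by lia)
    rw [sum_Icc_succ_top (by lia), mul_add]
    have h3 := h.card_players_Yle_succ hil
    have h4 : ((players (s.Yle (k + 1))).card : ℝ) =
        (players (s.Yle k)).card + (players (s.layer (k + 1)).Y).card := by exact_mod_cast h3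
    rw [h4]
    linarith

lemma one_le_card_Yle {i : ℕ} (hi : 1 ≤ i) : 1 ≤ (players (s.Yle i)).card :=
  card_pos.2 ⟨p₀, mem_players.2 ⟨(p₀, ∅), State.mem_Yle.2 ⟨1, le_rfl, hi, by simp [h.Y_one]⟩, rfl⟩⟩

/-- When thin edges need no value at all, the construction of a layer leaves no player that could
be added. -/
lemma card_Yle_le_excess (hu : A.tau / A.lam = 0) {i : ℕ} (hi : 1 ≤ i) (hil : i + 1 ≤ s.ℓ) :
    (players (s.Yle i)).card ≤ A.excess s i := by
  have hX : ∀ k, 1 ≤ k → k ≤ s.ℓ → (s.layer k).X = ∅ := fun k hk hkl =>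
    eq_empty_of_forall_notMem fun e he => absurd (h.X_blocked k hk hkl e he)
      (by rw [hu]; exact not_lt.2 (A.value_nonneg _))
  have hXle : s.Xle i = ∅ := eq_empty_of_forall_notMem fun e he => by
    obtain ⟨k, h1, h2, h3⟩ := State.mem_Xle.1 he
    rw [hX k h1 (by lia)] at h3
    exact notMem_empty e h3
  obtain ⟨L, W, J, hr⟩ := h.record i hi hil
  have hall : (univ : Finset P) ⊆ A.reach s i := by
    intro q _
    have h1 : q ∈ span A.rank (W ∪ players J ∪ players (s.Xle i) ∪ players L.toFinset) := by
      by_contra hq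
      have := hr.after q hq ∅ (by simp) (disjoint_empty_left _)
      rw [hu] at this
      exact absurd this (not_lt.2 (A.value_nonneg _))
    refine A.isRank.span_subset_span ?_ h1
    rw [hXle, players_empty, union_empty]
    refine union_subset hr.start fun p hp => ?_
    obtain ⟨e, he, rfl⟩ := mem_players.1 hp
    exact hr.removed e (List.mem_toFinset.1 he) (by rw [hX (i + 1) (by lia) hil]; simp)
  have h1 := (A.isRank.mono (subset_univ (unmatched s.M))).trans
    (A.isRank.rank_le_of_subset_span hall)
  rw [h.max.rank_unmatched, h.rank_rest_add, ← h.card_rest_add (j := i) (by lia)] at h1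
  lia

/-- If the sets `Y_2, …, Y_i` are large compared with the layers below them, but `Y_{i+1}` is not,
then one of the layers `L_1, …, L_i` is collapsible. -/
lemma exists_collapsible {δ : ℝ} (hδ0 : 0 < δ) (hδ1 : δ < 1) (hlam : A.lam = 6 + δ)
    (hmu : A.mu = (δ / 40) ^ 2) (htau : 0 ≤ A.tau) (hopt : A.tau ≤ A.optValue) {i : ℕ}
    (hi : 1 ≤ i) (hil : i + 1 ≤ s.ℓ)
    (hgrowth : ∀ j, 1 ≤ j → j < i →
      δ / 40 * (players (s.Yle j)).card ≤ (players (s.layer (j + 1)).Y).card)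
    (hsmall : ((players (s.layer (i + 1)).Y).card : ℝ) < δ / 40 * (players (s.Yle i)).card) :
    ∃ j, 1 ≤ j ∧ j ≤ i ∧ A.Collapsible s j := by
  by_contra! hnc
  have hlam0 : 0 < A.lam := by linarith
  have htu : A.tau = A.lam * (A.tau / A.lam) := by field_simp
  have hu : 0 ≤ A.tau / A.lam := div_nonneg htau hlam0.le
  have hut : A.tau / A.lam ≤ A.tau := div_le_self htau (by linarith)
  have hexc : ∀ j, 1 ≤ j → j ≤ i →
      (A.excess s j : ℝ) ≤ (δ / 40) ^ 2 * (players (s.Yle j)).card := by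
    intro j hj hji
    have h1 := h.rank_le_of_not_collapsible (by lia : i ≤ s.ℓ) hnc hj hji
    rw [h.rank_rest_add, hmu] at h1
    push_cast at h1
    linarith
  have hy : (1 : ℝ) ≤ (players (s.Yle i)).card := by exact_mod_cast h.one_le_card_Yle hi
  set y : ℝ := ((players (s.Yle i)).card : ℝ) with hydef
  rcases hu.eq_or_lt with hu0 | hu0
  · have h1 : y ≤ A.excess s i := by
      rw [hydef]
      exact_mod_cast h.card_Yle_le_excess hu0.symm hi hil
    have h2 := hexc i hi le_rfl
    nlinarith
  set u := A.tau / A.lam with hudef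
  have hsum : ((∑ j ∈ Icc 1 i, A.excess s j : ℕ) : ℝ) ≤ δ / 40 * ((1 + δ / 40) * y) := by
    push_cast
    refine (sum_le_sum fun j hj => hexc j (mem_Icc.1 hj).1 (mem_Icc.1 hj).2).trans ?_
    rw [← mul_sum, sq, mul_assoc]
    exact mul_le_mul_of_nonneg_left (h.mul_sum_card_le hi (by lia) hgrowth)
      (by positivity)
  have hmain := h.tau_mul_card_le hi hil hu hut hopt
  have hsucc : ((players (s.Yle (i + 1))).card : ℝ) =
      y + (players (s.layer (i + 1)).Y).card := by
    rw [hydef]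
    exact_mod_cast h.card_players_Yle_succ hil
  rw [← hudef, ← hydef, hsucc] at hmain
  set e : ℝ := ((∑ j ∈ Icc 1 i, A.excess s j : ℕ) : ℝ) with he
  set y' : ℝ := ((players (s.layer (i + 1)).Y).card : ℝ) with hy'
  have h1 : u * (y * (6 + δ)) ≤ u * (6 * y + 4 * y' + e * (2 * (6 + δ) + 1)) := by
    rw [htu, hlam] at hmain
    linarith
  have h2 := le_of_mul_le_mul_left h1 hu0
  have h3 : e ≤ δ / 40 * (2 * y) := by
    refine hsum.trans (mul_le_mul_of_nonneg_left ?_ (by positivity))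
    nlinarith
  -- the error terms add up to at most `(4 + 2 * 15) * (δ / 40) * y < δ * y`
  have h4 : e * (2 * (6 + δ) + 1) ≤ δ / 40 * (2 * y) * 15 :=
    mul_le_mul h3 (by linarith) (by linarith)
      (mul_nonneg (by linarith) (by linarith))
  nlinarith [mul_pos hδ0 (by linarith : 0 < y)]

end Setting.Inv

end Counting

end FairAlloc

theorem lemma4p1 (δ : ℝ) (hδ0 : 0 < δ) (hδ1 : δ < 1) :
    ∃ μ : ℝ, 0 < μ ∧ μ < 1 ∧
      ∀ (P : Type u) (R : Type w) [Fintype P] [Fintype R] [DecidableEq P] [DecidableEq R]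
        (A : FairAlloc.Problem P R) (τ : ℝ), 0 ≤ τ → τ ≤ A.optValue →
        ∀ (S : FairAlloc.Setting P R), S = ⟨A, τ, 6 + δ, μ⟩ →
        ∀ (s : FairAlloc.State P R), S.IsState s →
        ∀ i : ℕ, 1 ≤ i → i + 1 ≤ s.ℓ →
          ((FairAlloc.players (s.layer (i + 1)).Y).card : ℝ) <
            Real.sqrt μ * ((FairAlloc.players (s.Yle i)).card : ℝ) →
          ∃ j : ℕ, 1 ≤ j ∧ j ≤ i ∧ S.Collapsible s j := by
  refine ⟨(δ / 40) ^ 2, by positivity, by nlinarith, ?_⟩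
  rintro P R _ _ _ _ A τ hτ hopt S rfl s hs i hi hil hsmall
  rw [Real.sqrt_sq (by positivity)] at hsmall
  have hτ' : τ / (6 + δ) ≤ τ := div_le_self hτ (by linarith)
  obtain ⟨p₀, h⟩ := hs.exists_inv (div_nonneg hτ (by positivity)) hτ'
  -- take the lowest layer that is small compared with the layers below it
  induction i using Nat.strong_induction_on with
  | _ i ih =>
    by_cases hg : ∀ j, 1 ≤ j → j < i →
        δ / 40 * ((FairAlloc.players (s.Yle j)).card : ℝ) ≤
          (FairAlloc.players (s.layer (j + 1)).Y).card
    · exact h.exists_collapsible hδ0 hδ1 rfl rfl hτ hopt hi hil hg hsmall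
    · push Not at hg
      obtain ⟨j, hj, hji, hlt⟩ := hg
      obtain ⟨k, hk, hkj, hc⟩ := ih j hji hj (by lia) hlt
      exact ⟨k, hk, by lia, hc⟩
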